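/- Let $\mathsf C$ be a finite category (finitely many objects and morphisms) which is split, i.e. for every morphism $s\colon X\to Y$ there is a morphism $t\colon Y\to X$ with $s\circ t\circ s=s$. Let $k$ be a field and let $\alpha$ be a $2$-cocycle of $\mathsf C$ with values in $k^\times$, i.e. a family of elements $\alpha(t,s)\in k^\times$, one for each pair with $t\circ s$ defined, such that $\alpha(u\circ t,s)\alpha(u,t)=\alpha(u,t\circ s)\alpha(t,s)$ whenever $t\circ s$ and $u\circ t$ are defined. Let $A=k_\alpha\mathsf C$ be the twisted category algebra: it has $k$-basis $\mathrm{Mor}(\mathsf C)$ and product $t\cdot s=\alpha(t,s)\,t\circ s$ if $t\circ s$ is defined, and $t\cdot s=0$ otherwise. For an idempotent $e\in\mathrm{End}_{\mathsf C}(X)$ let $\Gamma_e$ be the group of invertible elements of the monoid $e\circ\mathrm{End}_{\mathsf C}(X)\circ e$, let $J_e$ be the set of its non-invertible elements, and put $e'=\alpha(e,e)^{-1}e$, an idempotent of $A$; thus $e'Ae'=k_\alpha\Gamma_e\oplus kJ_e$, where $kJ_e$ is a two-sided ideal. Assume that $|\Gamma_e|$ is invertible in $k$ for every idempotent $e$ of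 $\mathsf C$. Idempotents $e$ on $X$ and $f$ on $Y$ are equivalent if $e=s\circ t$ and $f=t\circ s$ for some $s\in e\circ\mathrm{Hom}_{\mathsf C}(Y,X)\circ f$ and $t\in f\circ\mathrm{Hom}_{\mathsf C}(X,Y)\circ e$. Let $e_1,\dots,e_n$ be representatives of the equivalence classes of idempotents of $\mathsf C$, and for each $i$ let $T_{i1},\dots,T_{il_i}$ be representatives of the isomorphism classes of simple $k_\alpha\Gamma_{e_i}$-modules. Let $\tilde T_{ir}$ be the inflation of $T_{ir}$ to $e_i'Ae_i'$ (with $kJ_{e_i}$ acting as zero), and put $$\Delta_{ir}=Ae_i'\otimes_{e_i'Ae_i'}\tilde T_{ir},\qquad D_{ir}=\Delta_{ir}/\mathrm{Rad}(\Delta_{ir}).$$ Let $\Lambda=\{(i,r)\mid 1\le i\le n,\ 1\le r\le l_i\}$, partially ordered by $$(i,r)<(j,s)\iff \mathrm{Mor}(\mathsf C)\circ e_j\circ\mathrm{Mor}(\mathsf C)\subsetneq\mathrm{Mor}(\mathsf C)\circ e_i\circ\mathrm{Mor}(\mathsf C),$$ that is, iff the $\mathscr J$-class of $e_j$ is strictly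 below that of $e_i$. Then $A$ is a quasi-hereditary algebra (it is finite-dimensional and has a heredity chain of two-sided ideals), the modules $D_{ir}$, $(i,r)\in\Lambda$, form a set of representatives of the isomorphism classes of simple $A$-modules, and the modules $\Delta_{ir}$ are the standard modules of $A$ with respect to $\le$. The latter means that, for each $(i,r)\in\Lambda$, the simple module $D_{ir}$ has a projective cover $P_{ir}$, and $\Delta_{ir}$ is isomorphic to the largest quotient module $M$ of $P_{ir}$ such that every composition factor of $\mathrm{Rad}(M)$ is isomorphic to some $D_{js}$ with $(j,s)<(i,r)$. In particular, $\Delta_{ir}$ has simple head $D_{ir}$, and every composition factor of $\mathrm{Rad}(\Delta_{ir})$ is isomorphic to some $D_{js}$ with $(j,s)<(i,r)$. Moreover, every projective cover $P_{ir}$ of $D_{ir}$ has a filtration $0=P^{(0)}\subset P^{(1)}\subset\cdots\subset P^{(m)}=P_{ir}$ with $m\ge1$ and $P^{(m)}/P^{(m-1)}\cong\Delta_{ir}$ such that, for each $1\le q\le m-1$, $P^{(q)}/P^{(q-1)}\cong\Delta_{js}$ for some $(j,s)\in\Lambda$ with $(i,r)<(j,s)$. -/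

import Mathlib

open CategoryTheory
open scoped TensorProduct

universe v u w x y

noncomputable section

/-! ### Module-theoretic notions over an arbitrary ring -/

/-- The family `D` is a set of representatives of the isomorphism classes of simple `R`-modules.
(Every simple `R`-module is isomorphic to a quotient of `R`, so that it suffices to let `M` range
over the universe of `R`.) -/
structure IsSimpleReps (R : Type u) [Ring R] {L : Type*} (D : L → Type*)
    [∀ i, AddCommGroup (D i)] [∀ i, Module R (D i)] : Prop where
  simple : ∀ i, IsSimpleModule R (D i)
  pairwise : ∀ i j, Nonempty (D i ≃ₗ[R] D j) → i = j
  exhaustive : ∀ (M : Type u) [AddCommGroup M] [Module R M], IsSimpleModule R M →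
    ∃ i, Nonempty (M ≃ₗ[R] D i)

/-- The head `M / Rad M` of a module, where `Rad M` is the intersection of the maximal
submodules of `M`. -/
abbrev Head (R : Type*) [Ring R] (M : Type*) [AddCommGroup M] [Module R M] : Type _ :=
  M ⧸ Module.jacobson R M

/-- Every composition factor of `M`, i.e. every simple subquotient `N₂ / N₁`, is isomorphic to
some `D i` with `i ∈ s`. -/
def FactorsAmong (R : Type*) [Ring R] {L : Type*} (D : L → Type*)
    [∀ i, AddCommGroup (D i)] [∀ i, Module R (D i)] (s : Set L)
    (M : Type*) [AddCommGroup M] [Module R M] : Prop :=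
  ∀ N₁ N₂ : Submodule R M, N₁ ⋖ N₂ →
    ∃ i ∈ s, Nonempty ((N₂ ⧸ N₁.submoduleOf N₂) ≃ₗ[R] D i)

/-- `π : P → M` is a projective cover: `P` is projective, and `π` is surjective with
superfluous kernel. -/
structure IsProjectiveCover {R : Type*} [Ring R] {P M : Type*} [AddCommGroup P] [Module R P]
    [AddCommGroup M] [Module R M] (π : P →ₗ[R] M) : Prop where
  projective : Module.Projective R P
  surjective : Function.Surjective π
  superfluous : ∀ N : Submodule R P, N ⊔ LinearMap.ker π = ⊤ → N = ⊤

/-- `M` is the standard module of weight `a`, with respect to the family `D` of simple modules and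
the partial order on the set `L` of weights: `M` is isomorphic to the largest quotient `P / K` of
a projective cover `P` of `D a` such that every composition factor of `Rad (P / K)` is isomorphic
to some `D b` with `b < a`. -/
def IsStandardModule (R : Type u) [Ring R] {L : Type*} [PartialOrder L] (D : L → Type*)
    [∀ i, AddCommGroup (D i)] [∀ i, Module R (D i)] (a : L)
    (M : Type*) [AddCommGroup M] [Module R M] : Prop :=
  ∃ (P : Type u) (_ : AddCommGroup P) (_ : Module R P) (π : P →ₗ[R] D a) (K : Submodule R P),
    IsProjectiveCover π ∧
    IsLeast {K' : Submodule R P | FactorsAmong R D {b | b < a} (Module.jacobson R (P ⧸ K'))} K ∧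
    Nonempty ((P ⧸ K) ≃ₗ[R] M)

/-- `P` has a filtration `0 = F 0 ⊂ F 1 ⊂ ⋯ ⊂ F (m + 1) = P` with top factor `Δ a` and all of whose
other factors are of the form `Δ b` with `a < b`. -/
def HasStandardFiltration (R : Type*) [Ring R] {L : Type*} [PartialOrder L] (Δ : L → Type*)
    [∀ i, AddCommGroup (Δ i)] [∀ i, Module R (Δ i)] (a : L)
    (P : Type*) [AddCommGroup P] [Module R P] : Prop :=
  ∃ (m : ℕ) (F : ℕ → Submodule R P), F 0 = ⊥ ∧ F (m + 1) = ⊤ ∧ (∀ q ≤ m, F q < F (q + 1)) ∧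
    Nonempty ((P ⧸ F m) ≃ₗ[R] Δ a) ∧
    ∀ q < m, ∃ b, a < b ∧
      Nonempty ((F (q + 1) ⧸ (F q).submoduleOf (F (q + 1))) ≃ₗ[R] Δ b)

/-! ### Quasi-hereditary algebras -/

/-- `I` is a heredity ideal of the ring `B`: it is of the form `B ε B` for an idempotent `ε`, it
satisfies `I J(B) I = 0`, and it is projective as a `B`-module. -/
structure IsHeredityIdeal (B : Type*) [Ring B] (I : Ideal B) : Prop where
  idempotent : ∃ ε : B, IsIdempotentElem ε ∧ I = Ideal.span {x | ∃ a b, x = a * ε * b}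
  radical : ∀ x ∈ I, ∀ y ∈ Ring.jacobson B, ∀ z ∈ I, x * y * z = 0
  projective : Module.Projective B I

/-- A heredity chain `0 = J 0 ⊂ J 1 ⊂ ⋯ ⊂ J n = A` of two-sided ideals: each `J (i + 1) / J i` is a
heredity ideal of `A / J i`. -/
structure IsHeredityChain (A : Type*) [Ring A] {n : ℕ} (J : Fin (n + 1) → Ideal A) : Prop where
  twoSided : ∀ i, (J i).IsTwoSided
  bot : J 0 = ⊥
  top : J (Fin.last n) = ⊤
  strict : StrictMono J
  heredity : ∀ i : Fin n,
    haveI := twoSided i.castSucc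
    IsHeredityIdeal (A ⧸ J i.castSucc) ((J i.succ).map (Ideal.Quotient.mk (J i.castSucc)))

/-- Quasi-hereditary finite-dimensional algebras over a field, in the sense of
Cline, Parshall and Scott. -/
def IsQuasiHereditary (k : Type*) [Field k] (A : Type*) [Ring A] [Algebra k A] : Prop :=
  Module.Finite k A ∧ ∃ (n : ℕ) (J : Fin (n + 1) → Ideal A), IsHeredityChain A J

/-! ### Tensor products over noncommutative rings -/

/-- `M ⊗_B N` for an `(A, B)`-bimodule `M` and a left `B`-module `N`, as a left `A`-module: the
quotient of `M ⊗_ℤ N` by the relations `(m b) ⊗ n = m ⊗ (b n)`. -/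
abbrev BalancedTensor (A : Type*) [Ring A] (B : Type*) [Ring B]
    (M : Type*) [AddCommGroup M] [Module A M] [Module Bᵐᵒᵖ M] [SMulCommClass A Bᵐᵒᵖ M]
    (N : Type*) [AddCommGroup N] [Module B N] : Type _ :=
  (M ⊗[ℤ] N) ⧸ Submodule.span A
    {z : M ⊗[ℤ] N | ∃ (m : M) (b : B) (n : N),
      z = (MulOpposite.op b • m) ⊗ₜ[ℤ] n - m ⊗ₜ[ℤ] (b • n)}

section AeBimodule

variable {A : Type*} [Ring A] {e : A}

/-- The left ideal `Ae` of `A`, for an idempotent `e`. -/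
abbrev leftIdeal (_ : IsIdempotentElem e) : Ideal A := Ideal.span {e}

lemma leftIdeal_mul (he : IsIdempotentElem e) (a : leftIdeal he) : (a : A) * e = a := by
  obtain ⟨c, hc⟩ := Ideal.mem_span_singleton'.1 a.2
  rw [← hc, mul_assoc, he.eq]

/-- The right action of `eAe` on `Ae` by multiplication. -/
instance leftIdealModule (he : IsIdempotentElem e) : Module he.Cornerᵐᵒᵖ (leftIdeal he) where
  smul b a := ⟨(a : A) * b.unop.1, by
    rw [Ideal.mem_span_singleton']
    refine ⟨a * b.unop.1, ?_⟩
    rw [mul_assoc, ((Subsemigroup.mem_corner_iff he).1 b.unop.2).2]⟩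
  one_smul a := Subtype.ext (leftIdeal_mul he a)
  mul_smul b c a := Subtype.ext (mul_assoc (a : A) c.unop.1 b.unop.1).symm
  smul_zero b := Subtype.ext (zero_mul b.unop.1)
  smul_add b a a' := Subtype.ext (add_mul (a : A) a' b.unop.1)
  add_smul b c a := Subtype.ext (mul_add (a : A) b.unop.1 c.unop.1)
  zero_smul a := Subtype.ext (mul_zero (a : A))

instance leftIdealSMulComm (he : IsIdempotentElem e) :
    SMulCommClass A he.Cornerᵐᵒᵖ (leftIdeal he) where
  smul_comm a b x := Subtype.ext (mul_assoc a (x : A) b.unop.1).symm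

end AeBimodule

/-! ### Morphisms, idempotents and `J`-classes of a category -/

/-- The morphisms of `C`. -/
@[ext]
structure Mor (C : Type u) [Category.{v} C] where
  dom : C
  cod : C
  hom : dom ⟶ cod

/-- The category is split (von Neumann regular). -/
def IsSplitCat (C : Type u) [Category.{v} C] : Prop :=
  ∀ ⦃X Y : C⦄ (s : X ⟶ Y), ∃ t : Y ⟶ X, s ≫ t ≫ s = s

/-- The idempotents of `C`. -/
structure Idem (C : Type u) [Category.{v} C] where
  obj : C
  hom : obj ⟶ obj
  idem : hom ≫ hom = hom

namespace Idem

variable {C : Type u} [Category.{v} C]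

/-- An idempotent, as a morphism of `C`. -/
def toMor (e : Idem C) : Mor C := ⟨e.obj, e.obj, e.hom⟩

/-- Equivalence of idempotents `e` on `X` and `f` on `Y`: there are `s ∈ e ∘ Hom(Y, X) ∘ f` and
`t ∈ f ∘ Hom(X, Y) ∘ e` with `e = s ∘ t` and `f = t ∘ s`. -/
def Equivalent (e f : Idem C) : Prop :=
  ∃ (s : f.obj ⟶ e.obj) (t : e.obj ⟶ f.obj),
    (∃ s' : f.obj ⟶ e.obj, s = f.hom ≫ s' ≫ e.hom) ∧
    (∃ t' : e.obj ⟶ f.obj, t = e.hom ≫ t' ≫ f.hom) ∧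
    e.hom = t ≫ s ∧ f.hom = s ≫ t

/-- The monoid `e ∘ End(X) ∘ e`, for an idempotent `e` on `X`. -/
def LocalMonoid (e : Idem C) : Type v :=
  {f : e.obj ⟶ e.obj // ∃ g : e.obj ⟶ e.obj, f = e.hom ≫ g ≫ e.hom}

lemma hom_comp (e : Idem C) (f : e.LocalMonoid) : e.hom ≫ f.1 = f.1 := by
  obtain ⟨f, g, rfl⟩ := f
  simp only [← Category.assoc, e.idem]

lemma comp_hom (e : Idem C) (f : e.LocalMonoid) : f.1 ≫ e.hom = f.1 := by
  obtain ⟨f, g, rfl⟩ := f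
  simp only [Category.assoc, e.idem]

/-- The product `f * g` is the composite `f ∘ g`; the identity is `e`. -/
instance (e : Idem C) : Monoid e.LocalMonoid where
  mul f g := ⟨g.1 ≫ f.1, g.1 ≫ f.1, by
    rw [Category.assoc, e.comp_hom f, ← Category.assoc, e.hom_comp g]⟩
  one := ⟨e.hom, e.hom, by rw [e.idem, e.idem]⟩
  mul_assoc f g h := Subtype.ext (Category.assoc h.1 g.1 f.1).symm
  one_mul f := Subtype.ext (e.comp_hom f)
  mul_one f := Subtype.ext (e.hom_comp f)

/-- The maximal subgroup `Γ_e`: the group of invertible elements of `e ∘ End(X) ∘ e`. -/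
abbrev Gam (e : Idem C) : Type v := e.LocalMonoidˣ

lemma mul_val (e : Idem C) (f g : e.LocalMonoid) : (f * g).1 = g.1 ≫ f.1 := rfl

lemma one_val (e : Idem C) : (1 : e.LocalMonoid).1 = e.hom := rfl

instance [∀ X Y : C, Finite (X ⟶ Y)] (e : Idem C) : Finite e.LocalMonoid :=
  inferInstanceAs (Finite (Subtype _))

end Idem

/-- The family `e` is a set of representatives of the equivalence classes of idempotents. -/
def IsIdemReps {C : Type u} [Category.{v} C] {n : ℕ} (e : Fin n → Idem C) : Prop :=
  ∀ f : Idem C, ∃! i, f.Equivalent (e i)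

/-- The two-sided ideal `Mor(C) ∘ T ∘ Mor(C)` of `C` generated by a set `T` of morphisms. -/
def idealGen {C : Type u} [Category.{v} C] (T : Set (Mor C)) : Set (Mor C) :=
  {y | ∃ s ∈ T, ∃ (a : y.dom ⟶ s.dom) (b : s.cod ⟶ y.cod), y.hom = a ≫ s.hom ≫ b}

/-- The `J`-class of a morphism `s`. -/
def jClass {C : Type u} [Category.{v} C] (s : Mor C) : Set (Mor C) :=
  {t | idealGen {t} = idealGen {s}}

/-- The strict order `I <_J J` on `J`-classes. -/
def JLT {C : Type u} [Category.{v} C] (I J : Set (Mor C)) : Prop := idealGen I ⊂ idealGen J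

/-- The index set `Λ` of all pairs `(i, r)` with `r = 1, …, l i`. It depends on the representatives
`e i` only through its partial order. -/
def Weight {C : Type u} [Category.{v} C] {n : ℕ} (_ : Fin n → Idem C) (l : Fin n → ℕ) : Type :=
  Σ i : Fin n, Fin (l i)

/-- The partial order on `Λ`, given by `(i, r) < (j, s)` iff the `J`-class of `e j` is strictly
below the `J`-class of `e i`. -/
instance {C : Type u} [Category.{v} C] {n : ℕ} (e : Fin n → Idem C) (l : Fin n → ℕ) :
    PartialOrder (Weight e l) where
  lt p q := JLT (jClass (e q.1).toMor) (jClass (e p.1).toMor)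
  le p q := p = q ∨ JLT (jClass (e q.1).toMor) (jClass (e p.1).toMor)
  le_refl p := Or.inl rfl
  le_trans p q r := by
    rintro (rfl | h) (rfl | h')
    · exact Or.inl rfl
    · exact Or.inr h'
    · exact Or.inr h
    · exact Or.inr (lt_trans h' h)
  le_antisymm p q := by
    rintro (rfl | h) (h' | h')
    · rfl
    · rfl
    · exact h'.symm
    · exact absurd (lt_trans h' h) (ssubset_irrefl _)
  lt_iff_le_not_ge p q := by
    constructor
    · intro h
      refine ⟨Or.inr h, ?_⟩
      rintro (rfl | h')
      · exact ssubset_irrefl _ h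
      · exact ssubset_irrefl _ (lt_trans h' h)
    · rintro ⟨rfl | h, h'⟩
      · exact absurd (Or.inl rfl) h'
      · exact h

/-! ### Twisted category algebras -/

/-- A `2`-cocycle of `C` with values in `kˣ`; `α t s` is the value at `(t, s)`, for `t ∘ s`
defined. -/
structure TwoCocycle (C : Type u) [Category.{v} C] (k : Type w) [Field k] where
  val : ∀ {X Y Z : C}, (Y ⟶ Z) → (X ⟶ Y) → kˣ
  cocycle : ∀ {W X Y Z : C} (s : W ⟶ X) (t : X ⟶ Y) (u : Y ⟶ Z),
    val (t ≫ u) s * val u t = val u (s ≫ t) * val t s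

/-- The twisted category algebra `k_α C`: the `k`-vector space with basis `Mor(C)`. -/
def TwistedAlg {C : Type u} [Category.{v} C] {k : Type w} [Field k] (_ : TwoCocycle C k) :
    Type (max u v w) :=
  Mor C →₀ k

namespace TwistedAlg

variable {C : Type u} [Category.{v} C] {k : Type w} [Field k] (α : TwoCocycle C k)

instance : AddCommGroup (TwistedAlg α) := inferInstanceAs (AddCommGroup (Mor C →₀ k))
instance : Module k (TwistedAlg α) := inferInstanceAs (Module k (Mor C →₀ k))

/-- The basis element belonging to a morphism `s`. -/
def of (s : Mor C) : TwistedAlg α := (Finsupp.single s 1 : Mor C →₀ k)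

open Classical in
/-- The product `t · s` of two basis elements: `α(t, s) (t ∘ s)` if `t ∘ s` exists, and `0`
otherwise. -/
def basisMul (t s : Mor C) : TwistedAlg α :=
  if h : s.cod = t.dom then
    ((α.val t.hom (s.hom ≫ eqToHom h) : kˣ) : k) • of α ⟨s.dom, t.cod, s.hom ≫ eqToHom h ≫ t.hom⟩
  else 0

/-- The bilinear extension of `basisMul`. -/
def mulHom : TwistedAlg α →ₗ[k] TwistedAlg α →ₗ[k] TwistedAlg α :=
  Finsupp.lift (TwistedAlg α →ₗ[k] TwistedAlg α) k (Mor C)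
    (fun t => Finsupp.lift (TwistedAlg α) k (Mor C) (fun s => basisMul α t s))

instance : Mul (TwistedAlg α) := ⟨fun a b => mulHom α a b⟩

variable {α}

lemma mul_def (a b : TwistedAlg α) : a * b = mulHom α a b := rfl

@[elab_as_elim]
lemma induction {p : TwistedAlg α → Prop} (a : TwistedAlg α) (zero : p 0)
    (add : ∀ a b, p a → p b → p (a + b)) (single : ∀ (c : k) (s : Mor C), p (c • of α s)) : p a := by
  refine Finsupp.induction_linear (motive := p) a zero add fun s c => ?_
  have : (Finsupp.single s c : Mor C →₀ k) = c • Finsupp.single s 1 := by simp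
  exact this ▸ single c s

variable (α)

lemma of_mul (t s : Mor C) : of α t * of α s = basisMul α t s := by
  have h (t : Mor C) : mulHom α (of α t) =
      Finsupp.lift (TwistedAlg α) k (Mor C) (fun s => basisMul α t s) := by
    refine (Finsupp.sum_single_index ?_).trans (one_smul k _)
    exact zero_smul k _
  rw [mul_def, h]
  refine (Finsupp.sum_single_index ?_).trans (one_smul k _)
  exact zero_smul k _

lemma of_mul_of {X Y Z : C} (t : Y ⟶ Z) (s : X ⟶ Y) :
    of α ⟨Y, Z, t⟩ * of α ⟨X, Y, s⟩ = ((α.val t s : kˣ) : k) • of α ⟨X, Z, s ≫ t⟩ := by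
  rw [of_mul]
  simp [basisMul]

lemma of_mul_ne {t s : Mor C} (h : s.cod ≠ t.dom) : of α t * of α s = 0 := by
  rw [of_mul]
  simp [basisMul, h]

variable {α}

lemma mul_add' (a b c : TwistedAlg α) : a * (b + c) = a * b + a * c := by
  simp only [mul_def, map_add]

lemma add_mul' (a b c : TwistedAlg α) : (a + b) * c = a * c + b * c := by
  simp only [mul_def, map_add, LinearMap.add_apply]

lemma smul_mul' (c : k) (a b : TwistedAlg α) : (c • a) * b = c • (a * b) := by
  simp only [mul_def, map_smul, LinearMap.smul_apply]

lemma mul_smul' (c : k) (a b : TwistedAlg α) : a * (c • b) = c • (a * b) := by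
  simp only [mul_def, map_smul]

lemma zero_mul' (a : TwistedAlg α) : 0 * a = 0 := by
  simp only [mul_def, map_zero, LinearMap.zero_apply]

lemma mul_zero' (a : TwistedAlg α) : a * 0 = 0 := by
  simp only [mul_def, map_zero]

lemma of_assoc (u t s : Mor C) : of α u * of α t * of α s = of α u * (of α t * of α s) := by
  obtain ⟨Y', Z, u⟩ := u
  obtain ⟨X', Y, t⟩ := t
  obtain ⟨W, X, s⟩ := s
  by_cases h₁ : Y = Y'
  · subst h₁
    by_cases h₂ : X = X'
    · subst h₂
      simp only [of_mul_of, smul_mul', mul_smul', smul_smul, Category.assoc]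
      congr 1
      have := congrArg (Units.val) (α.cocycle s t u)
      push_cast at this
      rw [mul_comm, this, mul_comm]
    · rw [of_mul_of, smul_mul', of_mul_ne α (by exact h₂), of_mul_ne α (by exact h₂), smul_zero,
        mul_zero']
  · rw [of_mul_ne α (by exact h₁), zero_mul']
    by_cases h₂ : X = X'
    · subst h₂
      rw [of_mul_of, mul_smul', of_mul_ne α (by exact h₁), smul_zero]
    · rw [of_mul_ne α (by exact h₂), mul_zero']

lemma mul_assoc' (a b c : TwistedAlg α) : a * b * c = a * (b * c) := by
  induction a using TwistedAlg.induction with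
  | zero => simp only [zero_mul']
  | add a a' h h' => simp only [add_mul', h, h']
  | single r u =>
    induction b using TwistedAlg.induction with
    | zero => simp only [zero_mul', mul_zero']
    | add b b' h h' => simp only [add_mul', mul_add', h, h']
    | single r' t =>
      induction c using TwistedAlg.induction with
      | zero => simp only [mul_zero']
      | add c c' h h' => simp only [mul_add', h, h']
      | single r'' s => simp only [smul_mul', mul_smul', of_assoc]

lemma val_id_left {X Y : C} (s : X ⟶ Y) : α.val (𝟙 Y) s = α.val (𝟙 Y) (𝟙 Y) := by
  have := α.cocycle s (𝟙 Y) (𝟙 Y)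
  simp only [Category.comp_id] at this
  exact (mul_left_cancel this).symm

lemma val_id_right {X Y : C} (s : X ⟶ Y) : α.val s (𝟙 X) = α.val (𝟙 X) (𝟙 X) := by
  have := α.cocycle (𝟙 X) (𝟙 X) s
  simp only [Category.id_comp] at this
  exact mul_left_cancel this

variable [Finite C]

/-- The identity element: the sum of the elements `α(id_X, id_X)⁻¹ id_X` over all objects `X`. -/
instance : One (TwistedAlg α) :=
  ⟨letI := Fintype.ofFinite C
   ∑ X : C, (((α.val (𝟙 X) (𝟙 X))⁻¹ : kˣ) : k) • of α ⟨X, X, 𝟙 X⟩⟩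

lemma one_def [Fintype C] : (1 : TwistedAlg α) =
    ∑ X : C, (((α.val (𝟙 X) (𝟙 X))⁻¹ : kˣ) : k) • of α ⟨X, X, 𝟙 X⟩ := by
  change (letI := Fintype.ofFinite C
    ∑ X : C, (((α.val (𝟙 X) (𝟙 X))⁻¹ : kˣ) : k) • of α ⟨X, X, 𝟙 X⟩) = _
  congr!

lemma one_mul_of (s : Mor C) : 1 * of α s = of α s := by
  classical
  let _ := Fintype.ofFinite C
  obtain ⟨X, Y, s⟩ := s
  rw [one_def, mul_def, map_sum, LinearMap.sum_apply]
  simp only [← mul_def]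
  rw [Finset.sum_eq_single Y]
  · rw [smul_mul', of_mul_of, smul_smul, val_id_left s, Category.comp_id]
    simp
  · intro Z _ hZ
    rw [smul_mul', of_mul_ne α (fun h => hZ h.symm), smul_zero]
  · simp

lemma mul_one_of (s : Mor C) : of α s * 1 = of α s := by
  classical
  let _ := Fintype.ofFinite C
  obtain ⟨X, Y, s⟩ := s
  rw [one_def, mul_def, map_sum]
  simp only [← mul_def]
  rw [Finset.sum_eq_single X]
  · rw [mul_smul', of_mul_of, smul_smul, val_id_right s, Category.id_comp]
    simp
  · intro Z _ hZ
    rw [mul_smul', of_mul_ne α (fun h => hZ h), smul_zero]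
  · simp

instance : Ring (TwistedAlg α) where
  __ := (inferInstance : AddCommGroup (TwistedAlg α))
  mul := (· * ·)
  one := 1
  mul_assoc := mul_assoc'
  left_distrib := mul_add'
  right_distrib := add_mul'
  zero_mul := zero_mul'
  mul_zero := mul_zero'
  one_mul a := by
    induction a using TwistedAlg.induction with
    | zero => exact mul_zero' _
    | add a b ha hb => rw [mul_add', ha, hb]
    | single c s => rw [mul_smul', one_mul_of]
  mul_one a := by
    induction a using TwistedAlg.induction with
    | zero => exact zero_mul' _
    | add a b ha hb => rw [add_mul', ha, hb]
    | single c s => rw [smul_mul', mul_one_of]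

instance : Algebra k (TwistedAlg α) :=
  Algebra.ofModule smul_mul' (fun c a b => mul_smul' c a b)

end TwistedAlg

/-! ### Twisted group algebras of maximal subgroups, inflation, and the modules `Δ` -/

section Delta

variable {C : Type u} [Category.{v} C] {k : Type w} [Field k]

/-- The restriction of a `2`-cocycle to the maximal subgroup `Γ_e`, regarded as a category with one
object. -/
def TwoCocycle.restrict (α : TwoCocycle C k) (e : Idem C) : TwoCocycle (SingleObj e.Gam) k where
  val t s := α.val (show e.Gam from t).1.1 (show e.Gam from s).1.1
  cocycle s t u := α.cocycle (show e.Gam from s).1.1 (show e.Gam from t).1.1 (show e.Gam from u).1.1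

/-- The twisted group algebra `k_α Γ_e`. -/
abbrev TwistedGroupAlg (α : TwoCocycle C k) (e : Idem C) : Type (max v w) :=
  TwistedAlg (α.restrict e)

/-- The inclusion of `Γ_e` into `Mor(C)`. -/
def gamIncl (e : Idem C) (g : Mor (SingleObj e.Gam)) : Mor C :=
  ⟨e.obj, e.obj, (show e.Gam from g.hom).1.1⟩

lemma gamIncl_injective (e : Idem C) : Function.Injective (gamIncl e) := by
  rintro ⟨⟨⟩, ⟨⟩, g⟩ ⟨⟨⟩, ⟨⟩, h⟩ H
  simp only [gamIncl, Mor.mk.injEq, heq_eq_eq, true_and] at H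
  have : (show e.Gam from g) = (show e.Gam from h) := Units.ext (Subtype.ext H)
  change g = h at this
  rw [this]

/-- The `k`-linear projection of `k_α C` onto `k_α Γ_e`, which sends the basis elements outside
`Γ_e` to `0`. -/
def gamProj (α : TwoCocycle C k) (e : Idem C) : TwistedAlg α →ₗ[k] TwistedGroupAlg α e :=
  Finsupp.lcomapDomain (gamIncl e) (gamIncl_injective e)

variable (α : TwoCocycle C k) (e : Idem C)

lemma gamProj_of_mem (g : Mor (SingleObj e.Gam)) :
    gamProj α e (TwistedAlg.of α (gamIncl e g)) = TwistedAlg.of (α.restrict e) g := by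
  exact Finsupp.comapDomain_single (gamIncl e) g 1 (gamIncl_injective e).injOn

lemma gamProj_of_notMem (s : Mor C) (hs : s ∉ Set.range (gamIncl e)) :
    gamProj α e (TwistedAlg.of α s) = 0 := by
  refine Finsupp.ext fun g => ?_
  change (Finsupp.single s (1 : k)) (gamIncl e g) = 0
  rw [Finsupp.single_eq_of_ne]
  rintro rfl
  exact hs ⟨g, rfl⟩

/-- The morphism of the one-object category `Γ_e` belonging to an element of `Γ_e`. -/
def gamMor (g : e.Gam) : Mor (SingleObj e.Gam) :=
  ⟨SingleObj.star _, SingleObj.star _, g⟩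

lemma localMonoid_mem_range (f : e.LocalMonoid) :
    (⟨e.obj, e.obj, f.1⟩ : Mor C) ∈ Set.range (gamIncl e) ↔ IsUnit f := by
  constructor
  · rintro ⟨⟨_, _, g⟩, hg⟩
    simp only [gamIncl, Mor.mk.injEq, heq_eq_eq, true_and] at hg
    exact ⟨(show e.Gam from g), Subtype.ext hg⟩
  · rintro ⟨g, rfl⟩
    exact ⟨gamMor e g, rfl⟩

lemma gamProj_mul_of [∀ X Y : C, Finite (X ⟶ Y)] (f g : e.LocalMonoid) :
    gamProj α e (TwistedAlg.of α ⟨_, _, f.1⟩ * TwistedAlg.of α ⟨_, _, g.1⟩) =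
      gamProj α e (TwistedAlg.of α ⟨_, _, f.1⟩) * gamProj α e (TwistedAlg.of α ⟨_, _, g.1⟩) := by
  rw [TwistedAlg.of_mul_of, map_smul]
  by_cases hf : IsUnit f
  · by_cases hg : IsUnit g
    · obtain ⟨f, rfl⟩ := hf
      obtain ⟨g, rfl⟩ := hg
      have h₁ := gamProj_of_mem α e (gamMor e f)
      have h₂ := gamProj_of_mem α e (gamMor e g)
      have h₃ := gamProj_of_mem α e (gamMor e (f * g))
      have h₄ := TwistedAlg.of_mul_of (α.restrict e) (gamMor e f).hom (gamMor e g).hom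
      change gamProj α e (TwistedAlg.of α ⟨_, _, f.1.1⟩) = _ at h₁
      change gamProj α e (TwistedAlg.of α ⟨_, _, g.1.1⟩) = _ at h₂
      change gamProj α e (TwistedAlg.of α ⟨_, _, g.1.1 ≫ f.1.1⟩) = _ at h₃
      rw [h₁, h₂, h₃]
      exact h₄.symm
    · rw [gamProj_of_notMem α e ⟨_, _, g.1⟩ (by rwa [localMonoid_mem_range]), mul_zero]
      have : ¬ IsUnit (f * g) := fun h => hg (isUnit_of_mul_isUnit_right h)
      have h := gamProj_of_notMem α e ⟨_, _, (f * g).1⟩ (by rwa [localMonoid_mem_range])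
      rw [Idem.mul_val] at h
      rw [h, smul_zero]
  · rw [gamProj_of_notMem α e ⟨_, _, f.1⟩ (by rwa [localMonoid_mem_range]), zero_mul]
    have : ¬ IsUnit (f * g) := fun h => hf (isUnit_of_mul_isUnit_left h)
    have h := gamProj_of_notMem α e ⟨_, _, (f * g).1⟩ (by rwa [localMonoid_mem_range])
    rw [Idem.mul_val] at h
    rw [h, smul_zero]

/-- The element `e' = α(e, e)⁻¹ e` of `k_α C`. -/
def idemElt : TwistedAlg α := (((α.val e.hom e.hom)⁻¹ : kˣ) : k) • TwistedAlg.of α e.toMor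

lemma idemElt_idem : IsIdempotentElem (idemElt α e) := by
  unfold IsIdempotentElem idemElt Idem.toMor
  rw [TwistedAlg.smul_mul', TwistedAlg.mul_smul', TwistedAlg.of_mul_of, e.idem, smul_smul,
    smul_smul]
  simp

lemma idemElt_mul_of_mul (s : Mor C) : ∃ (c : k) (f : e.LocalMonoid),
    idemElt α e * TwistedAlg.of α s * idemElt α e = c • TwistedAlg.of α ⟨_, _, f.1⟩ := by
  obtain ⟨X, Y, s⟩ := s
  unfold idemElt Idem.toMor
  simp only [TwistedAlg.smul_mul', TwistedAlg.mul_smul', smul_smul]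
  by_cases hY : Y = e.obj
  · subst hY
    by_cases hX : e.obj = X
    · subst hX
      rw [TwistedAlg.of_mul_of, TwistedAlg.smul_mul', TwistedAlg.of_mul_of, smul_smul, smul_smul]
      exact ⟨_, ⟨_, s, rfl⟩, rfl⟩
    · rw [TwistedAlg.of_mul_of, TwistedAlg.smul_mul',
        TwistedAlg.of_mul_ne α (by exact hX), smul_zero, smul_zero]
      exact ⟨0, 1, (zero_smul _ _).symm⟩
  · rw [TwistedAlg.of_mul_ne α (by exact hY), TwistedAlg.zero_mul', smul_zero]
    exact ⟨0, 1, (zero_smul _ _).symm⟩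

/-- The inflation `W̃` of a `k_α Γ_e`-module `W` to `e'Ae'`: the abelian group `W`, on which `e'Ae'`
acts through the surjection `inflHom` below. -/
def Inflation (_ : TwoCocycle C k) (_ : Idem C) (W : Type x) : Type x := W

variable [Finite C] [∀ X Y : C, Finite (X ⟶ Y)]

lemma gamProj_mul (a b : TwistedAlg α) :
    gamProj α e ((idemElt α e * a * idemElt α e) * (idemElt α e * b * idemElt α e)) =
      gamProj α e (idemElt α e * a * idemElt α e) *
        gamProj α e (idemElt α e * b * idemElt α e) := by
  induction a using TwistedAlg.induction with
  | zero => simp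
  | add a a' h h' => simp only [mul_add, add_mul, map_add, h, h']
  | single r t =>
    induction b using TwistedAlg.induction with
    | zero => simp
    | add b b' h h' => simp only [mul_add, add_mul, map_add] at h h' ⊢; rw [h, h']
    | single r' s =>
      obtain ⟨c, f, hf⟩ := idemElt_mul_of_mul α e t
      obtain ⟨d, g, hg⟩ := idemElt_mul_of_mul α e s
      simp only [mul_smul_comm, smul_mul_assoc, hf, hg, map_smul, gamProj_mul_of]

/-- The surjection `e'Ae' → k_α Γ_e` belonging to the decomposition `e'Ae' = k_α Γ_e ⊕ k J_e`
(where `J_e` consists of the non-invertible elements of `e ∘ End(X) ∘ e`). -/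
def inflHom : (idemElt_idem α e).Corner →+* TwistedGroupAlg α e where
  toFun a := gamProj α e a.1
  map_zero' := map_zero (gamProj α e)
  map_add' a b := map_add (gamProj α e) a.1 b.1
  map_mul' a b := by
    obtain ⟨_, a, rfl⟩ := a
    obtain ⟨_, b, rfl⟩ := b
    exact gamProj_mul α e a b
  map_one' := by
    change gamProj α e ((((α.val e.hom e.hom)⁻¹ : kˣ) : k) • TwistedAlg.of α e.toMor) = 1
    have h := gamProj_of_mem α e (gamMor e 1)
    change gamProj α e (TwistedAlg.of α e.toMor) = _ at h
    let _ : Fintype (SingleObj e.Gam) := inferInstanceAs (Fintype Unit)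
    rw [map_smul, h, TwistedAlg.one_def]
    simp
    rfl

variable (W : Type x) [AddCommGroup W] [Module (TwistedGroupAlg α e) W]

instance : AddCommGroup (Inflation α e W) := inferInstanceAs (AddCommGroup W)

instance : Module (idemElt_idem α e).Corner (Inflation α e W) :=
  Module.compHom W (inflHom α e)

/-- The `A`-module `Ae' ⊗_{e'Ae'} W̃`, where `A = k_α C`. -/
abbrev Delta : Type _ :=
  BalancedTensor (TwistedAlg α) (idemElt_idem α e).Corner (leftIdeal (idemElt_idem α e))
    (Inflation α e W)

end Delta

end

noncomputable section

/-! ### Simple modules, projective covers and composition factors -/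

section ModuleTheory

variable {R : Type*} [Ring R]

/-! Number the J-classes with lower classes first (`JRank`). The morphisms with number less than m
span a two-sided ideal J_m (`lowIdeal`), and 0 = J_0 ⊂ … ⊂ J_n = A is the heredity chain. Since C is
split, every L-class contains an idempotent f, and s = s ∘ f for all s in that class. Since C is
finite, composing s on the left keeps it in its L-class or moves it to a lower J-class
(`exists_comp_eq_of_mem_idealGen`). So J_(m+1)/J_m is a direct sum of images of modules Af' and is
projective over A/J_m. The working form of this is the lifting property `exists_lift_lowIdeal`.

Simple modules are found as in Clifford–Munn–Ponizovskii theory. For a simple eAe-module N, the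
largest submodule of Ae ⊗ N killed by e is its greatest proper submodule, and the head D satisfies
eD ≅ N. Conversely, for a simple S, take the last J_m that kills S and the e_i of the next class:
e_i'S is a simple k_αΓ-module and determines S, because e'Ae' ∩ J_m is exactly kJ_e
(`inflHom_eq_zero_iff`). The same ideals locate the composition factors of Rad Δ.

A projective cover P of D_p is a retract of Ae_p', filtered by the submodules J_m P. For a layer X
of number ord j, e_j'X is a module over the semisimple ring k_αΓ, so X is the image of a direct sum
of modules Δ_js under a map that is injective on the e_j'-part. The lifting property splits this
map, and a split surjection of this kind is an isomorphism (`exists_pi_delta_of_layer`). The top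
layer is a quotient of P, hence has at most one summand, and this summand is Δ_p. Finally, the
ideals J_m are idempotent, and therefore J_m P, for m the number of p, lies in every K such that P/K
has only factors D_q with q < p in its radical. -/

lemma IsSimpleReps.exists_equiv {R : Type u} [Ring R] {L : Type*} {D : L → Type*}
    [∀ i, AddCommGroup (D i)] [∀ i, Module R (D i)] (h : IsSimpleReps R D)
    (M : Type*) [AddCommGroup M] [Module R M] (hM : IsSimpleModule R M) :
    ∃ i, Nonempty (M ≃ₗ[R] D i) := by
  obtain ⟨I, hI, ⟨f⟩⟩ := isSimpleModule_iff_quot_maximal.1 hM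
  have := f.symm.isSimpleModule_iff.2 hM
  obtain ⟨i, ⟨g⟩⟩ := h.exhaustive (R ⧸ I) this
  exact ⟨i, ⟨f.trans g⟩⟩

lemma FactorsAmong.of_equiv {L : Type*} {D : L → Type*}
    [∀ i, AddCommGroup (D i)] [∀ i, Module R (D i)] {s : Set L}
    {M N : Type*} [AddCommGroup M] [Module R M] [AddCommGroup N] [Module R N]
    (h : FactorsAmong R D s M) (f : M ≃ₗ[R] N) : FactorsAmong R D s N := by
  intro N₁ N₂ hN
  have hN' : N₁.comap f.toLinearMap ⋖ N₂.comap f.toLinearMap := by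
    let o := (Submodule.orderIsoMapComap f).symm
    exact (apply_covBy_apply_iff o).2 hN
  obtain ⟨i, hi, ⟨g⟩⟩ := h _ _ hN'
  refine ⟨i, hi, ⟨LinearEquiv.trans (Submodule.Quotient.equiv _ _ (f.ofSubmodule' N₂) ?_).symm g⟩⟩
  ext ⟨y, hy⟩
  constructor
  · rintro ⟨⟨x, hx⟩, hx', hxy⟩
    have : f x = y := congrArg Subtype.val hxy
    subst this
    exact hx'
  · intro h
    obtain ⟨x, rfl⟩ := f.surjective y
    exact ⟨⟨x, hy⟩, h, rfl⟩

/-- The linear equivalence between the Jacobson radicals of isomorphic modules. -/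
def LinearEquiv.jacobson {M N : Type*} [AddCommGroup M] [Module R M] [AddCommGroup N] [Module R N]
    (f : M ≃ₗ[R] N) : Module.jacobson R M ≃ₗ[R] Module.jacobson R N :=
  (f.submoduleMap _).trans
    (LinearEquiv.ofEq _ _ (Module.map_jacobson_of_bijective (f := f.toLinearMap) f.bijective))

/-- Take N minimal among the submodules with image M; minimality makes the kernel superfluous.
Lifting `f` through its restriction to N gives φ : P → N. By minimality φ(N) = N, so φ restricts to
a surjective, hence bijective, endomorphism of the Noetherian module N, and N is a retract of P. -/
lemma LinearMap.exists_isProjectiveCover {P M : Type*} [AddCommGroup P] [Module R P] [AddCommGroup M]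
    [Module R M] [Module.Projective R P] [IsArtinian R P] [IsNoetherian R P] (f : P →ₗ[R] M)
    (hf : Function.Surjective f) :
    ∃ N : Submodule R P, IsProjectiveCover (f.domRestrict N) := by
  obtain ⟨N, hN, hmin⟩ := WellFounded.has_min (wellFounded_lt (α := Submodule R P))
    {N | N.map f = ⊤} ⟨⊤, by simpa using LinearMap.range_eq_top.2 hf⟩
  have hmin' : ∀ K ≤ N, K.map f = ⊤ → K = N := fun K hK h =>
    hK.eq_of_not_lt (hmin K h)
  have hsurj : Function.Surjective (f.domRestrict N) := by
    intro y
    have : y ∈ N.map f := by rw [hN]; trivial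
    obtain ⟨x, hx, rfl⟩ := this
    exact ⟨⟨x, hx⟩, rfl⟩
  refine ⟨N, ?_, hsurj, ?_⟩
  · obtain ⟨φ, hφ⟩ := Module.projective_lifting_property (f.domRestrict N) f hsurj
    have hφ' : ∀ x, f (φ x) = f x := fun x => LinearMap.congr_fun hφ x
    have h2 : Function.Surjective (φ.comp N.subtype) := by
      have : ((LinearMap.range (φ.comp N.subtype)).map N.subtype) = N := by
        apply hmin' _ (Submodule.map_subtype_le _ _)
        rw [eq_top_iff]
        intro y _
        obtain ⟨x, rfl⟩ := hsurj y
        exact ⟨φ x, ⟨_, ⟨x, rfl⟩, rfl⟩, hφ' _⟩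
      rw [← LinearMap.range_eq_top]
      apply Submodule.map_injective_of_injective N.injective_subtype
      rw [this, Submodule.map_top, Submodule.range_subtype]
    have h1 : Function.Injective (φ.comp N.subtype) :=
      IsNoetherian.injective_of_surjective_endomorphism _ h2
    let ψ := LinearEquiv.ofBijective _ ⟨h1, h2⟩
    exact Module.Projective.of_split N.subtype (ψ.symm.toLinearMap.comp φ) (by
      ext x : 1
      exact ψ.symm_apply_apply x)
  · intro K hK
    have : K.map N.subtype = N := by
      apply hmin' _ (Submodule.map_subtype_le _ _)
      rw [eq_top_iff]
      intro y _
      obtain ⟨x, rfl⟩ := hsurj y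
      have hx : x ∈ K ⊔ LinearMap.ker (f.domRestrict N) := by rw [hK]; trivial
      obtain ⟨a, ha, b, hb, rfl⟩ := Submodule.mem_sup.1 hx
      refine ⟨a, ⟨a, ha, rfl⟩, ?_⟩
      rw [map_add, LinearMap.mem_ker.1 hb, add_zero]
      rfl
    apply Submodule.map_injective_of_injective N.injective_subtype
    rw [this, Submodule.map_top, Submodule.range_subtype]

/-- The kernel of π is a maximal submodule; a proper N outside it would satisfy N + ker π = P,
against superfluousness. So ker π is the greatest proper submodule of P. -/
lemma IsProjectiveCover.le_ker {P M : Type*} [AddCommGroup P] [Module R P] [AddCommGroup M]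
    [Module R M] [IsSimpleModule R M] {π : P →ₗ[R] M} (hπ : IsProjectiveCover π)
    {N : Submodule R P} (hN : N ≠ ⊤) : N ≤ LinearMap.ker π := by
  have := LinearMap.isCoatom_ker_of_surjective hπ.surjective
  by_contra h
  exact hN (hπ.superfluous N (by rw [sup_comm]; exact this.2 _ (right_lt_sup.2 h |> fun h => by rwa [sup_comm] at h)))

end ModuleTheory

/-! ### The tensor product `Ae ⊗ N` over `eAe` -/

section CornerInduction

variable {A : Type*} [Ring A] {e : A} (he : IsIdempotentElem e)

lemma IsIdempotentElem.Corner.left_mul (c : he.Corner) : e * c.1 = c.1 :=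
  ((Subsemigroup.mem_corner_iff he).1 c.2).1
lemma IsIdempotentElem.Corner.mul_right (c : he.Corner) : c.1 * e = c.1 :=
  ((Subsemigroup.mem_corner_iff he).1 c.2).2

/-- The element `eae` of `eAe`. -/
def IsIdempotentElem.cornerMk (a : A) : he.Corner := ⟨e * a * e, a, rfl⟩

/-- The `eAe`-module `eM`, for an `A`-module `M`. -/
def CornerPart (_ : IsIdempotentElem e) (M : Type*) [AddCommGroup M] [Module A M] : AddSubgroup M where
  carrier := {x | e • x = x}
  zero_mem' := smul_zero e
  add_mem' {a b} ha hb := by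
    change e • (a + b) = a + b
    rw [smul_add, ha, hb]
  neg_mem' {a} ha := by
    change e • (-a) = -a
    rw [smul_neg, ha]

section
variable (M : Type*) [AddCommGroup M] [Module A M]

lemma smul_mem_cornerPart (x : M) : e • x ∈ CornerPart he M := by
  change e • e • x = e • x
  rw [smul_smul, he.eq]

instance : Module he.Corner (CornerPart he M) where
  smul c x := ⟨c.1 • x.1, by
    change e • c.1 • x.1 = c.1 • x.1
    rw [smul_smul, IsIdempotentElem.Corner.left_mul]⟩
  one_smul x := Subtype.ext x.2
  mul_smul c d x := Subtype.ext (mul_smul c.1 d.1 x.1)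
  smul_zero c := Subtype.ext (smul_zero c.1)
  smul_add c x y := Subtype.ext (smul_add c.1 x.1 y.1)
  add_smul c d x := Subtype.ext (add_smul c.1 d.1 x.1)
  zero_smul x := Subtype.ext (zero_smul A x.1)

end

variable (N : Type*) [AddCommGroup N] [Module he.Corner N]

/-- The `A`-module `Ae ⊗ N` over `eAe`. -/
abbrev Induced : Type _ := BalancedTensor A he.Corner (leftIdeal he) N

namespace Induced

/-- The map `n ↦ e ⊗ n`. -/
def unit : N →+ Induced he N :=
  (Submodule.mkQ _).toAddMonoidHom.comp
    (TensorProduct.mk ℤ (leftIdeal he) N ⟨e, Ideal.mem_span_singleton_self e⟩).toAddMonoidHom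

variable {N}

/-- The residue class of a pure tensor. -/
def tmul (a : leftIdeal he) (n : N) : Induced he N :=
  Submodule.Quotient.mk (a ⊗ₜ[ℤ] n)

lemma tmul_eq (a : leftIdeal he) (n : N) : tmul he a n = a.1 • unit he N n := by
  change Submodule.Quotient.mk (a ⊗ₜ[ℤ] n) =
    Submodule.Quotient.mk ((a.1 • (⟨e, Ideal.mem_span_singleton_self e⟩ : leftIdeal he)) ⊗ₜ[ℤ] n)
  congr 2
  exact Subtype.ext (leftIdeal_mul he a).symm

lemma tmul_balanced (a : leftIdeal he) (c : he.Corner) (n : N) :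
    tmul he (MulOpposite.op c • a) n = tmul he a (c • n) := by
  unfold tmul
  rw [Submodule.Quotient.eq]
  exact Submodule.subset_span ⟨a, c, n, rfl⟩

lemma unit_smul (c : he.Corner) (n : N) : unit he N (c • n) = c.1 • unit he N n := by
  have := tmul_balanced he ⟨e, Ideal.mem_span_singleton_self e⟩ c n
  rw [tmul_eq, tmul_eq] at this
  change (e * c.1) • _ = e • _ at this
  rw [IsIdempotentElem.Corner.left_mul] at this
  rw [this]
  have h := tmul_eq he ⟨e, Ideal.mem_span_singleton_self e⟩ (c • n)
  exact h

lemma smul_unit (n : N) : e • unit he N n = unit he N n := by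
  have := unit_smul he 1 n
  rw [one_smul] at this
  exact this.symm

@[elab_as_elim]
lemma induction {p : Induced he N → Prop} (z : Induced he N)
    (add : ∀ z z', p z → p z' → p (z + z')) (smul : ∀ (a : A) (n : N), p (a • unit he N n)) :
    p z := by
  obtain ⟨z, rfl⟩ := Submodule.Quotient.mk_surjective _ z
  induction z using TensorProduct.induction_on with
  | zero =>
    have := smul 0 0
    rw [zero_smul] at this
    exact this
  | tmul a n => 
    change p (tmul he a n)
    exact (tmul_eq he a n).symm ▸ smul a.1 n
  | add z z' h h' => exact add _ _ h h'

lemma span_unit : Submodule.span A (Set.range (unit he N)) = ⊤ := by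
  rw [eq_top_iff]
  intro z _
  induction z using induction with
  | add z z' h h' => exact add_mem (h trivial) (h' trivial)
  | smul a n => exact Submodule.smul_mem _ _ (Submodule.subset_span ⟨n, rfl⟩)

/-- This is e(ae ⊗ n) = eae ⊗ n = e ⊗ (eae)n. Together with `unit_injective` it identifies e(Ae ⊗ N)
with N. -/
lemma smul_mem_range (z : Induced he N) : e • z ∈ (unit he N).range := by
  induction z using induction with
  | add z z' h h' => rw [smul_add]; exact add_mem h h'
  | smul a n =>
    refine ⟨he.cornerMk a • n, ?_⟩
    rw [unit_smul, ← smul_unit he n]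
    simp only [smul_smul]
    simp [IsIdempotentElem.cornerMk, mul_assoc, he.eq]

lemma exists_unit {z : Induced he N} (hz : e • z = z) : ∃ n, unit he N n = z := by
  obtain ⟨n, hn⟩ := smul_mem_range he z
  exact ⟨n, hn.trans hz⟩

section Lift

variable {M : Type*} [AddCommGroup M] [Module A M]

/-- The additive map `a ⊗ n ↦ a • f n`. -/
def liftAux (f : N →+ M) : (leftIdeal he ⊗[ℤ] N) →+ M :=
  TensorProduct.liftAddHom
    (AddMonoidHom.mk' (fun a : leftIdeal he => (DistribSMul.toAddMonoidHom M a.1).comp f)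
      (fun a b => by ext n; exact add_smul a.1 b.1 (f n)))
    (fun r a n => by
      change (r • a.1) • f n = a.1 • f (r • n)
      rw [map_zsmul, smul_comm, smul_assoc])

/-- The universal property of `Ae ⊗ N`. -/
def lift (f : N →+ M) (hf : ∀ (c : he.Corner) n, f (c • n) = c.1 • f n) :
    Induced he N →ₗ[A] M :=
  Submodule.liftQ _ { liftAux he f with
    map_smul' := fun a z => by
      change liftAux he f (a • z) = a • liftAux he f z
      induction z using TensorProduct.induction_on with
      | zero => rw [smul_zero, map_zero, smul_zero]
      | tmul b n =>
        change (a * b.1) • f n = a • b.1 • f n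
        rw [mul_smul]
      | add z z' h h' => rw [smul_add, map_add, map_add, h, h', smul_add] } (by
    rw [Submodule.span_le]
    rintro _ ⟨a, c, n, rfl⟩
    rw [SetLike.mem_coe, LinearMap.mem_ker, map_sub, sub_eq_zero]
    change (a.1 * c.1) • f n = a.1 • f (c • n)
    rw [hf, mul_smul])

lemma lift_unit (f : N →+ M) (hf : ∀ (c : he.Corner) n, f (c • n) = c.1 • f n) (n : N) :
    lift he f hf (unit he N n) = f n := by
  change e • f n = f n
  have := hf 1 n
  rw [one_smul] at this
  exact this.symm

end Lift

/-- The additive map ρ : a ⊗ n ↦ (eae)n respects the relations and is a left inverse of `unit`. -/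
lemma unit_injective : Function.Injective (unit he N) := by
  let ρ : (leftIdeal he ⊗[ℤ] N) →+ N := TensorProduct.liftAddHom
    (AddMonoidHom.mk' (fun a : leftIdeal he => DistribSMul.toAddMonoidHom N (he.cornerMk a.1))
      (fun a b => by
        ext n
        change he.cornerMk (a.1 + b.1) • n = he.cornerMk a.1 • n + he.cornerMk b.1 • n
        rw [← add_smul]
        congr 1
        exact Subtype.ext (by simp [IsIdempotentElem.cornerMk, mul_add, add_mul]; rfl)))
    (fun r a n => by
      change he.cornerMk (r • a.1) • n = he.cornerMk a.1 • (r • n)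
      have : he.cornerMk (r • a.1) = r • he.cornerMk a.1 := Subtype.ext (by
        change e * (r • a.1) * e = r • (e * a.1 * e)
        rw [mul_smul_comm, smul_mul_assoc])
      rw [this, smul_assoc, smul_comm])
  -- The relations span an A-submodule while ρ is only additive, so the induction must carry all
  -- A-multiples of z.
  have hρ : ∀ z ∈ Submodule.span A {z : (leftIdeal he) ⊗[ℤ] N | ∃ (m : leftIdeal he) (b : he.Corner) (n : N),
      z = (MulOpposite.op b • m) ⊗ₜ[ℤ] n - m ⊗ₜ[ℤ] (b • n)}, ∀ a : A, ρ (a • z) = 0 := by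
    intro z hz
    induction hz using Submodule.span_induction with
    | mem z hz =>
      obtain ⟨m, b, n, rfl⟩ := hz
      intro a
      rw [smul_sub, map_sub, sub_eq_zero]
      change he.cornerMk (a * (m.1 * b.1)) • n = he.cornerMk (a * m.1) • b • n
      rw [smul_smul]
      congr 1
      refine Subtype.ext ?_
      have h1 := leftIdeal_mul he m
      change e * (a * (m.1 * b.1)) * e = e * (a * m.1) * e * b.1
      rw [mul_assoc, mul_assoc a, mul_assoc m.1, IsIdempotentElem.Corner.mul_right,
        mul_assoc e, mul_assoc a, h1]
      simp only [mul_assoc]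
    | zero => simp
    | add z z' _ _ h h' => intro a; rw [smul_add, map_add, h, h', add_zero]
    | smul b z _ h => intro a; rw [smul_smul]; exact h _
  rw [injective_iff_map_eq_zero]
  intro n hn
  have h := hρ _ ((Submodule.Quotient.mk_eq_zero _).1 hn) 1
  rw [one_smul] at h
  change he.cornerMk e • n = 0 at h
  have h1 : he.cornerMk e = 1 := Subtype.ext (by
    change e * e * e = e
    rw [he.eq, he.eq])
  rwa [h1, one_smul] at h

end Induced

end CornerInduction

/-! ### Passing between simple modules over A and over the corner eAe -/

section CornerSimple

variable {A : Type*} [Ring A] {e : A} (he : IsIdempotentElem e)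

/-- The largest submodule of `M` on which `e` vanishes. -/
def cornerRad (e : A) (M : Type*) [AddCommGroup M] [Module A M] : Submodule A M where
  carrier := {x | ∀ a : A, e • a • x = 0}
  zero_mem' a := by rw [smul_zero, smul_zero]
  add_mem' {x y} hx hy a := by rw [smul_add, smul_add, hx a, hy a, add_zero]
  smul_mem' b x hx a := by rw [smul_smul a]; exact hx _

lemma smul_eq_zero_of_mem_cornerRad {M : Type*} [AddCommGroup M] [Module A M] {x : M}
    (hx : x ∈ cornerRad e M) : e • x = 0 := by
  have := hx 1
  rwa [one_smul] at this

/-- `CornerPart` is functorial. -/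
def CornerPart.congr {M M' : Type*} [AddCommGroup M] [Module A M] [AddCommGroup M'] [Module A M']
    (f : M ≃ₗ[A] M') : CornerPart he M ≃ₗ[he.Corner] CornerPart he M' where
  toFun x := ⟨f x.1, by
    change e • f x.1 = f x.1
    rw [← map_smul, show e • x.1 = x.1 from x.2]⟩
  map_add' x y := Subtype.ext (map_add f x.1 y.1)
  map_smul' c x := Subtype.ext (map_smul f c.1 x.1)
  invFun x := ⟨f.symm x.1, by
    change e • f.symm x.1 = f.symm x.1
    rw [← map_smul, show e • x.1 = x.1 from x.2]⟩
  left_inv x := Subtype.ext (f.symm_apply_apply x.1)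
  right_inv x := Subtype.ext (f.apply_symm_apply x.1)

/-- The `A`-submodule of `M` generated by an `eAe`-submodule of `eM` meets `eM` in the given
submodule. -/
lemma CornerPart.mem_of_mem_span {M : Type*} [AddCommGroup M] [Module A M]
    (K : Submodule he.Corner (CornerPart he M)) {x : CornerPart he M}
    (hx : x.1 ∈ Submodule.span A (Subtype.val '' (K : Set (CornerPart he M)))) : x ∈ K := by
  -- For general z in the span only the elements e a z lie in eM; for x = ex, taking a = 1 recovers
  -- x.
  have key : ∀ z ∈ Submodule.span A (Subtype.val '' (K : Set (CornerPart he M))), ∀ a : A,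
      (⟨e • a • z, smul_mem_cornerPart he M _⟩ : CornerPart he M) ∈ K := by
    intro z hz
    induction hz using Submodule.span_induction with
    | mem z hz =>
      obtain ⟨z, hz, rfl⟩ := hz
      intro a
      have h := K.smul_mem (he.cornerMk a) hz
      convert h using 1
      refine Subtype.ext ?_
      change e • a • z.1 = (e * a * e) • z.1
      rw [mul_smul, mul_smul, show e • z.1 = z.1 from z.2]
    | zero =>
      intro a
      convert K.zero_mem using 1
      refine Subtype.ext ?_
      change e • a • (0 : M) = 0
      rw [smul_zero, smul_zero]
    | add z z' _ _ h h' =>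
      intro a
      convert K.add_mem (h a) (h' a) using 1
      refine Subtype.ext ?_
      change e • a • (z + z') = e • a • z + e • a • z'
      rw [smul_add, smul_add]
    | smul b z _ h =>
      intro a
      convert h (a * b) using 3
      rw [smul_smul]
  convert key _ hx 1 using 1
  refine Subtype.ext ?_
  change x.1 = e • (1 : A) • x.1
  rw [one_smul, show e • x.1 = x.1 from x.2]

/-- By `CornerPart.mem_of_mem_span`, K ↦ AK embeds the submodules of eM into those of M. -/
instance {M : Type*} [AddCommGroup M] [Module A M] [IsNoetherian A M] :
    IsNoetherian he.Corner (CornerPart he M) := by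
  rw [isNoetherian_iff']
  refine StrictMono.wellFoundedGT
    (f := fun K : Submodule he.Corner (CornerPart he M) =>
      Submodule.span A (Subtype.val '' (K : Set (CornerPart he M)))) ?_
  refine Monotone.strictMono_of_injective
    (fun K L h => Submodule.span_mono (Set.image_mono h)) ?_
  have : ∀ K L : Submodule he.Corner (CornerPart he M),
      Submodule.span A (Subtype.val '' (K : Set (CornerPart he M))) =
        Submodule.span A (Subtype.val '' (L : Set (CornerPart he M))) → K ≤ L := by
    intro K L h x hx
    refine CornerPart.mem_of_mem_span he L ?_
    rw [← h]
    exact Submodule.subset_span ⟨x, hx, rfl⟩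
  exact fun K L h => le_antisymm (this _ _ h) (this _ _ h.symm)

/-- A nonzero K ≤ eS generates the simple module S, and AK ∩ eS = K. -/
lemma CornerPart.isSimpleModule {S : Type*} [AddCommGroup S] [Module A S] [IsSimpleModule A S]
    {x : S} (hx : e • x ≠ 0) : IsSimpleModule he.Corner (CornerPart he S) := by
  have : Nontrivial (CornerPart he S) :=
    ⟨⟨⟨e • x, smul_mem_cornerPart he S x⟩, 0, fun h => hx (congrArg Subtype.val h)⟩⟩
  have h : IsSimpleOrder (Submodule he.Corner (CornerPart he S)) := by
    refine ⟨fun K => ?_⟩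
    rw [or_iff_not_imp_left]
    intro hK
    obtain ⟨y, hy, hy0⟩ := K.exists_mem_ne_zero_of_ne_bot hK
    rw [eq_top_iff]
    intro z _
    refine CornerPart.mem_of_mem_span he K ?_
    have : Submodule.span A (Subtype.val '' (K : Set (CornerPart he S))) = ⊤ := by
      rw [eq_top_iff, ← IsSimpleModule.span_singleton_eq_top A (m := y.1)
        (fun h => hy0 (Subtype.ext h))]
      exact Submodule.span_mono (Set.singleton_subset_iff.2 ⟨y, hy, rfl⟩)
    rw [this]
    trivial
  exact { toIsSimpleOrder := h }

namespace Induced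

variable {N : Type*} [AddCommGroup N] [Module he.Corner N]

/-- An element x of I sends ae ⊗ n to xae(e ⊗ n). By `hI`, xae lies in the left ideal generated by I
∩ eAe, whose elements kill e ⊗ N. -/
lemma smul_eq_zero_of_killed (I : Ideal A) [I.IsTwoSided]
    (hI : ∀ x ∈ I, x * e = x → x ∈ Ideal.span {y | y ∈ I ∧ e * y * e = y})
    (hN : ∀ c : he.Corner, c.1 ∈ I → ∀ n : N, c • n = 0) :
    ∀ x ∈ I, ∀ z : Induced he N, x • z = 0 := by
  intro x hx z
  induction z using induction with
  | add z z' h h' => rw [smul_add, h, h', add_zero]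
  | smul a n =>
    have h1 : x * a * e ∈ Ideal.span {y | y ∈ I ∧ e * y * e = y} :=
      hI _ (I.mul_mem_right _ (I.mul_mem_right _ hx)) (by rw [mul_assoc, he.eq])
    have h2 : ∀ y ∈ Ideal.span {y | y ∈ I ∧ e * y * e = y}, y • unit he N n = 0 := by
      intro y hy
      induction hy using Submodule.span_induction with
      | mem y hy =>
        let c : he.Corner := ⟨y, y, hy.2⟩
        have := unit_smul he c n
        rw [hN c hy.1, map_zero] at this
        exact this.symm
      | zero => rw [zero_smul]
      | add y y' _ _ h h' => rw [add_smul, h, h', add_zero]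
      | smul b y _ h => rw [smul_assoc, h, smul_zero]
    rw [← smul_unit, smul_smul, smul_smul]
    exact h2 _ h1

variable (N) in
/-- The residue class of `e ⊗ n` in the head. -/
def headUnit : N →+ Head A (Induced he N) :=
  (Submodule.mkQ _).toAddMonoidHom.comp (unit he N)

lemma smul_headUnit (n : N) : e • headUnit he N n = headUnit he N n :=
  congrArg (Submodule.mkQ _) (smul_unit he n)

section Simple

variable [IsSimpleModule he.Corner N]

/-- If ez ≠ 0 for some z in K, the n with e ⊗ n in K form a nonzero submodule of the simple module
N. Then K contains e ⊗ N, which generates everything. Hence `cornerRad` is the greatest proper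
submodule. -/
lemma smul_eq_zero_of_ne_top {K : Submodule A (Induced he N)} (hK : K ≠ ⊤) {z : Induced he N}
    (hz : z ∈ K) : e • z = 0 := by
  by_contra h
  obtain ⟨n, hn⟩ := smul_mem_range he z
  have hn0 : n ≠ 0 := by rintro rfl; exact h (by rw [← hn, map_zero])
  apply hK
  let K' : Submodule he.Corner N :=
    { carrier := {n | unit he N n ∈ K}
      zero_mem' := by
        change unit he N 0 ∈ K
        rw [map_zero]
        exact K.zero_mem
      add_mem' := fun {a b} ha hb => by
        change unit he N (a + b) ∈ K
        rw [map_add]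
        exact K.add_mem ha hb
      smul_mem' := fun c a ha => by
        change unit he N (c • a) ∈ K
        rw [unit_smul]
        exact K.smul_mem _ ha }
  have hK' : K' = ⊤ := by
    refine (eq_bot_or_eq_top K').resolve_left fun h0 => hn0 ?_
    have : n ∈ K' := by
      change unit he N n ∈ K
      rw [hn]
      exact K.smul_mem _ hz
    rwa [h0] at this
  rw [eq_top_iff, ← span_unit he, Submodule.span_le]
  rintro _ ⟨m, rfl⟩
  have : m ∈ K' := by rw [hK']; trivial
  exact this

lemma cornerRad_ne_top : cornerRad e (Induced he N) ≠ ⊤ := by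
  have := IsSimpleModule.nontrivial he.Corner N
  obtain ⟨n, hn⟩ := exists_ne (0 : N)
  intro h
  have : unit he N n ∈ cornerRad e (Induced he N) := by rw [h]; trivial
  have := smul_eq_zero_of_mem_cornerRad this
  rw [smul_unit] at this
  exact hn (unit_injective he (by rw [this, map_zero]))

lemma le_cornerRad {K : Submodule A (Induced he N)} (hK : K ≠ ⊤) :
    K ≤ cornerRad e (Induced he N) :=
  fun _ hz a => smul_eq_zero_of_ne_top he hK (K.smul_mem a hz)

lemma isCoatom_cornerRad : IsCoatom (cornerRad e (Induced he N)) :=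
  ⟨cornerRad_ne_top he, fun K hK => by
    by_contra h
    exact hK.not_ge (le_cornerRad he h)⟩

lemma jacobson_eq : Module.jacobson A (Induced he N) = cornerRad e (Induced he N) := by
  refine le_antisymm (sInf_le (isCoatom_cornerRad he)) (le_sInf fun K hK => ?_)
  exact ((hK.le_iff.1 (le_cornerRad he hK.1)).resolve_left (cornerRad_ne_top he)).le

instance isSimpleModule_head : IsSimpleModule A (Head A (Induced he N)) := by
  rw [isSimpleModule_iff_isCoatom, jacobson_eq]
  exact isCoatom_cornerRad he

instance : Nontrivial (Induced he N) := by
  have := cornerRad_ne_top he (N := N)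
  by_contra h
  rw [not_nontrivial_iff_subsingleton] at h
  exact this (Subsingleton.elim _ _)

lemma headUnit_injective : Function.Injective (headUnit he N) := by
  rw [injective_iff_map_eq_zero]
  intro n hn
  have h : unit he N n ∈ Module.jacobson A (Induced he N) := (Submodule.Quotient.mk_eq_zero _).1 hn
  rw [jacobson_eq] at h
  have := smul_eq_zero_of_mem_cornerRad h
  rw [smul_unit] at this
  exact unit_injective he (by rw [this, map_zero])

/-- `N ≅ e D` for the head `D` of `Ae ⊗ N`. -/
def headCornerEquiv : N ≃ₗ[he.Corner] CornerPart he (Head A (Induced he N)) :=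
  LinearEquiv.ofBijective
    { toFun := fun n => ⟨headUnit he N n, smul_headUnit he n⟩
      map_add' := fun n n' => Subtype.ext (map_add _ n n')
      map_smul' := fun c n => Subtype.ext (congrArg (Submodule.mkQ _) (unit_smul he c n)) }
    ⟨fun n n' h => headUnit_injective he (congrArg Subtype.val h), fun z => by
      obtain ⟨z, hz⟩ := z
      obtain ⟨z, rfl⟩ := Submodule.mkQ_surjective _ z
      obtain ⟨n, hn⟩ := smul_mem_range he z
      refine ⟨n, Subtype.ext ?_⟩
      change Submodule.mkQ _ (unit he N n) = _
      rw [hn]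
      exact hz⟩

lemma exists_head_smul_ne_zero : ∃ z : Head A (Induced he N), e • z ≠ 0 := by
  have := IsSimpleModule.nontrivial he.Corner N
  obtain ⟨n, hn⟩ := exists_ne (0 : N)
  refine ⟨headUnit he N n, fun h => hn (headUnit_injective he ?_)⟩
  rw [← smul_headUnit, h, map_zero]

/-- A simple module `S` with `eS ≅ N` is the head of `Ae ⊗ N`. -/
lemma nonempty_equiv_head {S : Type*} [AddCommGroup S] [Module A S] [IsSimpleModule A S]
    (g : N ≃ₗ[he.Corner] CornerPart he S) : Nonempty (S ≃ₗ[A] Head A (Induced he N)) := by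
  let f : N →+ S := (CornerPart he S).subtype.comp g.toLinearMap.toAddMonoidHom
  have hf : ∀ (c : he.Corner) n, f (c • n) = c.1 • f n := fun c n =>
    congrArg Subtype.val (map_smul g c n)
  let F := lift he f hf
  have := IsSimpleModule.nontrivial he.Corner N
  obtain ⟨n, hn⟩ := exists_ne (0 : N)
  have hF : F ≠ 0 := by
    intro h0
    have h1 := lift_unit he f hf n
    change F _ = _ at h1
    rw [h0] at h1
    exact hn (g.injective (Subtype.ext (h1.symm.trans (by rw [map_zero]; rfl))))
  have hs := LinearMap.surjective_of_ne_zero hF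
  have hk := LinearMap.isCoatom_ker_of_surjective hs
  have hke : LinearMap.ker F = Module.jacobson A (Induced he N) := by
    rw [jacobson_eq]
    exact ((hk.le_iff.1 (le_cornerRad he hk.1)).resolve_left (cornerRad_ne_top he)).symm
  exact ⟨((Submodule.quotEquivOfEq _ _ hke.symm).trans (F.quotKerEquivOfSurjective hs)).symm⟩

end Simple

/-- A surjection onto `X = AeX` from a direct sum of modules `Ae ⊗ N q`, if `eX` is the direct sum
of the modules `N q`. -/
lemma exists_pi_surjective {X : Type*} [AddCommGroup X] [Module A X]
    (hX : Submodule.span A {x : X | e • x = x} = ⊤) {m : ℕ} {N : Fin m → Type*}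
    [∀ q, AddCommGroup (N q)] [∀ q, Module he.Corner (N q)]
    (ψ : CornerPart he X ≃ₗ[he.Corner] ∀ q, N q) :
    ∃ g : (∀ q, Induced he (N q)) →ₗ[A] X, Function.Surjective g ∧
      ∀ z, e • z = z → g z = 0 → z = 0 := by
  let f (q : Fin m) : N q →+ X := (CornerPart he X).subtype.comp
    (ψ.symm.toLinearMap.comp (LinearMap.single he.Corner N q)).toAddMonoidHom
  have hf (q) : ∀ (c : he.Corner) n, f q (c • n) = c.1 • f q n := fun c n =>
    congrArg Subtype.val (map_smul (ψ.symm.toLinearMap.comp (LinearMap.single he.Corner N q)) c n)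
  let g : (∀ q, Induced he (N q)) →ₗ[A] X :=
    ∑ q, (lift he (f q) (hf q)).comp (LinearMap.proj q)
  -- On the e-part, which is the product of the N q, the map g is ψ⁻¹. So its image contains the
  -- generating set eX, and its kernel meets the e-part trivially.
  have hg : ∀ n : ∀ q, N q, g (fun q => unit he (N q) (n q)) = (ψ.symm n).1 := by
    intro n
    simp only [g, LinearMap.sum_apply, LinearMap.comp_apply, LinearMap.proj_apply, lift_unit]
    change ∑ q, (CornerPart he X).subtype (ψ.symm (Pi.single q (n q))) = _
    rw [← map_sum, ← map_sum, Finset.univ_sum_single]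
    rfl
  refine ⟨g, ?_, ?_⟩
  · rw [← LinearMap.range_eq_top, eq_top_iff, ← hX, Submodule.span_le]
    intro x hx
    refine ⟨_, (hg (ψ ⟨x, hx⟩)).trans ?_⟩
    rw [ψ.symm_apply_apply]
  · intro z hz h0
    have : ∀ q, ∃ n, unit he (N q) n = z q := fun q => exists_unit he (congrFun hz q)
    choose n hn using this
    have hz' : z = fun q => unit he (N q) (n q) := funext fun q => (hn q).symm
    rw [hz', hg] at h0
    have h1 : n = 0 := by
      apply ψ.symm.injective
      rw [map_zero]
      exact Subtype.ext h0
    rw [hz', h1]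
    funext q
    exact map_zero _

lemma span_pi_corner {m : ℕ} {N : Fin m → Type*}
    [∀ q, AddCommGroup (N q)] [∀ q, Module he.Corner (N q)] :
    Submodule.span A {z : ∀ q, Induced he (N q) | e • z = z} = ⊤ := by
  rw [eq_top_iff]
  intro z _
  rw [← Finset.univ_sum_single z]
  refine Submodule.sum_mem _ fun q _ => ?_
  have : ∀ y : Induced he (N q), Pi.single q y ∈
      Submodule.span A {z : ∀ q, Induced he (N q) | e • z = z} := by
    intro y
    induction y using induction with
    | add y y' h h' => rw [Pi.single_add]; exact add_mem h h'
    | smul a n =>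
      rw [← LinearMap.coe_single (R := A), map_smul]
      refine Submodule.smul_mem _ _ (Submodule.subset_span ?_)
      change e • _ = _
      rw [← map_smul, smul_unit]
  exact this _

end Induced

/-- A split surjection is injective if it is injective on a generating set `eY` of its domain. -/
lemma injective_of_split {X Y : Type*} [AddCommGroup X] [Module A X] [AddCommGroup Y] [Module A Y]
    (hY : Submodule.span A {y : Y | e • y = y} = ⊤) (g : Y →ₗ[A] X) (s : X →ₗ[A] Y)
    (hs : ∀ x, g (s x) = x) (hg : ∀ y, e • y = y → g y = 0 → y = 0) : Function.Injective g := by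
  -- For y in eY, the element s(g y) − y lies in eY and is killed by g, hence vanishes; and eY
  -- generates Y.
  have h : ∀ y, s (g y) = y := by
    intro y
    have hy : y ∈ Submodule.span A {y : Y | e • y = y} := by rw [hY]; trivial
    induction hy using Submodule.span_induction with
    | mem y hy =>
      rw [← sub_eq_zero]
      refine hg _ ?_ (by rw [map_sub, hs, sub_self])
      rw [smul_sub, ← map_smul, ← map_smul, show e • y = y from hy]
    | zero => rw [map_zero, map_zero]
    | add y y' _ _ h h' => rw [map_add, map_add, h, h']
    | smul a y _ h => rw [map_smul, map_smul, h]
  exact Function.LeftInverse.injective h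

end CornerSimple

/-! ### Modules over a quotient of a ring -/

section Surjective

variable {S R : Type*} [Ring S] [Ring R] (φ : S →+* R)
  (N : Type*) [AddCommGroup N] [Module S N]

lemma exists_module_of_surjective (hφ : Function.Surjective φ)
    (hN : ∀ s, φ s = 0 → ∀ n : N, s • n = 0) : ∃ _ : Module R N, ∀ s (n : N), φ s • n = s • n := by
  have key : ∀ s t, φ s = φ t → ∀ n : N, s • n = t • n := fun s t h n => by
    rw [← sub_eq_zero, ← sub_smul]
    exact hN _ (by rw [map_sub, h, sub_self]) n
  have hσ := Function.surjInv_eq hφ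
  exact ⟨{
    smul := fun r n => Function.surjInv hφ r • n
    one_smul := fun n => (key _ 1 (by rw [hσ, map_one]) n).trans (one_smul S n)
    mul_smul := fun r r' n =>
      (key _ (Function.surjInv hφ r * Function.surjInv hφ r')
        (by rw [map_mul, hσ, hσ, hσ]) n).trans (mul_smul _ _ n)
    smul_zero := fun r => smul_zero (Function.surjInv hφ r)
    smul_add := fun r n n' => smul_add (Function.surjInv hφ r) n n'
    add_smul := fun r r' n =>
      (key _ (Function.surjInv hφ r + Function.surjInv hφ r')
        (by rw [map_add, hσ, hσ, hσ]) n).trans (add_smul _ _ n)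
    zero_smul := fun n => (key _ 0 (by rw [hσ, map_zero]) n).trans (zero_smul S n) },
    fun s n => key _ _ (hσ _) n⟩

lemma isSemisimpleModule_of_surjective [IsSemisimpleRing R] (hφ : Function.Surjective φ)
    (hN : ∀ s, φ s = 0 → ∀ n : N, s • n = 0) : IsSemisimpleModule S N := by
  obtain ⟨_, h⟩ := exists_module_of_surjective φ N hφ hN
  have : RingHomSurjective φ := ⟨hφ⟩
  exact (LinearMap.isSemisimpleModule_iff_of_bijective
    ({ toFun := id, map_add' := fun _ _ => rfl, map_smul' := fun s n => (h s n).symm } : N →ₛₗ[φ] N)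
    Function.bijective_id).2 inferInstance

end Surjective

/-! ### Filtrations -/

section Filtration

variable {R : Type*} [Ring R] {L : Type*} [PartialOrder L] (Δ : L → Type*)
  [∀ i, AddCommGroup (Δ i)] [∀ i, Module R (Δ i)] (a : L)
  {P : Type*} [AddCommGroup P] [Module R P]

/-- `N'` is a submodule with `N' / N ≅ Δ b` for some `b > a`. -/
def FiltrationStep (N N' : Submodule R P) : Prop :=
  N < N' ∧ ∃ b, a < b ∧ Nonempty ((N' ⧸ N.submoduleOf N') ≃ₗ[R] Δ b)

variable {Δ a}

/-- Closures under single steps let the filtrations of successive layers be joined by transitivity;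
an indexed chain is extracted only at the end. -/
lemma exists_chain_of_reflTransGen {K : Submodule R P}
    (h : Relation.ReflTransGen (FiltrationStep Δ a) ⊥ K) :
    ∃ (m : ℕ) (F : ℕ → Submodule R P), F 0 = ⊥ ∧ F m = K ∧
      ∀ q < m, FiltrationStep Δ a (F q) (F (q + 1)) := by
  induction h with
  | refl => exact ⟨0, fun _ => ⊥, rfl, rfl, fun q hq => absurd hq (Nat.not_lt_zero q)⟩
  | @tail K K' _ hs ih =>
    obtain ⟨m, F, h0, hm, hF⟩ := ih
    refine ⟨m + 1, fun q => if q ≤ m then F q else K', by simp [h0], by simp, fun q hq => ?_⟩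
    rcases Nat.lt_succ_iff_lt_or_eq.1 hq with h | rfl
    · simpa [h.le, Nat.succ_le_of_lt h] using hF q h
    · simpa [hm] using hs

lemma hasStandardFiltration_of_reflTransGen {K : Submodule R P} (hK : K < ⊤)
    (h : Relation.ReflTransGen (FiltrationStep Δ a) ⊥ K) (f : Nonempty ((P ⧸ K) ≃ₗ[R] Δ a)) :
    HasStandardFiltration R Δ a P := by
  obtain ⟨m, F, h0, hm, hF⟩ := exists_chain_of_reflTransGen h
  refine ⟨m, fun q => if q ≤ m then F q else ⊤, by simp [h0], by simp, ?_, ?_, ?_⟩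
  · intro q hq
    rcases hq.lt_or_eq with h | rfl
    · simpa [h.le, Nat.succ_le_of_lt h] using (hF q h).1
    · simpa [hm] using hK
  · have h' : (if m ≤ m then F m else ⊤) = K := by rw [if_pos le_rfl, hm]
    beta_reduce
    rw [h']
    exact f
  · intro q hq
    have h₁ : (if q ≤ m then F q else ⊤) = F q := if_pos hq.le
    have h₂ : (if q + 1 ≤ m then F (q + 1) else ⊤) = F (q + 1) := if_pos hq
    obtain ⟨b, hb, ⟨f⟩⟩ := (hF q hq).2
    refine ⟨b, hb, ?_⟩
    beta_reduce
    rw [h₁, h₂]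
    exact ⟨f⟩

/-- The quotient of nested submodules as image of a linear map. -/
def quotSubmoduleOfEquiv {N N' : Submodule R P} {D : Type*} [AddCommGroup D] [Module R D]
    (f : N' →ₗ[R] D) (hf : Function.Surjective f) (h : LinearMap.ker f = N.submoduleOf N') :
    (N' ⧸ N.submoduleOf N') ≃ₗ[R] D :=
  (Submodule.quotEquivOfEq _ _ h.symm).trans (f.quotKerEquivOfSurjective hf)

/-- Partial products refine N₁ ≤ N₂: F t consists of the elements whose coordinates q ≥ t vanish,
and F (t + 1) / F t is the coordinate t. Nontriviality of the factors makes the steps strict. -/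
lemma reflTransGen_of_pi [∀ i, Nontrivial (Δ i)] {N₁ N₂ : Submodule R P} (hN : N₁ ≤ N₂) {m : ℕ} (b : Fin m → L)
    (hb : ∀ q, a < b q) (g : N₂ →ₗ[R] ∀ q, Δ (b q)) (hg : Function.Surjective g)
    (hk : LinearMap.ker g = N₁.submoduleOf N₂) :
    Relation.ReflTransGen (FiltrationStep Δ a) N₁ N₂ := by
  let F (t : ℕ) : Submodule R P := Submodule.map N₂.subtype
    (⨅ q : Fin m, ⨅ _ : t ≤ q.1, LinearMap.ker ((LinearMap.proj q).comp g))
  have hF : ∀ t (x : N₂), x.1 ∈ F t ↔ ∀ q : Fin m, t ≤ q.1 → g x q = 0 := by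
    intro t x
    simp only [F, Submodule.mem_map, Submodule.mem_iInf, LinearMap.mem_ker, LinearMap.comp_apply,
      LinearMap.proj_apply]
    constructor
    · rintro ⟨y, hy, hyx⟩
      obtain rfl : y = x := Subtype.ext hyx
      exact hy
    · intro h
      exact ⟨x, h, rfl⟩
  have hle : ∀ t, F t ≤ N₂ := fun t => Submodule.map_subtype_le _ _
  have h0 : F 0 = N₁ := by
    ext x
    constructor
    · intro hx
      have := (hF 0 ⟨x, hle 0 hx⟩).1 hx
      have h : (⟨x, hle 0 hx⟩ : N₂) ∈ LinearMap.ker g := funext fun q => this q (Nat.zero_le _)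
      rw [hk] at h
      exact h
    · intro hx
      refine (hF 0 ⟨x, hN hx⟩).2 fun q _ => ?_
      have h : (⟨x, hN hx⟩ : N₂) ∈ LinearMap.ker g := by rw [hk]; exact hx
      exact congrFun h q
  have hm : F m = N₂ := by
    refine le_antisymm (hle m) fun x hx => ?_
    exact (hF m ⟨x, hx⟩).2 fun q hq => absurd q.2 (by omega)
  have hmono : ∀ t, F t ≤ F (t + 1) := fun t x hx =>
    (hF (t + 1) ⟨x, hle t hx⟩).2 fun q hq => (hF t ⟨x, hle t hx⟩).1 hx q (by omega)
  have key : ∀ t, t ≤ m → Relation.ReflTransGen (FiltrationStep Δ a) N₁ (F t) := by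
    intro t
    induction t with
    | zero => intro _; rw [h0]
    | succ t ih =>
      intro ht
      refine (ih (by omega)).tail ?_
      let q : Fin m := ⟨t, ht⟩
      let f : F (t + 1) →ₗ[R] Δ (b q) :=
        (LinearMap.proj q).comp (g.comp (Submodule.inclusion (hle (t + 1))))
      have hf : Function.Surjective f := by
        intro y
        obtain ⟨x, hx⟩ := hg (Pi.single q y)
        refine ⟨⟨x.1, (hF (t + 1) x).2 fun q' hq' => ?_⟩, ?_⟩
        · rw [hx, Pi.single_eq_of_ne]
          intro h
          have := congrArg Fin.val h
          simp only [q] at this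
          omega
        · change g x q = y
          rw [hx, Pi.single_eq_same]
      have hfk : LinearMap.ker f = (F t).submoduleOf (F (t + 1)) := by
        ext ⟨x, hx⟩
        change g ⟨x, hle (t + 1) hx⟩ q = 0 ↔ x ∈ F t
        have h1 := (hF (t + 1) ⟨x, hle (t + 1) hx⟩).1 hx
        refine Iff.trans ?_ (hF t ⟨x, hle (t + 1) hx⟩).symm
        constructor
        · intro h q' hq'
          rcases hq'.lt_or_eq with h' | h'
          · exact h1 q' h'
          · obtain rfl : q = q' := Fin.ext h'
            exact h
        · intro h
          exact h q le_rfl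
      refine ⟨(hmono t).lt_of_ne fun h => ?_, b q, hb q, ⟨quotSubmoduleOfEquiv f hf hfk⟩⟩
      obtain ⟨y, hy⟩ := exists_ne (0 : Δ (b q))
      obtain ⟨x, rfl⟩ := hf y
      apply hy
      rw [← LinearMap.mem_ker, hfk]
      change x.1 ∈ F t
      rw [h]
      exact x.2
  rw [← hm]
  exact key m le_rfl

end Filtration

/-! ### Twisted group algebras are semisimple -/

/-- Maschke's argument: a k-linear projection p onto K is averaged to |G|⁻¹ ∑ u(g)⁻¹ p(u(g)x). The
twist is harmless because c(g,h) u(g)⁻¹ = u(h) u(gh)⁻¹, so reindexing by g ↦ gh still works. -/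
lemma isSemisimpleRing_of_units {k R G : Type*} [Field k] [Ring R] [Algebra k R] [Group G]
    [Finite G] (u : G → Rˣ) (c : G → G → k) (hu : ∀ g h, (u g * u h : R) = c g h • (u (g * h) : R))
    (hspan : Submodule.span k (Set.range fun g => (u g : R)) = ⊤) (hG : (Nat.card G : k) ≠ 0) :
    IsSemisimpleRing R := by
  let _ := Fintype.ofFinite G
  refine (isSemisimpleModule_iff R R).2 ⟨fun K => ?_⟩
  obtain ⟨p, hp⟩ := LinearMap.exists_leftInverse_of_injective
    (K.restrictScalars k).subtype (LinearMap.ker_eq_bot.2 (Submodule.injective_subtype _))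
  have hp' : ∀ x (hx : x ∈ K), (p x).1 = x := fun x hx =>
    congrArg Subtype.val (LinearMap.congr_fun hp ⟨x, hx⟩)
  let q : R →ₗ[k] R := (Nat.card G : k)⁻¹ • ∑ g : G,
    (LinearMap.mulLeft k ((u g)⁻¹ : Rˣ).1).comp
      ((K.restrictScalars k).subtype.comp (p.comp (LinearMap.mulLeft k (u g).1)))
  have hq : ∀ x, q x = (Nat.card G : k)⁻¹ • ∑ g : G, ((u g)⁻¹ : Rˣ).1 * (p ((u g).1 * x)).1 := by
    intro x
    simp [q]
  have hqK : ∀ x, q x ∈ K := by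
    intro x
    rw [hq]
    refine Submodule.smul_of_tower_mem K _ (Submodule.sum_mem _ fun g _ => ?_)
    exact K.smul_mem _ (p _).2
  have hqid : ∀ x ∈ K, q x = x := by
    intro x hx
    have : ∀ g : G, ((u g)⁻¹ : Rˣ).1 * (p ((u g).1 * x)).1 = x := by
      intro g
      rw [hp' ((u g).1 * x) (K.smul_mem (u g).1 hx), Units.inv_mul_cancel_left]
    rw [hq, Finset.sum_congr rfl fun g _ => this g, Finset.sum_const, Finset.card_univ,
      ← Nat.card_eq_fintype_card, ← Nat.cast_smul_eq_nsmul k, smul_smul, inv_mul_cancel₀ hG,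
      one_smul]
  have hqu : ∀ h x, q ((u h).1 * x) = (u h).1 * q x := by
    intro h x
    rw [hq, hq, mul_smul_comm, Finset.mul_sum]
    congr 1
    rw [← Equiv.sum_comp (Equiv.mulRight h) fun g =>
      (u h).1 * (((u g)⁻¹ : Rˣ).1 * (p ((u g).1 * x)).1)]
    refine Finset.sum_congr rfl fun g _ => ?_
    rw [Equiv.coe_mulRight, ← mul_assoc (u g).1, hu, smul_mul_assoc, map_smul]
    have h1 : c g h • ((u g)⁻¹ : Rˣ).1 = (u h).1 * ((u (g * h))⁻¹ : Rˣ).1 := by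
      rw [Units.eq_mul_inv_iff_mul_eq, smul_mul_assoc, ← mul_smul_comm, ← hu,
        Units.inv_mul_cancel_left]
    rw [← mul_assoc, ← h1, smul_mul_assoc]
    exact mul_smul_comm _ _ _
  have hqmul : ∀ r x, q (r * x) = r * q x := by
    intro r x
    have hr : r ∈ Submodule.span k (Set.range fun g => (u g : R)) := by rw [hspan]; trivial
    induction hr using Submodule.span_induction with
    | mem r hr =>
      obtain ⟨g, rfl⟩ := hr
      exact hqu g x
    | zero => rw [zero_mul, zero_mul, map_zero]
    | add r r' _ _ h h' => rw [add_mul, add_mul, map_add, h, h']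
    | smul c r _ h => rw [smul_mul_assoc, smul_mul_assoc, map_smul, h]
  let Q : R →ₗ[R] K :=
    { toFun := fun x => ⟨q x, hqK x⟩
      map_add' := fun x y => Subtype.ext (map_add q x y)
      map_smul' := fun r x => Subtype.ext (hqmul r x) }
  exact ⟨LinearMap.ker Q, LinearMap.isCompl_of_proj fun x => Subtype.ext (hqid x.1 x.2)⟩

section

variable {C : Type u} [Category.{v} C]

lemma TwistedAlg.span_of {k : Type w} [Field k] (α : TwoCocycle C k) :
    Submodule.span k (Set.range (TwistedAlg.of α)) = ⊤ := by
  rw [eq_top_iff]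
  intro a _
  induction a using TwistedAlg.induction with
  | zero => exact zero_mem _
  | add a b ha hb => exact add_mem (ha trivial) (hb trivial)
  | single c s => exact Submodule.smul_mem _ _ (Submodule.subset_span ⟨s, rfl⟩)

instance TwistedGroupAlg.isSemisimpleRing {k : Type w} [Field k] (α : TwoCocycle C k)
    [∀ X Y : C, Finite (X ⟶ Y)] (e : Idem C) [hk : NeZero (Nat.card e.Gam : k)] :
    IsSemisimpleRing (TwistedGroupAlg α e) := by
  let β := α.restrict e
  have hmul : ∀ g h : e.Gam, (TwistedAlg.of β (gamMor e g) * TwistedAlg.of β (gamMor e h)) =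
      ((α.val g.1.1 h.1.1 : kˣ) : k) • TwistedAlg.of β (gamMor e (g * h)) := fun g h =>
    TwistedAlg.of_mul_of β (gamMor e g).hom (gamMor e h).hom
  have hone : (1 : TwistedGroupAlg α e) =
      ((α.val e.hom e.hom)⁻¹ : kˣ).1 • TwistedAlg.of β (gamMor e 1) := by
    let _ : Fintype (SingleObj e.Gam) := inferInstanceAs (Fintype Unit)
    rw [TwistedAlg.one_def]
    simp
    rfl
  -- The basis element of 1 ∈ Γ_e is α(e,e) times the identity, which explains the scalars in the
  -- inverses below.
  have hone' (c : kˣ) : (c : k) • TwistedAlg.of β (gamMor e 1) =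
      (c * α.val e.hom e.hom : kˣ).1 • (1 : TwistedGroupAlg α e) := by
    rw [hone, smul_smul, ← Units.val_mul, mul_inv_cancel_right]
  have hunit : ∀ g : e.Gam, IsUnit (TwistedAlg.of β (gamMor e g)) := by
    intro g
    rw [isUnit_iff_exists_and_exists]
    constructor
    · refine ⟨(((α.val g.1.1 (g⁻¹).1.1) * α.val e.hom e.hom)⁻¹ : kˣ).1 •
        TwistedAlg.of β (gamMor e g⁻¹), ?_⟩
      rw [mul_smul_comm, hmul, mul_inv_cancel, hone', smul_smul, Units.inv_mul, one_smul]
    · refine ⟨(((α.val (g⁻¹).1.1 g.1.1) * α.val e.hom e.hom)⁻¹ : kˣ).1 •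
        TwistedAlg.of β (gamMor e g⁻¹), ?_⟩
      rw [smul_mul_assoc, hmul, inv_mul_cancel, hone', smul_smul, Units.inv_mul, one_smul]
  refine isSemisimpleRing_of_units (fun g => (hunit g).unit)
    (fun g h => ((α.val g.1.1 h.1.1 : kˣ) : k)) hmul ?_ hk.ne
  rw [eq_top_iff, ← TwistedAlg.span_of]
  refine Submodule.span_mono ?_
  rintro _ ⟨⟨⟨⟩, ⟨⟩, g⟩, rfl⟩
  exact ⟨g, rfl⟩

end

/-! ### The `J`-order of a finite split category -/

section Combinatorics

variable {C : Type u} [Category.{v} C]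

lemma mem_idealGen_singleton {y s : Mor C} :
    y ∈ idealGen {s} ↔ ∃ (a : y.dom ⟶ s.dom) (b : s.cod ⟶ y.cod), y.hom = a ≫ s.hom ≫ b := by
  constructor
  · rintro ⟨s, rfl, h⟩
    exact h
  · rintro h
    exact ⟨s, rfl, h⟩

lemma self_mem_idealGen (s : Mor C) : s ∈ idealGen {s} :=
  mem_idealGen_singleton.2 ⟨𝟙 _, 𝟙 _, by simp⟩

lemma mem_idealGen_trans {r s t : Mor C} (h : r ∈ idealGen {s}) (h' : s ∈ idealGen {t}) :
    r ∈ idealGen {t} := by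
  rw [mem_idealGen_singleton] at *
  obtain ⟨a, b, h⟩ := h
  obtain ⟨c, d, h'⟩ := h'
  exact ⟨a ≫ c, d ≫ b, by rw [h, h']; simp⟩

lemma comp_mem_idealGen {X Y Z : C} (s : X ⟶ Y) (t : Y ⟶ Z) :
    (⟨X, Z, s ≫ t⟩ : Mor C) ∈ idealGen {⟨X, Y, s⟩} :=
  mem_idealGen_singleton.2 ⟨𝟙 _, t, by simp⟩

lemma comp_mem_idealGen' {X Y Z : C} (s : X ⟶ Y) (t : Y ⟶ Z) :
    (⟨X, Z, s ≫ t⟩ : Mor C) ∈ idealGen {⟨Y, Z, t⟩} :=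
  mem_idealGen_singleton.2 ⟨s, 𝟙 _, by simp⟩

lemma idealGen_subset {s t : Mor C} : idealGen {s} ⊆ idealGen {t} ↔ s ∈ idealGen {t} :=
  ⟨fun h => h (self_mem_idealGen s), fun h _ hr => mem_idealGen_trans hr h⟩

lemma idealGen_jClass (s : Mor C) : idealGen (jClass s) = idealGen {s} := by
  ext y
  constructor
  · rintro ⟨t, ht, a, b, h⟩
    refine mem_idealGen_trans (mem_idealGen_singleton.2 ⟨a, b, h⟩) ?_
    exact ht ▸ self_mem_idealGen t
  · rintro ⟨t, rfl, h⟩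
    exact ⟨t, rfl, h⟩

lemma jLT_iff {s t : Mor C} : JLT (jClass s) (jClass t) ↔ s ∈ idealGen {t} ∧ t ∉ idealGen {s} := by
  rw [JLT, idealGen_jClass, idealGen_jClass, ssubset_iff_subset_not_subset, idealGen_subset,
    idealGen_subset]

lemma Idem.Equivalent.mem_idealGen {e f : Idem C} (h : e.Equivalent f) :
    e.toMor ∈ idealGen {f.toMor} ∧ f.toMor ∈ idealGen {e.toMor} := by
  obtain ⟨s, t, ⟨s', hs⟩, ⟨t', ht⟩, h1, h2⟩ := h
  constructor
  · refine mem_idealGen_singleton.2 ⟨t, s, ?_⟩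
    change e.hom = t ≫ f.hom ≫ s
    have hf := f.idem
    rw [h1, hs, reassoc_of% hf]
  · refine mem_idealGen_singleton.2 ⟨s, t, ?_⟩
    change f.hom = s ≫ e.hom ≫ t
    have he := e.idem
    rw [h2, ht, reassoc_of% he]

variable [∀ X Y : C, Finite (X ⟶ Y)]

namespace Idem

/-- Cutting e = b ∘ f ∘ a down by e gives b'fa' = 1 in a finite monoid, where one-sided inverses are
two-sided. So the non-units lie in strictly lower J-classes. -/
lemma isUnit_of_mem_idealGen (e : Idem C) (f : e.LocalMonoid)
    (h : e.toMor ∈ idealGen {⟨e.obj, e.obj, f.1⟩}) : IsUnit f := by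
  obtain ⟨a, b, h⟩ := mem_idealGen_singleton.1 h
  change e.obj ⟶ e.obj at a
  change e.obj ⟶ e.obj at b
  change e.hom = a ≫ f.1 ≫ b at h
  let a' : e.LocalMonoid := ⟨e.hom ≫ a ≫ e.hom, a, rfl⟩
  let b' : e.LocalMonoid := ⟨e.hom ≫ b ≫ e.hom, b, rfl⟩
  have h1 : b' * (f * a') = 1 := by
    refine Subtype.ext ?_
    change ((e.hom ≫ a ≫ e.hom) ≫ f.1) ≫ e.hom ≫ b ≫ e.hom = e.hom
    have h2 := e.hom_comp f
    have h3 := e.comp_hom f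
    simp only [Category.assoc]
    rw [reassoc_of% h2, reassoc_of% h3]
    have := congrArg (fun z => e.hom ≫ z ≫ e.hom) h
    simp only [Category.assoc, e.idem] at this
    exact this.symm
  have h2 := mul_eq_one_symm h1
  rw [mul_assoc] at h2
  exact IsUnit.of_mul_eq_one _ h2

/-- With t = f ∘ a ∘ e and s = e ∘ b ∘ f one gets s ∘ t = e, so t ∘ s is idempotent. Moreover f
factors through t ∘ s, so this is a unit of the local monoid at f, and an idempotent unit is the
identity f. -/
lemma equivalent_of_mem_idealGen {e f : Idem C} (h : e.toMor ∈ idealGen {f.toMor})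
    (h' : f.toMor ∈ idealGen {e.toMor}) : e.Equivalent f := by
  obtain ⟨a, b, h⟩ := mem_idealGen_singleton.1 h
  obtain ⟨c, d, h'⟩ := mem_idealGen_singleton.1 h'
  change e.obj ⟶ f.obj at a
  change f.obj ⟶ e.obj at b
  change f.obj ⟶ e.obj at c
  change e.obj ⟶ f.obj at d
  change e.hom = a ≫ f.hom ≫ b at h
  change f.hom = c ≫ e.hom ≫ d at h'
  let t := e.hom ≫ a ≫ f.hom
  let s := f.hom ≫ b ≫ e.hom
  have hts : t ≫ s = e.hom := by
    have he := e.idem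
    have hf := f.idem
    have := congrArg (fun z => e.hom ≫ z ≫ e.hom) h
    simp only [Category.assoc, e.idem] at this
    simp only [t, s, Category.assoc]
    rw [reassoc_of% hf, ← this]
  have het : e.hom ≫ t = t := by
    have he := e.idem
    simp only [t]
    rw [reassoc_of% he]
  have hse : s ≫ e.hom = s := by
    simp only [s, Category.assoc, e.idem]
  let x : f.LocalMonoid := ⟨s ≫ t, b ≫ e.hom ≫ e.hom ≫ a, by simp [s, t]⟩
  have hx : IsUnit x := by
    refine f.isUnit_of_mem_idealGen x (mem_idealGen_singleton.2 ⟨c ≫ t, s ≫ d, ?_⟩)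
    change f.hom = (c ≫ t) ≫ (s ≫ t) ≫ s ≫ d
    simp only [Category.assoc]
    rw [reassoc_of% hts, reassoc_of% hts]
    have he := e.idem
    rw [reassoc_of% he, h']
  have hxx : x * x = x := by
    refine Subtype.ext ?_
    change (s ≫ t) ≫ s ≫ t = s ≫ t
    simp only [Category.assoc]
    rw [reassoc_of% hts, het]
  have hx1 : x = 1 := by
    obtain ⟨y, hy⟩ := hx
    rw [← hy, ← Units.val_mul, Units.val_inj, mul_eq_left] at hxx
    rw [← hy, hxx, Units.val_one]
  exact ⟨s, t, ⟨b, rfl⟩, ⟨a, rfl⟩, hts.symm, (congrArg Subtype.val hx1).symm⟩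

end Idem

/-- Stability: if `a ∘ s` belongs to the `J`-class of `s`, then also to its `L`-class. -/
lemma exists_comp_eq_of_mem_idealGen {X Y Z : C} (s : X ⟶ Y) (a : Y ⟶ Z)
    (h : (⟨X, Y, s⟩ : Mor C) ∈ idealGen {⟨X, Z, s ≫ a⟩}) : ∃ b : Z ⟶ Y, (s ≫ a) ≫ b = s := by
  obtain ⟨p, q, h⟩ := mem_idealGen_singleton.1 h
  change X ⟶ X at p
  change Z ⟶ Y at q
  change s = p ≫ (s ≫ a) ≫ q at h
  -- Iterating s = q ∘ (a ∘ s) ∘ p gives s = uⁿ ∘ s ∘ P with u = q ∘ a. By finiteness uⁱ = uⁱ⁺ᵈ⁺¹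
  -- for some i and d; since uⁱ ∘ s ∘ P = s, this yields s = uᵈ⁺¹ ∘ s = (uᵈ ∘ q) ∘ (a ∘ s).
  let u : End Y := a ≫ q
  have hP : ∀ n : ℕ, ∃ P : X ⟶ X, P ≫ s ≫ (u ^ n : End Y) = s := by
    intro n
    induction n with
    | zero => exact ⟨𝟙 X, by rw [pow_zero, End.one_def]; simp⟩
    | succ n ih =>
      obtain ⟨P, hP⟩ := ih
      refine ⟨P ≫ p, ?_⟩
      rw [pow_succ, End.mul_def]
      simp only [Category.assoc] at h ⊢
      change P ≫ p ≫ s ≫ (a ≫ q) ≫ _ = s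
      have h' : p ≫ s ≫ a ≫ q = s := h.symm
      simp only [Category.assoc]
      rw [reassoc_of% h', hP]
  have : Finite (End Y) := inferInstanceAs (Finite (Y ⟶ Y))
  obtain ⟨i, j, hij, hu⟩ := Finite.exists_ne_map_eq_of_infinite (fun n : ℕ => u ^ n)
  wlog hlt : i < j generalizing i j
  · exact this j i hij.symm hu.symm (by omega)
  obtain ⟨P, hP⟩ := hP i
  obtain ⟨d, rfl⟩ : ∃ d, j = i + (d + 1) := ⟨j - i - 1, by omega⟩
  refine ⟨q ≫ (u ^ d : End Y), ?_⟩
  have h1 : (u ^ (i + (d + 1)) : End Y) = (u ^ i : End Y) ≫ (a ≫ q) ≫ (u ^ d : End Y) := by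
    rw [add_comm, pow_add, End.mul_def, pow_succ, End.mul_def]
  have h2 : P ≫ s ≫ (u ^ (i + (d + 1)) : End Y) = s := by
    rw [← show u ^ i = u ^ (i + (d + 1)) from hu]
    exact hP
  rw [h1] at h2
  have h3 : P ≫ s ≫ (u ^ i : End Y) = s := hP
  rw [reassoc_of% h3] at h2
  simpa only [Category.assoc] using h2

/-! ### `L`-classes -/

end Combinatorics

section LClasses

variable {C : Type u} [Category.{v} C]

/-- The left ideal `Mor(C) ∘ s`. -/
def leftGen (s : Mor C) : Set (Mor C) :=
  {y | ∃ (Z : C) (b : s.cod ⟶ Z), y = ⟨s.dom, Z, s.hom ≫ b⟩}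

lemma leftGen_comp_subset {X Y Z : C} (s : X ⟶ Y) (a : Y ⟶ Z) :
    leftGen (⟨X, Z, s ≫ a⟩ : Mor C) ⊆ leftGen ⟨X, Y, s⟩ := by
  rintro _ ⟨W, b, rfl⟩
  exact ⟨W, a ≫ b, by simp⟩

lemma self_mem_leftGen (s : Mor C) : s ∈ leftGen s := ⟨s.cod, 𝟙 _, by simp⟩

/-- If s ∘ t ∘ s = s, then t ∘ s is an idempotent in the L-class of s. -/
lemma exists_idem_leftGen_eq (hC : IsSplitCat C) (s : Mor C) :
    ∃ f : Idem C, leftGen f.toMor = leftGen s := by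
  obtain ⟨X, Y, s⟩ := s
  obtain ⟨t, ht⟩ := hC s
  refine ⟨⟨X, s ≫ t, by rw [Category.assoc, reassoc_of% ht]⟩, ?_⟩
  refine Set.Subset.antisymm (leftGen_comp_subset s t) ?_
  have := leftGen_comp_subset (s ≫ t) s
  rwa [Category.assoc, ht] at this

open Classical in
/-- An idempotent in the `L`-class of `s`, which depends only on this `L`-class. -/
def leftIdem (hC : IsSplitCat C) (s : Mor C) : Idem C :=
  (show ∃ f : Idem C, leftGen f.toMor = leftGen s from exists_idem_leftGen_eq hC s).choose

lemma leftGen_leftIdem (hC : IsSplitCat C) (s : Mor C) :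
    leftGen (leftIdem hC s).toMor = leftGen s :=
  (exists_idem_leftGen_eq hC s).choose_spec

/-- The existence statement from which `leftIdem` chooses involves `s` only through `leftGen s`, so
equal left ideals yield the same choice, not merely equivalent ones. -/
lemma leftIdem_congr (hC : IsSplitCat C) {s t : Mor C} (h : leftGen s = leftGen t) :
    leftIdem hC s = leftIdem hC t := by
  have key : ∀ (S T : Set (Mor C)) (hS : ∃ f : Idem C, leftGen f.toMor = S)
      (hT : ∃ f : Idem C, leftGen f.toMor = T), S = T → hS.choose = hT.choose := by
    rintro S _ hS hT rfl
    rfl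
  exact key _ _ _ _ h

/-- `s = s ∘ f` for the idempotent `f` belonging to the `L`-class of `s`. -/
lemma exists_leftIdem_comp (hC : IsSplitCat C) (s : Mor C) :
    ∃ t : (leftIdem hC s).obj ⟶ s.cod, s = ⟨_, _, t⟩ ∧ (leftIdem hC s).hom ≫ t = t := by
  have h : s ∈ leftGen (leftIdem hC s).toMor := by
    rw [leftGen_leftIdem]
    exact self_mem_leftGen s
  generalize leftIdem hC s = f at h
  obtain ⟨Z, b, rfl⟩ := h
  refine ⟨f.hom ≫ b, rfl, ?_⟩
  exact (Category.assoc _ _ _).symm.trans (congrArg (· ≫ b) f.idem)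

lemma mem_idealGen_of_leftGen_eq {s t : Mor C} (h : leftGen s = leftGen t) :
    s ∈ idealGen {t} := by
  have : s ∈ leftGen t := h ▸ self_mem_leftGen s
  obtain ⟨Z, b, rfl⟩ := this
  exact comp_mem_idealGen t.hom b

/-! ### A linear extension of the `J`-order -/

/-- A linear extension of the `J`-order, as a numbering of the `J`-classes. -/
structure JRank {n : ℕ} (e : Fin n → Idem C) where
  /-- The number of the `J`-class of a morphism. -/
  pos : Mor C → ℕ
  /-- The number of the `J`-class of `e i`. -/
  ord : Equiv.Perm (Fin n)
  pos_lt : ∀ s, pos s < n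
  pos_idem : ∀ i, pos (e i).toMor = ord i
  pos_le : ∀ {s t : Mor C}, t ∈ idealGen {s} → pos t ≤ pos s
  mem_of_pos_eq : ∀ {s t : Mor C}, pos t = pos s → t ∈ idealGen {s}

instance Mor.finite [Finite C] [∀ X Y : C, Finite (X ⟶ Y)] : Finite (Mor C) :=
  Finite.of_injective (β := Σ X : C, Σ Y : C, X ⟶ Y) (fun s => ⟨s.dom, s.cod, s.hom⟩) (by
    rintro ⟨X, Y, s⟩ ⟨X', Y', s'⟩ h
    obtain ⟨rfl, h⟩ := Sigma.mk.inj_iff.1 h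
    obtain ⟨rfl, h⟩ := Sigma.mk.inj_iff.1 (eq_of_heq h)
    exact Mor.ext rfl rfl h)

/-- Each J-class contains exactly one e i. Sorting these by the cardinality of their principal
ideals extends the J-order, since a proper inclusion of finite ideals strictly increases the
cardinality. -/
lemma nonempty_jRank [Finite C] [∀ X Y : C, Finite (X ⟶ Y)] (hC : IsSplitCat C) {n : ℕ}
    {e : Fin n → Idem C} (he : IsIdemReps e) : Nonempty (JRank e) := by
  have hcls : ∀ s : Mor C, ∃ i, s ∈ idealGen {(e i).toMor} ∧ (e i).toMor ∈ idealGen {s} := by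
    intro s
    obtain ⟨f, hf⟩ := exists_idem_leftGen_eq hC s
    obtain ⟨i, hi, -⟩ := he f
    obtain ⟨h1, h2⟩ := hi.mem_idealGen
    exact ⟨i, mem_idealGen_trans (mem_idealGen_of_leftGen_eq hf.symm) h1,
      mem_idealGen_trans h2 (mem_idealGen_of_leftGen_eq hf)⟩
  choose cls h1 h2 using hcls
  have huniq : ∀ i j, (e i).toMor ∈ idealGen {(e j).toMor} →
      (e j).toMor ∈ idealGen {(e i).toMor} → i = j := by
    intro i j h h'
    obtain ⟨l, -, hl⟩ := he (e i)
    rw [hl i (Idem.equivalent_of_mem_idealGen (self_mem_idealGen _) (self_mem_idealGen _)),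
      hl j (Idem.equivalent_of_mem_idealGen h h')]
  let c (i : Fin n) : ℕ := (idealGen {(e i).toMor}).ncard
  let σ := Tuple.sort c
  have hσ : Monotone (c ∘ σ) := Tuple.monotone_sort c
  refine ⟨⟨fun s => (σ.symm (cls s)).1, σ.symm, fun s => (σ.symm (cls s)).2, fun i => ?_, ?_, ?_⟩⟩
  · congr 2
    exact (huniq _ _ (h1 _) (h2 _)).symm
  · intro s t hst
    have hle : (e (cls t)).toMor ∈ idealGen {(e (cls s)).toMor} :=
      mem_idealGen_trans (h2 t) (mem_idealGen_trans hst (h1 s))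
    have hsub := idealGen_subset.2 hle
    rcases (Set.ncard_le_ncard hsub (Set.toFinite _)).lt_or_eq with h | h
    · by_contra hlt
      have h3 := hσ (le_of_lt (Fin.lt_def.2 (not_le.1 hlt)))
      simp only [Function.comp_apply, Equiv.apply_symm_apply] at h3
      exact absurd h (not_lt.2 h3)
    · have heq := Set.eq_of_subset_of_ncard_le hsub h.ge (Set.toFinite _)
      have : cls t = cls s := huniq _ _ hle (idealGen_subset.1 heq.ge)
      rw [this]
  · intro s t hst
    have : cls t = cls s := σ.symm.injective (Fin.ext hst)
    exact mem_idealGen_trans (h1 t) (this ▸ h2 s)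

variable {n : ℕ} {e : Fin n → Idem C}

lemma JRank.eq_of_pos_eq (r : JRank e) {i j : Fin n} (h : r.pos (e i).toMor = r.pos (e j).toMor) : i = j := by
  rw [r.pos_idem, r.pos_idem] at h
  exact r.ord.injective (Fin.ext h)

lemma JRank.jLT_iff (r : JRank e) {i j : Fin n} : JLT (jClass (e i).toMor) (jClass (e j).toMor) ↔
    (e i).toMor ∈ idealGen {(e j).toMor} ∧ i ≠ j := by
  rw [_root_.jLT_iff]
  refine and_congr_right fun h => ?_
  rw [not_iff_comm, not_not]
  constructor
  · intro h'
    rw [h']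
    exact self_mem_idealGen _
  · intro h'
    exact r.eq_of_pos_eq (le_antisymm (r.pos_le h) (r.pos_le h'))

lemma JRank.pos_lt_pos (r : JRank e) {i j : Fin n} (h : JLT (jClass (e i).toMor) (jClass (e j).toMor)) :
    (r.ord i).1 < (r.ord j).1 := by
  rw [r.jLT_iff] at h
  have := r.pos_le h.1
  rw [r.pos_idem, r.pos_idem] at this
  exact this.lt_of_ne fun h' => h.2 (r.ord.injective (Fin.ext h'))

end LClasses

section MorSpan

variable {C : Type u} [Category.{v} C] {k : Type w} [Field k] (α : TwoCocycle C k)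

/-- The subspace of `k_α C` spanned by a set of morphisms. -/
def morSpan (S : Set (Mor C)) : Submodule k (TwistedAlg α) :=
  (Finsupp.supported k k S : Submodule k (Mor C →₀ k))

variable {α}

/-- The coefficient of `x` at a morphism `s`. -/
def TwistedAlg.coeff (x : TwistedAlg α) (s : Mor C) : k := (show Mor C →₀ k from x) s

lemma mem_morSpan_iff {S : Set (Mor C)} {x : TwistedAlg α} :
    x ∈ morSpan α S ↔ ∀ s ∉ S, x.coeff s = 0 :=
  Finsupp.mem_supported' k x

lemma of_mem_morSpan {S : Set (Mor C)} {s : Mor C} : TwistedAlg.of α s ∈ morSpan α S ↔ s ∈ S := by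
  rw [mem_morSpan_iff]
  constructor
  · intro h
    by_contra hs
    have := h s hs
    change (Finsupp.single s (1 : k)) s = 0 at this
    rw [Finsupp.single_eq_same] at this
    exact one_ne_zero this
  · intro hs t ht
    change (Finsupp.single s (1 : k)) t = 0
    exact Finsupp.single_eq_of_ne (by rintro rfl; exact ht hs)

lemma morSpan_eq_span (S : Set (Mor C)) :
    morSpan α S = Submodule.span k (TwistedAlg.of α '' S) :=
  Finsupp.supported_eq_span_single k S

@[elab_as_elim]
lemma morSpan_induction {S : Set (Mor C)} {p : (x : TwistedAlg α) → x ∈ morSpan α S → Prop}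
    {x : TwistedAlg α} (hx : x ∈ morSpan α S) (zero : p 0 (zero_mem _))
    (add : ∀ a b ha hb, p a ha → p b hb → p (a + b) (add_mem ha hb))
    (single : ∀ (c : k) (s) (hs : s ∈ S),
      p (c • TwistedAlg.of α s) (Submodule.smul_mem _ c (of_mem_morSpan.2 hs))) : p x hx := by
  -- `p` is not assumed stable under scalars, so the span induction carries all multiples of x at
  -- once.
  suffices h : ∀ c : k, ∃ h : c • x ∈ morSpan α S, p (c • x) h by
    obtain ⟨h1, h⟩ := h 1
    simpa using h
  have hx' := hx
  rw [morSpan_eq_span] at hx'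
  clear hx
  induction hx' using Submodule.span_induction with
  | mem x hx =>
    obtain ⟨s, hs, rfl⟩ := hx
    exact fun c => ⟨_, single c s hs⟩
  | zero => intro c; simpa using zero
  | add x y _ _ hx hy =>
    intro c
    obtain ⟨h1, h2⟩ := hx c
    obtain ⟨h3, h4⟩ := hy c
    rw [smul_add]
    exact ⟨_, add _ _ _ _ h2 h4⟩
  | smul d x _ h =>
    intro c
    simpa [smul_smul] using h (c * d)

lemma of_mul_of_mem_morSpan {t s : Mor C} {U : Set (Mor C)}
    (h : ∀ (X Y Z : C) (a : X ⟶ Y) (b : Y ⟶ Z), s = ⟨X, Y, a⟩ → t = ⟨Y, Z, b⟩ →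
      (⟨X, Z, a ≫ b⟩ : Mor C) ∈ U) : TwistedAlg.of α t * TwistedAlg.of α s ∈ morSpan α U := by
  obtain ⟨X, Y, s⟩ := s
  obtain ⟨Y', Z, t⟩ := t
  by_cases hY : Y = Y'
  · subst hY
    rw [TwistedAlg.of_mul_of]
    exact Submodule.smul_mem _ _ (of_mem_morSpan.2 (h X Y Z s t rfl rfl))
  · rw [TwistedAlg.of_mul_ne α (by exact hY)]
    exact zero_mem _

lemma mem_morSpan_univ (x : TwistedAlg α) : x ∈ morSpan α Set.univ :=
  mem_morSpan_iff.2 fun _ hs => absurd trivial hs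

lemma mem_morSpan_inter {S T : Set (Mor C)} {x : TwistedAlg α} (hS : x ∈ morSpan α S)
    (hT : x ∈ morSpan α T) : x ∈ morSpan α (S ∩ T) := by
  rw [mem_morSpan_iff] at *
  intro s hs
  by_cases h : s ∈ S
  · exact hT s fun h' => hs ⟨h, h'⟩
  · exact hS s h

lemma idemElt_mem_morSpan (f : Idem C) : idemElt α f ∈ morSpan α {f.toMor} :=
  Submodule.smul_mem _ _ (of_mem_morSpan.2 rfl)

variable [Finite C]

lemma mul_mem_morSpan {S T U : Set (Mor C)}
    (h : ∀ s ∈ S, ∀ t ∈ T, TwistedAlg.of α s * TwistedAlg.of α t ∈ morSpan α U)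
    {x y : TwistedAlg α} (hx : x ∈ morSpan α S) (hy : y ∈ morSpan α T) : x * y ∈ morSpan α U := by
  induction hx using morSpan_induction with
  | zero => rw [zero_mul]; exact zero_mem _
  | add a b _ _ ha hb => rw [add_mul]; exact add_mem ha hb
  | single c s hs =>
    induction hy using morSpan_induction with
    | zero => rw [mul_zero]; exact zero_mem _
    | add a b _ _ ha hb => rw [mul_add]; exact add_mem ha hb
    | single d t ht =>
      rw [smul_mul_assoc, mul_smul_comm]
      exact Submodule.smul_mem _ _ (Submodule.smul_mem _ _ (h s hs t ht))

/-! ### The idempotents `e'` -/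

/-- The cocycle identity for (t, f, f), with t ∘ f = t, forces α(t,f) = α(f,f), the scalar removed
by the normalisation of f'. -/
lemma of_mul_idemElt (f : Idem C) {Z : C} {t : f.obj ⟶ Z} (ht : f.hom ≫ t = t) :
    TwistedAlg.of α ⟨_, _, t⟩ * idemElt α f = TwistedAlg.of α ⟨_, _, t⟩ := by
  have h := α.cocycle f.hom f.hom t
  rw [ht, f.idem] at h
  have h' := mul_left_cancel h
  unfold idemElt Idem.toMor
  rw [mul_smul_comm, TwistedAlg.of_mul_of, smul_smul, h', Units.inv_mul, one_smul, ht]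

lemma idemElt_mul_of (f : Idem C) {Z : C} {t : Z ⟶ f.obj} (ht : t ≫ f.hom = t) :
    idemElt α f * TwistedAlg.of α ⟨_, _, t⟩ = TwistedAlg.of α ⟨_, _, t⟩ := by
  have h := α.cocycle t f.hom f.hom
  rw [ht, f.idem, mul_comm] at h
  have h' := mul_right_cancel h
  unfold idemElt Idem.toMor
  rw [smul_mul_assoc, TwistedAlg.of_mul_of, smul_smul, ← h', Units.inv_mul, one_smul, ht]

lemma mem_morSpan_of_mul_idemElt {f : Idem C} {x : TwistedAlg α} (hx : x * idemElt α f = x) :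
    x ∈ morSpan α {s | ∃ (Z : C) (t : f.obj ⟶ Z), s = ⟨_, _, t⟩ ∧ f.hom ≫ t = t} := by
  rw [← hx]
  refine mul_mem_morSpan ?_ (mem_morSpan_univ x) (idemElt_mem_morSpan f)
  rintro s - _ rfl
  refine of_mul_of_mem_morSpan ?_
  rintro X Y Z a b h -
  cases h
  exact ⟨Z, f.hom ≫ b, rfl, (Category.assoc _ _ _).symm.trans (congrArg (· ≫ b) f.idem)⟩

lemma mem_morSpan_of_idemElt_mul {f : Idem C} {x : TwistedAlg α} (hx : idemElt α f * x = x) :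
    x ∈ morSpan α {s | ∃ (Z : C) (t : Z ⟶ f.obj), s = ⟨_, _, t⟩ ∧ t ≫ f.hom = t} := by
  rw [← hx]
  refine mul_mem_morSpan ?_ (idemElt_mem_morSpan f) (mem_morSpan_univ x)
  rintro _ rfl s -
  refine of_mul_of_mem_morSpan ?_
  rintro X Y Z a b - h
  cases h
  exact ⟨X, a ≫ f.hom, rfl, (Category.assoc _ _ _).trans (congrArg (a ≫ ·) f.idem)⟩

lemma corner_mem_morSpan {f : Idem C} (c : (idemElt_idem α f).Corner) :
    c.1 ∈ morSpan α {s | ∃ g : f.LocalMonoid, s = ⟨_, _, g.1⟩} := by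
  obtain ⟨_, a, rfl⟩ := c
  change idemElt α f * a * idemElt α f ∈ _
  induction a using TwistedAlg.induction with
  | zero => rw [mul_zero, zero_mul]; exact zero_mem _
  | add a b ha hb => rw [mul_add, add_mul]; exact add_mem ha hb
  | single c s =>
    obtain ⟨d, g, h⟩ := idemElt_mul_of_mul α f s
    rw [mul_smul_comm, smul_mul_assoc, h]
    exact Submodule.smul_mem _ _ (Submodule.smul_mem _ _ (of_mem_morSpan.2 ⟨g, rfl⟩))

end MorSpan

/-! ### The chain of ideals -/

section LowIdeal

variable {C : Type u} [Category.{v} C] [Finite C] {k : Type w} [Field k] (α : TwoCocycle C k)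
  {n : ℕ} {e : Fin n → Idem C} (r : JRank e)

/-- The ideal of `k_α C` spanned by the first `m` classes of morphisms. -/
def lowIdeal (m : ℕ) : Ideal (TwistedAlg α) where
  carrier := morSpan α {s | r.pos s < m}
  zero_mem' := zero_mem (morSpan α {s | r.pos s < m})
  add_mem' ha hb := add_mem (S := Submodule k (TwistedAlg α)) ha hb
  smul_mem' a x hx := by
    refine mul_mem_morSpan ?_ (mem_morSpan_univ a) hx
    intro t _ s hs
    refine of_mul_of_mem_morSpan ?_
    rintro X Y Z a b rfl rfl
    exact (r.pos_le (comp_mem_idealGen a b)).trans_lt hs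

variable {α}

lemma mem_lowIdeal {m : ℕ} {x : TwistedAlg α} :
    x ∈ lowIdeal α r m ↔ x ∈ morSpan α {s | r.pos s < m} := Iff.rfl

lemma of_mem_lowIdeal {m : ℕ} {s : Mor C} : TwistedAlg.of α s ∈ lowIdeal α r m ↔ r.pos s < m :=
  of_mem_morSpan

instance (m : ℕ) : (lowIdeal α r m).IsTwoSided :=
  ⟨fun {x} a hx => by
    refine mul_mem_morSpan ?_ hx (mem_morSpan_univ a)
    intro t ht s _
    refine of_mul_of_mem_morSpan ?_
    rintro X Y Z a b rfl rfl
    exact (r.pos_le (comp_mem_idealGen' a b)).trans_lt ht⟩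

lemma lowIdeal_mono {m m' : ℕ} (h : m ≤ m') : lowIdeal α r m ≤ lowIdeal α r m' := by
  intro x hx
  rw [mem_lowIdeal, mem_morSpan_iff] at *
  exact fun s hs => hx s fun h' => hs (lt_of_lt_of_le h' h)

lemma lowIdeal_zero : lowIdeal α r 0 = ⊥ := by
  rw [eq_bot_iff]
  intro x hx
  rw [mem_lowIdeal, mem_morSpan_iff] at hx
  exact Finsupp.ext fun s => hx s (Nat.not_lt_zero _)

lemma lowIdeal_top : lowIdeal α r n = ⊤ := by
  rw [eq_top_iff]
  intro x _
  rw [mem_lowIdeal, mem_morSpan_iff]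
  exact fun s hs => absurd (r.pos_lt s) hs

lemma smul_mem_lowIdeal {m : ℕ} (c : k) {x : TwistedAlg α} (hx : x ∈ lowIdeal α r m) :
    c • x ∈ lowIdeal α r m :=
  Submodule.smul_mem (morSpan α _) c hx

lemma idemElt_mem_lowIdeal {m : ℕ} {f : Idem C} :
    idemElt α f ∈ lowIdeal α r m ↔ r.pos f.toMor < m := by
  rw [← of_mem_lowIdeal (α := α)]
  constructor
  · intro h
    have := smul_mem_lowIdeal r ((α.val f.hom f.hom : kˣ) : k) h
    rwa [idemElt, smul_smul, Units.mul_inv, one_smul] at this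
  · exact smul_mem_lowIdeal r _

/-- The ideal spanned by the first `m + 1` classes is generated by the ideal spanned by the first
`m` classes and by `e i`, where the class of `e i` has number `m`. -/
lemma lowIdeal_succ_le {i : Fin n} {K : Ideal (TwistedAlg α)} [K.IsTwoSided]
    (hK : lowIdeal α r (r.ord i) ≤ K) (hi : idemElt α (e i) ∈ K) :
    lowIdeal α r (r.ord i + 1) ≤ K := by
  intro x hx
  have hsmul : ∀ (c : k), ∀ y ∈ K, c • y ∈ K := fun c y hy => by
    rw [← one_mul y, ← smul_mul_assoc]
    exact K.mul_mem_left _ hy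
  rw [mem_lowIdeal] at hx
  induction hx using morSpan_induction with
  | zero => exact zero_mem _
  | add a b _ _ ha hb => exact add_mem ha hb
  | single c s hs =>
    refine hsmul c _ ?_
    rcases Nat.lt_succ_iff_lt_or_eq.1 hs with h | h
    · exact hK ((of_mem_lowIdeal r).2 h)
    · rw [← r.pos_idem] at h
      obtain ⟨X, Y, s⟩ := s
      obtain ⟨a, b, h⟩ := mem_idealGen_singleton.1 (r.mem_of_pos_eq h)
      change X ⟶ (e i).obj at a
      change (e i).obj ⟶ Y at b
      have h1 : TwistedAlg.of α (e i).toMor ∈ K := by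
        have := hsmul ((α.val (e i).hom (e i).hom : kˣ) : k) _ hi
        rwa [idemElt, smul_smul, Units.mul_inv, one_smul] at this
      have h2 := K.mul_mem_left (TwistedAlg.of α ⟨_, _, b⟩)
        (K.mul_mem_right (TwistedAlg.of α ⟨_, _, a⟩) h1)
      have h3 := TwistedAlg.of_mul_of α (e i).hom a
      have h4 := TwistedAlg.of_mul_of α b (a ≫ (e i).hom)
      change TwistedAlg.of α ⟨_, _, b⟩ * (TwistedAlg.of α ⟨_, _, (e i).hom⟩ *
        TwistedAlg.of α ⟨_, _, a⟩) ∈ K at h2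
      rw [h3, mul_smul_comm, h4, smul_smul] at h2
      change s = a ≫ (e i).hom ≫ b at h
      rw [h, ← Category.assoc]
      have h5 := hsmul (α.val (e i).hom a * α.val b (a ≫ (e i).hom) : kˣ)⁻¹.1 _ h2
      rwa [smul_smul, ← Units.val_mul, ← Units.val_mul, inv_mul_cancel, Units.val_one,
        one_smul] at h5

/-- If t = t ∘ f and t ∘ u ∘ t = t, then t = t ∘ (f ∘ u ∘ t), where f ∘ u ∘ t is no higher than t in
the J-order and belongs to the local monoid at f. This is the condition on I in
`Induced.smul_eq_zero_of_killed`. -/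
lemma mem_span_corner_of_mem_lowIdeal (hC : IsSplitCat C) {m : ℕ} {f : Idem C} {x : TwistedAlg α}
    (hx : x ∈ lowIdeal α r m) (hxf : x * idemElt α f = x) :
    x ∈ Ideal.span {y | y ∈ lowIdeal α r m ∧ idemElt α f * y * idemElt α f = y} := by
  have h := mem_morSpan_inter hx (mem_morSpan_of_mul_idemElt hxf)
  clear hx hxf
  induction h using morSpan_induction with
  | zero => exact zero_mem _
  | add a b _ _ ha hb => exact add_mem ha hb
  | single c s hs =>
    obtain ⟨hs, Z, t, rfl, ht⟩ := hs
    obtain ⟨u, hu⟩ := hC t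
    have h1 : f.hom ≫ t ≫ u ≫ f.hom = t ≫ u ≫ f.hom := by rw [reassoc_of% ht]
    have h2 : (t ≫ u ≫ f.hom) ≫ f.hom = t ≫ u ≫ f.hom := by simp only [Category.assoc, f.idem]
    have h3 : (t ≫ u ≫ f.hom) ≫ t = t := by simp only [Category.assoc, ht, hu]
    have h4 := TwistedAlg.of_mul_of α t (t ≫ u ≫ f.hom)
    rw [h3] at h4
    have h5 : TwistedAlg.of α ⟨f.obj, Z, t⟩ = (((α.val t (t ≫ u ≫ f.hom))⁻¹ : kˣ).1 •
        TwistedAlg.of α ⟨f.obj, Z, t⟩) * TwistedAlg.of α ⟨f.obj, f.obj, t ≫ u ≫ f.hom⟩ := by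
      rw [smul_mul_assoc, h4, smul_smul, Units.inv_mul, one_smul]
    rw [h5, ← smul_mul_assoc]
    refine Ideal.mul_mem_left _ _ (Ideal.subset_span ⟨?_, ?_⟩)
    · rw [of_mem_lowIdeal]
      exact (r.pos_le (comp_mem_idealGen _ _)).trans_lt hs
    · rw [idemElt_mul_of f h2, of_mul_idemElt f h1]

/-! ### Lifting maps defined on the ideals of the chain -/

section Lift

variable {M X : Type*} [AddCommGroup M] [Module (TwistedAlg α) M]
  [AddCommGroup X] [Module (TwistedAlg α) X]

/-- The additive map `k_α C → M` with `s ↦ s • b f`, where `f` is the idempotent belonging to the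
`L`-class of `s`. -/
def leftIdemHom (hC : IsSplitCat C) (b : Idem C → M) : TwistedAlg α →+ M :=
  Finsupp.liftAddHom (M := k) (N := M) (fun s : Mor C =>
    { toFun := fun c => (c • TwistedAlg.of α s) • b (leftIdem hC s)
      map_zero' := by rw [zero_smul, zero_smul]
      map_add' := fun c d => by rw [add_smul, add_smul] })

lemma leftIdemHom_smul_of (hC : IsSplitCat C) (b : Idem C → M) (c : k) (s : Mor C) :
    leftIdemHom hC b (c • TwistedAlg.of α s) = (c • TwistedAlg.of α s) • b (leftIdem hC s) := by
  have : (c • TwistedAlg.of α s) = (Finsupp.single s c : Mor C →₀ k) :=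
    (Finsupp.smul_single c s 1).trans (by rw [smul_eq_mul, mul_one])
  conv_lhs => rw [this]
  exact Finsupp.liftAddHom_apply_single _ _ _

variable [∀ X Y : C, Finite (X ⟶ Y)]

/-- For s in J_(m+1), the composite t ∘ s either lies in J_m, which kills M, or stays in the J-class
of s. In the second case stability puts it in the L-class of s, and both have the same idempotent.
-/
lemma leftIdemHom_mul (hC : IsSplitCat C) (b : Idem C → M) {m : ℕ} (hM : ∀ x ∈ lowIdeal α r m, ∀ z : M, x • z = 0)
    (a : TwistedAlg α) {x : TwistedAlg α} (hx : x ∈ lowIdeal α r (m + 1)) :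
    leftIdemHom hC b (a * x) = a • leftIdemHom hC b x := by
  rw [mem_lowIdeal] at hx
  induction hx using morSpan_induction with
  | zero => rw [mul_zero, map_zero, smul_zero]
  | add x y _ _ hx hy => rw [mul_add, map_add, map_add, smul_add, hx, hy]
  | single d s hs =>
    induction a using TwistedAlg.induction with
    | zero => rw [zero_mul, map_zero, zero_smul]
    | add a a' h h' => rw [add_mul, map_add, add_smul, h, h']
    | single c t =>
      rw [leftIdemHom_smul_of, ← mul_smul, smul_mul_smul_comm]
      obtain ⟨X, Y, s⟩ := s
      obtain ⟨Y', Z, t⟩ := t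
      by_cases hY : Y = Y'
      · subst hY
        rw [TwistedAlg.of_mul_of, smul_smul, leftIdemHom_smul_of]
        by_cases hlt : r.pos (⟨X, Z, s ≫ t⟩ : Mor C) < m
        · have := smul_mem_lowIdeal r (c * d * (α.val t s : kˣ).1)
            ((of_mem_lowIdeal (α := α) r).2 hlt)
          rw [hM _ this, hM _ this]
        · have h1 := r.pos_le (comp_mem_idealGen s t)
          have h2 : r.pos (⟨X, Y, s⟩ : Mor C) = r.pos (⟨X, Z, s ≫ t⟩ : Mor C) := by
            change r.pos (⟨X, Y, s⟩ : Mor C) < m + 1 at hs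
            omega
          obtain ⟨b, hb⟩ := exists_comp_eq_of_mem_idealGen s t (r.mem_of_pos_eq h2)
          have h3 : leftGen (⟨X, Z, s ≫ t⟩ : Mor C) = leftGen ⟨X, Y, s⟩ := by
            refine Set.Subset.antisymm (leftGen_comp_subset s t) ?_
            have := leftGen_comp_subset (s ≫ t) b
            rwa [hb] at this
          rw [leftIdem_congr hC h3]
      · rw [TwistedAlg.of_mul_ne α (by exact hY), smul_zero, map_zero, zero_smul]

/-- The layers of the chain `lowIdeal` are relatively projective. -/
lemma exists_lift_lowIdeal (hC : IsSplitCat C) {m : ℕ} (hM : ∀ x ∈ lowIdeal α r m, ∀ z : M, x • z = 0)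
    (g : M →ₗ[TwistedAlg α] X) (hg : Function.Surjective g)
    (f : lowIdeal α r (m + 1) →ₗ[TwistedAlg α] X) :
    ∃ h : lowIdeal α r (m + 1) →ₗ[TwistedAlg α] M,
      (∀ a, g (h a) = f a) ∧ ∀ a, a.1 ∈ lowIdeal α r m → h a = 0 := by
  classical
  -- Since s = s · i' for the idempotent i of its L-class, preimages of the values of `f` at the
  -- elements i' dictate a lift. The default 0 concerns idempotents outside J_(m+1), which do not
  -- arise from any s in J_(m+1).
  let b (i : Idem C) : M := Function.surjInv hg
    (if h : idemElt α i ∈ lowIdeal α r (m + 1) then f ⟨idemElt α i, h⟩ else 0)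
  refine ⟨{ toFun := fun a => leftIdemHom hC b a.1
            map_add' := fun a a' => map_add (leftIdemHom hC b) a.1 a'.1
            map_smul' := fun c a => leftIdemHom_mul r hC b hM c a.2 }, ?_, ?_⟩
  swap
  · rintro ⟨a, ha'⟩ ha
    change leftIdemHom hC b a = 0
    change a ∈ morSpan α {s | r.pos s < m} at ha
    clear ha'
    induction ha using morSpan_induction with
    | zero => exact map_zero _
    | add a a' _ _ h h' => rw [map_add, h, h', add_zero]
    | single c s hs =>
      rw [leftIdemHom_smul_of]
      exact hM _ (smul_mem_lowIdeal r c ((of_mem_lowIdeal r).2 hs)) _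
  rintro ⟨a, ha⟩
  change g (leftIdemHom hC b a) = _
  have key : ∀ (a : TwistedAlg α) (ha : a ∈ morSpan α {s | r.pos s < m + 1}),
      ∃ h : a ∈ lowIdeal α r (m + 1), g (leftIdemHom hC b a) = f ⟨a, h⟩ := by
    intro a ha
    induction ha using morSpan_induction with
    | zero => exact ⟨zero_mem _, by rw [map_zero, map_zero]; exact (map_zero f).symm⟩
    | add a a' _ _ h h' =>
      obtain ⟨h1, h2⟩ := h
      obtain ⟨h1', h2'⟩ := h'
      exact ⟨add_mem h1 h1', by
        rw [map_add, map_add, h2, h2']; exact (map_add f ⟨a, h1⟩ ⟨a', h1'⟩).symm⟩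
    | single c s hs =>
      refine ⟨smul_mem_lowIdeal r c ((of_mem_lowIdeal r).2 hs), ?_⟩
      obtain ⟨t, hst, ht⟩ := exists_leftIdem_comp hC s
      have h1 : idemElt α (leftIdem hC s) ∈ lowIdeal α r (m + 1) := by
        rw [idemElt_mem_lowIdeal]
        exact (r.pos_le (mem_idealGen_of_leftGen_eq (leftGen_leftIdem hC s))).trans_lt hs
      rw [leftIdemHom_smul_of, map_smul]
      have h2 : g (b (leftIdem hC s)) = f ⟨_, h1⟩ := by
        simp only [b]
        rw [Function.surjInv_eq hg, dif_pos h1]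
      rw [h2, ← map_smul]
      congr 1
      refine Subtype.ext ?_
      change (c • TwistedAlg.of α s) * idemElt α (leftIdem hC s) = c • TwistedAlg.of α s
      have h3 := of_mul_idemElt (α := α) _ ht
      rw [← hst] at h3
      rw [smul_mul_assoc, h3]
  exact (key a ha).2

end Lift

end LowIdeal

/-! ### The surjection `e'Ae' → k_α Γ_e` -/

section InflHom

variable {C : Type u} [Category.{v} C] [Finite C] [∀ X Y : C, Finite (X ⟶ Y)] {k : Type w} [Field k]
  {α : TwoCocycle C k}

lemma inflHom_surjective (f : Idem C) : Function.Surjective (inflHom α f) := by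
  intro b
  induction b using TwistedAlg.induction with
  | zero => exact ⟨0, map_zero _⟩
  | add b b' h h' =>
    obtain ⟨c, rfl⟩ := h
    obtain ⟨c', rfl⟩ := h'
    exact ⟨c + c', map_add _ _ _⟩
  | single c g =>
    have h1 : idemElt α f * (c • TwistedAlg.of α (gamIncl f g)) * idemElt α f =
        c • TwistedAlg.of α (gamIncl f g) := by
      have h2 := idemElt_mul_of (α := α) f (f.comp_hom (show f.Gam from g.hom).1)
      have h3 := of_mul_idemElt (α := α) f (f.hom_comp (show f.Gam from g.hom).1)
      rw [mul_smul_comm, smul_mul_assoc]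
      unfold gamIncl
      rw [h2, h3]
    refine ⟨⟨c • TwistedAlg.of α (gamIncl f g), _, h1⟩, ?_⟩
    change gamProj α f (c • TwistedAlg.of α (gamIncl f g)) = _
    rw [map_smul, gamProj_of_mem]

/-- Units of the local monoid lie in the J-class of e i, non-units in strictly lower ones. Hence
kJ_e is the intersection of the corner with an ideal of the chain, whichever linear extension is
used. -/
lemma inflHom_eq_zero_iff {n : ℕ} {e : Fin n → Idem C} (r : JRank e) {i : Fin n}
    (c : (idemElt_idem α (e i)).Corner) :
    inflHom α (e i) c = 0 ↔ c.1 ∈ lowIdeal α r (r.ord i) := by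
  rw [mem_lowIdeal, mem_morSpan_iff]
  constructor
  · intro h s hs
    by_cases hs' : ∃ g : (e i).LocalMonoid, s = ⟨_, _, g.1⟩
    · obtain ⟨g, rfl⟩ := hs'
      have h1 : (⟨_, _, g.1⟩ : Mor C) ∈ idealGen {(e i).toMor} := by
        have := comp_mem_idealGen (e i).hom g.1
        rwa [(e i).hom_comp] at this
      have h2 := r.pos_le h1
      rw [r.pos_idem] at h2
      have h3 : r.pos (e i).toMor = r.pos ⟨_, _, g.1⟩ := by
        rw [r.pos_idem]
        change ¬ r.pos _ < (r.ord i).1 at hs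
        omega
      have h4 := (e i).isUnit_of_mem_idealGen g (r.mem_of_pos_eq h3)
      obtain ⟨g', hg'⟩ := (localMonoid_mem_range (e i) g).2 h4
      rw [← hg']
      exact congrArg (fun y : TwistedGroupAlg α (e i) => y.coeff g') h
    · exact (mem_morSpan_iff.1 (corner_mem_morSpan c)) s hs'
  · intro h
    refine Finsupp.ext fun g => ?_
    refine h (gamIncl (e i) g) ?_
    change ¬ r.pos _ < (r.ord i).1
    rw [not_lt, ← r.pos_idem]
    refine r.pos_le ?_
    let g' : (e i).Gam := show (e i).Gam from g.hom
    have h1 := comp_mem_idealGen g'.1.1 (g'⁻¹).1.1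
    have h2 : g'.1.1 ≫ (g'⁻¹).1.1 = (e i).hom := congrArg Subtype.val g'.inv_mul
    rwa [h2] at h1

end InflHom

/-! ### Simple modules of twisted category algebras -/

section Inflation

variable {C : Type u} [Category.{v} C] [Finite C] [∀ X Y : C, Finite (X ⟶ Y)] {k : Type w} [Field k]
  (α : TwoCocycle C k) (f : Idem C)

lemma Inflation.smul_eq (W : Type x) [AddCommGroup W] [Module (TwistedGroupAlg α f) W]
    (c : (idemElt_idem α f).Corner) (z : Inflation α f W) :
    c • z = (show Inflation α f W from inflHom α f c • (show W from z)) := rfl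

lemma Inflation.isSimpleModule (W : Type x) [AddCommGroup W] [Module (TwistedGroupAlg α f) W]
    [IsSimpleModule (TwistedGroupAlg α f) W] :
    IsSimpleModule (idemElt_idem α f).Corner (Inflation α f W) := by
  have : RingHomSurjective (inflHom α f) := ⟨inflHom_surjective f⟩
  exact (LinearMap.isSimpleModule_iff_of_bijective
    ({ toFun := fun z => z, map_add' := fun _ _ => rfl, map_smul' := fun _ _ => rfl } :
      Inflation α f W →ₛₗ[inflHom α f] W) Function.bijective_id).2 inferInstance

lemma Inflation.nonempty_equiv {W W' : Type*} [AddCommGroup W] [Module (TwistedGroupAlg α f) W]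
    [AddCommGroup W'] [Module (TwistedGroupAlg α f) W']
    (g : Inflation α f W ≃ₗ[(idemElt_idem α f).Corner] Inflation α f W') :
    Nonempty (W ≃ₗ[TwistedGroupAlg α f] W') :=
  ⟨{ toFun := fun z => g z
     invFun := fun z => g.symm z
     left_inv := fun z => g.symm_apply_apply z
     right_inv := fun z => g.apply_symm_apply z
     map_add' := fun z z' => map_add g z z'
     map_smul' := fun a z => by
      obtain ⟨c, rfl⟩ := inflHom_surjective f a
      exact map_smul g c (show Inflation α f W from z) }⟩

lemma IsSimpleReps.exists_equiv_inflation {L : Type*} {W : L → Type*} [∀ i, AddCommGroup (W i)]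
    [∀ i, Module (TwistedGroupAlg α f) (W i)] (hW : IsSimpleReps (TwistedGroupAlg α f) W)
    (N : Type*) [AddCommGroup N] [Module (idemElt_idem α f).Corner N]
    (hN : ∀ c, inflHom α f c = 0 → ∀ z : N, c • z = 0)
    (hs : IsSimpleModule (idemElt_idem α f).Corner N) :
    ∃ i, Nonempty (N ≃ₗ[(idemElt_idem α f).Corner] Inflation α f (W i)) := by
  obtain ⟨_, h⟩ := exists_module_of_surjective (inflHom α f) N (inflHom_surjective f) hN
  have : RingHomSurjective (inflHom α f) := ⟨inflHom_surjective f⟩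
  have hs' : IsSimpleModule (TwistedGroupAlg α f) N :=
    (LinearMap.isSimpleModule_iff_of_bijective
      ({ toFun := id, map_add' := fun _ _ => rfl, map_smul' := fun s n => (h s n).symm } :
        N →ₛₗ[inflHom α f] N) Function.bijective_id).1 hs
  obtain ⟨i, ⟨g⟩⟩ := hW.exists_equiv N hs'
  refine ⟨i, ⟨{
    toFun := fun z => g z
    invFun := fun z => g.symm z
    left_inv := fun z => g.symm_apply_apply z
    right_inv := fun z => g.apply_symm_apply z
    map_add' := fun z z' => map_add g z z'
    map_smul' := fun c z => by
      rw [← h, map_smul]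
      rfl }⟩⟩

end Inflation

/-! ### The first ideal of the chain acting nontrivially on a module -/

section Rank

variable {C : Type u} [Category.{v} C] {n : ℕ} {e : Fin n → Idem C} (r : JRank e)

/-- If `s ∘ e i` is not in a lower class for some `s`, then `e i` is below any `t` with
`s ∘ e i ∈ Mor(C) ∘ t ∘ Mor(C)`. -/
lemma JRank.mem_idealGen_of_le {i : Fin n} {s t : Mor C} (h : s ∈ idealGen {(e i).toMor})
    (h' : r.ord i ≤ r.pos s) (ht : s ∈ idealGen {t}) : (e i).toMor ∈ idealGen {t} := by
  have h1 := r.pos_le h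
  rw [← r.pos_idem] at h'
  exact mem_idealGen_trans (r.mem_of_pos_eq (le_antisymm h' h1)) ht

variable [Finite C] {k : Type w} [Field k] {α : TwoCocycle C k}

lemma exists_mor_of_notMem_lowIdeal {m : ℕ} {S : Set (Mor C)} {a : TwistedAlg α}
    (ha : a ∈ morSpan α S) (ha' : a ∉ lowIdeal α r m) : ∃ s ∈ S, m ≤ r.pos s := by
  by_contra! h
  apply ha'
  rw [mem_lowIdeal, mem_morSpan_iff] at *
  exact fun s hs => ha s fun h' => hs (h s h')

/-- A nonzero module is killed by `lowIdeal α r (r.ord i)` but not by `e i` for some `i`. -/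
lemma exists_idemElt_smul_ne_zero (S : Type*) [AddCommGroup S] [Module (TwistedAlg α) S]
    [Nontrivial S] : ∃ i, (∀ a ∈ lowIdeal α r (r.ord i), ∀ z : S, a • z = 0) ∧
      ∃ z : S, idemElt α (e i) • z ≠ 0 := by
  classical
  have hex : ∃ m, ∃ a ∈ lowIdeal α r m, ∃ z : S, a • z ≠ 0 := by
    obtain ⟨z, hz⟩ := exists_ne (0 : S)
    exact ⟨n, 1, by rw [lowIdeal_top]; trivial, z, by rwa [one_smul]⟩
  -- J_0 = 0 kills S and J_n = A does not, so the first ideal acting nontrivially is some J_(m+1).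
  obtain ⟨m, hm⟩ : ∃ m, Nat.find hex = m + 1 := by
    refine Nat.exists_eq_succ_of_ne_zero fun h => ?_
    obtain ⟨a, ha, z, hz⟩ := Nat.find_spec hex
    rw [h, lowIdeal_zero] at ha
    exact hz (by rw [show a = 0 from ha, zero_smul])
  have hlow : ∀ a ∈ lowIdeal α r m, ∀ z : S, a • z = 0 := by
    have := Nat.find_min hex (m := m) (by omega)
    push Not at this
    exact this
  obtain ⟨a, ha, z, hz⟩ := Nat.find_spec hex
  rw [hm] at ha
  have hmn : m < n := by
    by_contra h
    refine hz (hlow a (lowIdeal_mono r (not_lt.1 h) ?_) z)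
    rw [lowIdeal_top]
    trivial
  obtain ⟨i, hi⟩ := r.ord.surjective ⟨m, hmn⟩
  have hi' : (r.ord i).1 = m := congrArg Fin.val hi
  refine ⟨i, by rwa [hi'], ?_⟩
  by_contra! h
  have := lowIdeal_succ_le r (i := i) (K := Module.annihilator (TwistedAlg α) S)
    (fun x hx => Module.mem_annihilator.2 (hlow x (by rwa [← hi'])))
    (Module.mem_annihilator.2 h)
  exact hz (Module.mem_annihilator.1 (this (by rwa [hi'])) z)

end Rank

lemma exists_smul_ne_zero_of_subquotient {A M D : Type*} [Ring A] [AddCommGroup M] [Module A M]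
    [AddCommGroup D] [Module A D] {N₁ N₂ : Submodule A M} (g : (N₂ ⧸ N₁.submoduleOf N₂) ≃ₗ[A] D)
    {a : A} (h : ∃ z : D, a • z ≠ 0) : ∃ y ∈ N₂, a • y ≠ 0 := by
  obtain ⟨z, hz⟩ := h
  obtain ⟨z, rfl⟩ := g.surjective z
  obtain ⟨z, rfl⟩ := Submodule.mkQ_surjective _ z
  refine ⟨z.1, z.2, fun h => hz ?_⟩
  have : a • z = 0 := Subtype.ext h
  rw [← map_smul, ← map_smul, this, map_zero, map_zero]

/-! ### Classification of the simple modules and composition factors of Rad Δ -/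

section Simple

variable {C : Type u} [Category.{v} C] [Finite C] [∀ X Y : C, Finite (X ⟶ Y)] {k : Type w} [Field k]
  {α : TwoCocycle C k} {n : ℕ} {e : Fin n → Idem C} (r : JRank e)

/-- The ideal meets the corner in kJ_e, which acts as zero on the inflation; splitness carries this
to all of Δ. -/
lemma lowIdeal_smul_delta (hC : IsSplitCat C) (i : Fin n) (W : Type x) [AddCommGroup W]
    [Module (TwistedGroupAlg α (e i)) W] {a : TwistedAlg α} (ha : a ∈ lowIdeal α r (r.ord i))
    (z : Delta α (e i) W) : a • z = 0 := by
  refine Induced.smul_eq_zero_of_killed (idemElt_idem α (e i)) (lowIdeal α r (r.ord i))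
    (fun x hx hx' => mem_span_corner_of_mem_lowIdeal r hC hx hx') ?_ a ha z
  intro c hc w
  rw [Inflation.smul_eq, (inflHom_eq_zero_iff r c).2 hc]
  exact zero_smul (TwistedGroupAlg α (e i)) (show W from w)

lemma cornerPart_killed {i : Fin n} {S : Type*} [AddCommGroup S] [Module (TwistedAlg α) S]
    (hS : ∀ a ∈ lowIdeal α r (r.ord i), ∀ z : S, a • z = 0) (c : (idemElt_idem α (e i)).Corner)
    (hc : inflHom α (e i) c = 0) (z : CornerPart (idemElt_idem α (e i)) S) : c • z = 0 :=
  Subtype.ext (hS _ ((inflHom_eq_zero_iff r c).1 hc) z.1)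

variable {l : Fin n → ℕ} {T : ∀ i, Fin (l i) → Type x}
  [∀ i r, AddCommGroup (T i r)] [∀ i r, Module (TwistedGroupAlg α (e i)) (T i r)]

lemma lowIdeal_smul_head (hC : IsSplitCat C) (i : Fin n) (W : Type x) [AddCommGroup W]
    [Module (TwistedGroupAlg α (e i)) W] {a : TwistedAlg α} (ha : a ∈ lowIdeal α r (r.ord i))
    (z : Head (TwistedAlg α) (Delta α (e i) W)) : a • z = 0 := by
  obtain ⟨z, rfl⟩ := Submodule.mkQ_surjective _ z
  rw [← map_smul, lowIdeal_smul_delta r hC i W ha, map_zero]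

/-- D_is is killed by the ideal of number ord i but not by e_i', which recovers i; then e_i'D_is,
the inflation of T_is, recovers s. For a simple S the same data are read off at the first layer not
killing it, and e_i'S determines S. -/
lemma delta_isSimpleReps (r : JRank e) (hC : IsSplitCat C)
    (hT : ∀ i, IsSimpleReps (TwistedGroupAlg α (e i)) (T i)) :
    IsSimpleReps (TwistedAlg α)
      (fun p : Weight e l => Head (TwistedAlg α) (Delta α (e p.1) (T p.1 p.2))) := by
  have hs : ∀ i j, IsSimpleModule (idemElt_idem α (e i)).Corner (Inflation α (e i) (T i j)) := by
    intro i j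
    have := (hT i).simple j
    exact Inflation.isSimpleModule α (e i) (T i j)
  refine ⟨fun p => inferInstance, ?_, ?_⟩
  · have hle : ∀ p q : Weight e l, Nonempty (Head (TwistedAlg α) (Delta α (e p.1) (T p.1 p.2))
        ≃ₗ[TwistedAlg α] Head (TwistedAlg α) (Delta α (e q.1) (T q.1 q.2))) →
        (r.ord q.1).1 ≤ r.ord p.1 := by
      rintro p q ⟨g⟩
      by_contra hlt
      obtain ⟨z, hz⟩ := Induced.exists_head_smul_ne_zero (idemElt_idem α (e p.1))
        (N := Inflation α (e p.1) (T p.1 p.2))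
      apply hz
      apply g.injective
      rw [map_smul, map_zero]
      refine lowIdeal_smul_head r hC _ _ ?_ _
      rw [idemElt_mem_lowIdeal, r.pos_idem]
      omega
    rintro ⟨i, s⟩ ⟨j, t⟩ hg
    have hij : i = j := r.ord.injective (Fin.ext (le_antisymm (hle _ _ ⟨hg.some.symm⟩) (hle _ _ hg)))
    subst hij
    obtain ⟨g⟩ := hg
    have he := idemElt_idem α (e i)
    obtain ⟨h⟩ := Inflation.nonempty_equiv α (e i) (((Induced.headCornerEquiv he
      (N := Inflation α (e i) (T i s))).trans (CornerPart.congr he g)).trans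
        (Induced.headCornerEquiv he (N := Inflation α (e i) (T i t))).symm)
    rw [(hT i).pairwise s t ⟨h⟩]
  · intro S _ _ hS
    have := IsSimpleModule.nontrivial (TwistedAlg α) S
    obtain ⟨i, hi, z, hz⟩ := exists_idemElt_smul_ne_zero (α := α) r S
    have he := idemElt_idem α (e i)
    obtain ⟨s, ⟨g⟩⟩ := (hT i).exists_equiv_inflation α (e i) (CornerPart he S)
      (cornerPart_killed r hi) (CornerPart.isSimpleModule he hz)
    exact ⟨⟨i, s⟩, Induced.nonempty_equiv_head he g.symm⟩

/-- A factor D_q of Rad Δ_p gives e_q' Rad Δ_p ≠ 0. Hence e_q'Ae_p' is not contained in the ideal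
killing Δ_p, and some morphism in the J-class of e_p has the form e_q ∘ t'; so e_p is below e_q. The
classes differ, because e_p' kills Rad Δ_p. -/
lemma delta_factorsAmong (r : JRank e) (hC : IsSplitCat C)
    (hT : ∀ i, IsSimpleReps (TwistedGroupAlg α (e i)) (T i)) (p : Weight e l) :
    FactorsAmong (TwistedAlg α)
      (fun p : Weight e l => Head (TwistedAlg α) (Delta α (e p.1) (T p.1 p.2))) {q | q < p}
      (Module.jacobson (TwistedAlg α) (Delta α (e p.1) (T p.1 p.2))) := by
  have hs : ∀ i j, IsSimpleModule (idemElt_idem α (e i)).Corner (Inflation α (e i) (T i j)) := by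
    intro i j
    have := (hT i).simple j
    exact Inflation.isSimpleModule α (e i) (T i j)
  intro N₁ N₂ hN
  obtain ⟨q, ⟨g⟩⟩ := (delta_isSimpleReps r hC hT).exists_equiv _
    ((covBy_iff_quot_is_simple hN.le).1 hN)
  refine ⟨q, ?_, ⟨g⟩⟩
  obtain ⟨⟨z, hzj⟩, -, hz⟩ := exists_smul_ne_zero_of_subquotient g
    (Induced.exists_head_smul_ne_zero (idemElt_idem α (e q.1))
      (N := Inflation α (e q.1) (T q.1 q.2)))
  have hz' : idemElt α (e q.1) • z ≠ 0 := fun h => hz (Subtype.ext h)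
  refine r.jLT_iff.2 ⟨?_, ?_⟩
  · have hex : ∃ a : TwistedAlg α, idemElt α (e q.1) * a * idemElt α (e p.1) ∉
        lowIdeal α r (r.ord p.1) := by
      by_contra! h
      apply hz'
      clear hz hz' hzj
      induction z using Induced.induction with
      | add y y' h h' => rw [smul_add, h, h', add_zero]
      | smul a t =>
        rw [← Induced.smul_unit, smul_smul, smul_smul]
        exact lowIdeal_smul_delta r hC _ _ (h a) _
    obtain ⟨a, ha⟩ := hex
    have h1 := mem_morSpan_inter
      (mem_morSpan_of_mul_idemElt (α := α) (f := e p.1)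
        (x := idemElt α (e q.1) * a * idemElt α (e p.1))
        (by rw [mul_assoc, (idemElt_idem α (e p.1)).eq]))
      (mem_morSpan_of_idemElt_mul (α := α) (f := e q.1)
        (x := idemElt α (e q.1) * a * idemElt α (e p.1))
        (by simp only [← mul_assoc, (idemElt_idem α (e q.1)).eq]))
    obtain ⟨s, ⟨⟨Z, t, rfl, ht⟩, ⟨Z', t', hs', ht'⟩⟩, hle⟩ := exists_mor_of_notMem_lowIdeal r h1 ha
    refine r.mem_idealGen_of_le (s := ⟨_, Z, t⟩) ?_ hle ?_
    · have := comp_mem_idealGen (e p.1).hom t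
      rwa [ht] at this
    · rw [hs']
      have := comp_mem_idealGen' t' (e q.1).hom
      rwa [ht'] at this
  · intro h
    rw [Induced.jacobson_eq] at hzj
    have h2 := smul_eq_zero_of_mem_cornerRad hzj
    exact hz' (h ▸ h2 : idemElt α (e q.1) • z = 0)

end Simple

/-! ### Quasi-heredity -/

lemma mem_ringJacobson_iff {R : Type*} [Ring R] {x : R} :
    x ∈ Ring.jacobson R ↔ ∀ y, ∃ z, z * y * x + z = 1 := by
  have : Ring.jacobson R = Ideal.jacobson ⊥ := by
    rw [Ring.jacobson_eq_sInf_isMaximal, Ideal.jacobson]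
    simp
  rw [this, Ideal.mem_jacobson_iff]
  simp only [Ideal.mem_bot, sub_eq_zero]

section

variable {C : Type u} [Category.{v} C] [Finite C] {k : Type w} [Field k]
  {α : TwoCocycle C k} {n : ℕ} {e : Fin n → Idem C} (r : JRank e)

lemma map_lowIdeal_succ_eq_span (i : Fin n) :
    (lowIdeal α r (r.ord i + 1)).map (Ideal.Quotient.mk (lowIdeal α r (r.ord i))) =
      Ideal.span {x | ∃ a b, x = a * Ideal.Quotient.mk _ (idemElt α (e i)) * b} := by
  have hi : idemElt α (e i) ∈ lowIdeal α r (r.ord i + 1) := by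
    rw [idemElt_mem_lowIdeal, r.pos_idem]
    exact Nat.lt_succ_self _
  refine le_antisymm ?_ ?_
  · let K : Ideal (TwistedAlg α ⧸ lowIdeal α r (r.ord i)) :=
      Ideal.span {x | ∃ a b, x = a * Ideal.Quotient.mk _ (idemElt α (e i)) * b}
    have hK : K.IsTwoSided := by
      refine ⟨fun {x} b hx => ?_⟩
      induction hx using Submodule.span_induction with
      | mem x hx =>
        obtain ⟨a, c, rfl⟩ := hx
        exact Ideal.subset_span ⟨a, c * b, by rw [mul_assoc _ c]⟩
      | zero => rw [zero_mul]; exact zero_mem _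
      | add x y _ _ hx hy => rw [add_mul]; exact add_mem hx hy
      | smul a x _ hx => rw [smul_eq_mul, mul_assoc]; exact Ideal.mul_mem_left _ _ hx
    rw [Ideal.map_le_iff_le_comap]
    refine lowIdeal_succ_le r (K := K.comap (Ideal.Quotient.mk _)) ?_ ?_
    · intro x hx
      rw [Ideal.mem_comap, Ideal.Quotient.eq_zero_iff_mem.2 hx]
      exact zero_mem _
    · exact Ideal.subset_span ⟨1, 1, by rw [one_mul, mul_one]⟩
  · rw [Ideal.span_le]
    rintro _ ⟨a, b, rfl⟩
    obtain ⟨a, rfl⟩ := Ideal.Quotient.mk_surjective a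
    obtain ⟨b, rfl⟩ := Ideal.Quotient.mk_surjective b
    rw [← map_mul, ← map_mul]
    exact Ideal.mem_map_of_mem _ (Ideal.mul_mem_right _ _ (Ideal.mul_mem_left _ _ hi))

end

section QuasiHereditary

variable {C : Type u} [Category.{v} C] [Finite C] [∀ X Y : C, Finite (X ⟶ Y)] {k : Type w} [Field k]
  {α : TwoCocycle C k} {n : ℕ} {e : Fin n → Idem C} (r : JRank e)

instance TwistedAlg.finite : Module.Finite k (TwistedAlg α) :=
  inferInstanceAs (Module.Finite k (Mor C →₀ k))

instance TwistedAlg.isNoetherianRing : IsNoetherianRing (TwistedAlg α) :=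
  IsNoetherianRing.of_finite k _

instance TwistedAlg.isArtinianRing : IsArtinianRing (TwistedAlg α) :=
  IsArtinianRing.of_finite k _

/-- Modulo the ideal, the corner becomes the semisimple ring k_αΓ, while cutting the Jacobson
radical down by e' lands in the Jacobson radical of the corner. -/
lemma corner_mem_lowIdeal_of_mem_jacobson {i : Fin n} [NeZero (Nat.card (e i).Gam : k)]
    {a : TwistedAlg α} (ha : Ideal.Quotient.mk (lowIdeal α r (r.ord i)) a ∈
      Ring.jacobson (TwistedAlg α ⧸ lowIdeal α r (r.ord i))) :
    idemElt α (e i) * a * idemElt α (e i) ∈ lowIdeal α r (r.ord i) := by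
  let J := lowIdeal α r (r.ord i)
  let he := idemElt_idem α (e i)
  let c₀ : he.Corner := he.cornerMk a
  have h₀ : Ideal.Quotient.mk J c₀.1 ∈ Ring.jacobson (TwistedAlg α ⧸ J) := by
    change Ideal.Quotient.mk J (idemElt α (e i) * a * idemElt α (e i)) ∈ _
    rw [map_mul, map_mul]
    exact Ideal.mul_mem_right _ _ (Ideal.mul_mem_left _ _ ha)
  rw [mem_ringJacobson_iff] at h₀
  suffices h : inflHom α (e i) c₀ ∈ Ring.jacobson (TwistedGroupAlg α (e i)) by
    rw [IsSemisimpleRing.jacobson_eq_bot] at h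
    exact (inflHom_eq_zero_iff r c₀).1 h
  rw [mem_ringJacobson_iff]
  intro b
  obtain ⟨c, rfl⟩ := inflHom_surjective (e i) b
  obtain ⟨z, hz⟩ := h₀ (Ideal.Quotient.mk J c.1)
  obtain ⟨z, rfl⟩ := Ideal.Quotient.mk_surjective z
  -- Since c and c₀ already lie in the corner, e'ze' is again a left quasi-inverse.
  refine ⟨inflHom α (e i) (he.cornerMk z), ?_⟩
  rw [← map_mul, ← map_mul, ← map_add, ← sub_eq_zero, ← map_one (inflHom α (e i)), ← map_sub,
    inflHom_eq_zero_iff r]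
  have h1 : z * c.1 * c₀.1 + z - 1 ∈ J := by
    rw [← Ideal.Quotient.eq, map_add, map_mul, map_mul, map_one]
    exact hz
  have h2 := J.mul_mem_right (idemElt α (e i)) (J.mul_mem_left (idemElt α (e i)) h1)
  convert h2 using 1
  change (idemElt α (e i) * z * idemElt α (e i)) * c.1 * c₀.1 +
    (idemElt α (e i) * z * idemElt α (e i)) - idemElt α (e i) = _
  have h3 := IsIdempotentElem.Corner.left_mul he c
  have h4 := IsIdempotentElem.Corner.mul_right he c₀
  rw [mul_sub, sub_mul, mul_add, add_mul, mul_one, he.eq]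
  congr 2
  rw [mul_assoc (_ * z), h3, mul_assoc (idemElt α (e i)) (_ * _), mul_assoc (_ * _) c₀.1, h4]
  simp only [mul_assoc]

/-- The free cover g of the layer is killed by J_m as an A-module, so J_(m+1) → K lifts through g.
The lift vanishes on J_m and therefore descends to a section of g over A/J_m. -/
lemma lowIdeal_layer_projective (hC : IsSplitCat C) (m : ℕ) :
    Module.Projective (TwistedAlg α ⧸ lowIdeal α r m)
      ((lowIdeal α r (m + 1)).map (Ideal.Quotient.mk (lowIdeal α r m))) := by
  let J := lowIdeal α r m
  let B := TwistedAlg α ⧸ J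
  let K : Ideal B := (lowIdeal α r (m + 1)).map (Ideal.Quotient.mk J)
  change Module.Projective B K
  refine Module.Projective.of_lifting_property'' fun g hg => ?_
  let _ : Module (TwistedAlg α) K := Module.compHom K (Ideal.Quotient.mk J)
  let _ : Module (TwistedAlg α) (K →₀ B) := Module.compHom (K →₀ B) (Ideal.Quotient.mk J)
  let g' : (K →₀ B) →ₗ[TwistedAlg α] K :=
    { toFun := g, map_add' := map_add g, map_smul' := fun a z => map_smul g (Ideal.Quotient.mk J a) z }
  let f : lowIdeal α r (m + 1) →ₗ[TwistedAlg α] K :=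
    { toFun := fun a => ⟨Ideal.Quotient.mk J a.1, Ideal.mem_map_of_mem _ a.2⟩
      map_add' := fun a b => Subtype.ext (map_add _ a.1 b.1)
      map_smul' := fun a b => Subtype.ext (map_mul _ a b.1) }
  have hf : ∀ z : K, ∃ a, f a = z := by
    rintro ⟨z, hz⟩
    obtain ⟨a, ha, rfl⟩ := (Ideal.mem_map_iff_of_surjective _ Ideal.Quotient.mk_surjective).1 hz
    exact ⟨⟨a, ha⟩, rfl⟩
  have hkill : ∀ a ∈ lowIdeal α r m, ∀ z : K →₀ B, a • z = 0 := by
    intro a ha z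
    change Ideal.Quotient.mk J a • z = 0
    rw [Ideal.Quotient.eq_zero_iff_mem.2 ha, zero_smul]
  obtain ⟨h, hh, h0⟩ := exists_lift_lowIdeal r hC hkill g' hg f
  have hh0 : ∀ a, f a = 0 → h a = 0 := fun a ha =>
    h0 a (Ideal.Quotient.eq_zero_iff_mem.1 (congrArg Subtype.val ha))
  choose σ hσ using hf
  have key : ∀ a b, f a = f b → h a = h b := fun a b hab => by
    rw [← sub_eq_zero, ← map_sub]
    exact hh0 _ (by rw [map_sub, hab, sub_self])
  refine ⟨{ toFun := fun z => h (σ z)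
            map_add' := fun z z' => ?_
            map_smul' := fun b z => ?_ }, ?_⟩
  · rw [← map_add]
    exact key _ _ (by rw [map_add, hσ, hσ, hσ])
  · obtain ⟨b, rfl⟩ := Ideal.Quotient.mk_surjective b
    refine (key _ (b • σ z) ?_).trans (map_smul h b (σ z))
    rw [map_smul, hσ, hσ]
    rfl
  · ext z : 1
    exact (hh (σ z)).trans (hσ z)

lemma lowIdeal_layer_isHeredityIdeal (hC : IsSplitCat C) (i : Fin n)
    [NeZero (Nat.card (e i).Gam : k)] :
    IsHeredityIdeal (TwistedAlg α ⧸ lowIdeal α r (r.ord i))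
      ((lowIdeal α r (r.ord i + 1)).map (Ideal.Quotient.mk (lowIdeal α r (r.ord i)))) := by
  have hspan := map_lowIdeal_succ_eq_span (α := α) r i
  refine ⟨⟨Ideal.Quotient.mk _ (idemElt α (e i)), ?_, hspan⟩, ?_, lowIdeal_layer_projective r hC _⟩
  · exact (idemElt_idem α (e i)).map (Ideal.Quotient.mk _)
  · intro x hx y hy z hz
    rw [hspan] at hx hz
    induction hx using Submodule.span_induction with
    | zero => rw [zero_mul, zero_mul]
    | add x x' _ _ h h' => rw [add_mul, add_mul, h, h', add_zero]
    | smul a x _ h => rw [smul_eq_mul, mul_assoc, mul_assoc, ← mul_assoc x, h, mul_zero]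
    | mem x hx =>
      obtain ⟨a, b, rfl⟩ := hx
      -- The radical element y varies, so that left coefficients of z can be absorbed into it. What
      -- remains is a ε (b y c) ε d, where ε(byc)ε = 0 by the corner computation.
      induction hz using Submodule.span_induction generalizing y with
      | zero => rw [mul_zero]
      | add z z' _ _ h h' => rw [mul_add, h y hy, h' y hy, add_zero]
      | smul c z _ h =>
        rw [smul_eq_mul, ← mul_assoc, mul_assoc _ y c]
        exact h _ (Ideal.mul_mem_right _ _ hy)
      | mem z hz =>
        obtain ⟨c, d, rfl⟩ := hz
        obtain ⟨w, hw⟩ := Ideal.Quotient.mk_surjective (b * y * c)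
        have h1 := corner_mem_lowIdeal_of_mem_jacobson r (i := i) (a := w) (by
          rw [hw]
          exact Ideal.mul_mem_right _ _ (Ideal.mul_mem_left _ _ hy))
        have h2 := Ideal.Quotient.eq_zero_iff_mem.2 h1
        rw [map_mul, map_mul, hw] at h2
        calc _ = a * (Ideal.Quotient.mk _ (idemElt α (e i)) * (b * y * c) *
            Ideal.Quotient.mk _ (idemElt α (e i))) * d := by simp only [mul_assoc]
          _ = 0 := by rw [h2, mul_zero, zero_mul]

lemma twistedAlg_isQuasiHereditary (r : JRank e) (hC : IsSplitCat C) (hk : ∀ e : Idem C, (Nat.card e.Gam : k) ≠ 0) :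
    IsQuasiHereditary k (TwistedAlg α) := by
  refine ⟨inferInstance, n, fun m => lowIdeal α r m, ?_⟩
  refine
    { twoSided := fun m => inferInstance
      bot := lowIdeal_zero r
      top := lowIdeal_top r
      strict := ?_
      heredity := ?_ }
  · rw [Fin.strictMono_iff_lt_succ]
    intro m
    refine (lowIdeal_mono r (by simp)).lt_of_not_ge fun h => ?_
    obtain ⟨i, rfl⟩ := r.ord.surjective m
    have h1 : idemElt α (e i) ∈ lowIdeal α r (r.ord i).succ := by
      rw [idemElt_mem_lowIdeal, r.pos_idem]
      simp
    have h2 := h h1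
    rw [idemElt_mem_lowIdeal, r.pos_idem] at h2
    simp at h2
  · intro m
    obtain ⟨i, rfl⟩ := r.ord.surjective m
    have : NeZero (Nat.card (e i).Gam : k) := ⟨hk (e i)⟩
    exact lowIdeal_layer_isHeredityIdeal r hC i

end QuasiHereditary

/-! ### Standard filtrations of projective covers -/

section Layer

variable {C : Type u} [Category.{v} C] [Finite C] {k : Type w} [Field k]
  {α : TwoCocycle C k} {n : ℕ} {e : Fin n → Idem C} (r : JRank e)
  {P : Type y} [AddCommGroup P] [Module (TwistedAlg α) P]

/-- The submodules `J m • P` of a direct summand `P` of `A`, for an embedding `ι : P → A`. -/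
def lowPart (ι : P →ₗ[TwistedAlg α] TwistedAlg α) (m : ℕ) : Submodule (TwistedAlg α) P :=
  Submodule.comap ι (lowIdeal α r m)

variable {ι : P →ₗ[TwistedAlg α] TwistedAlg α} {y : P}

lemma mem_lowPart {m : ℕ} {z : P} : z ∈ lowPart r ι m ↔ ι z ∈ lowIdeal α r m := Iff.rfl

lemma lowPart_mono {m m' : ℕ} (h : m ≤ m') : lowPart r ι m ≤ lowPart r ι m' :=
  fun _ hz => lowIdeal_mono r h hz

lemma smul_mem_lowPart {m : ℕ} {a : TwistedAlg α} (ha : a ∈ lowIdeal α r m) (z : P) :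
    a • z ∈ lowPart r ι m := by
  rw [mem_lowPart, map_smul]
  exact Ideal.mul_mem_right _ _ ha

/-- The layer `J (m + 1) P / J m P`. -/
abbrev Layer (ι : P →ₗ[TwistedAlg α] TwistedAlg α) (m : ℕ) : Type _ :=
  lowPart r ι (m + 1) ⧸ (lowPart r ι m).submoduleOf (lowPart r ι (m + 1))

lemma lowIdeal_smul_layer {m : ℕ} {a : TwistedAlg α} (ha : a ∈ lowIdeal α r m)
    (z : Layer r ι m) : a • z = 0 := by
  obtain ⟨z, rfl⟩ := Submodule.mkQ_surjective _ z
  rw [← map_smul]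
  exact (Submodule.Quotient.mk_eq_zero _).2 (smul_mem_lowPart r ha z.1)

/-- The a with aP inside J_(m+1)P and, modulo J_m P, inside the span of the e_j'-part form a
two-sided ideal. It contains J_m and e_j', hence J_(m+1); now use z = ι(z)y. -/
lemma layer_span (hy : ∀ z, ι z • y = z) (j : Fin n) :
    Submodule.span (TwistedAlg α) {z : Layer r ι (r.ord j) | idemElt α (e j) • z = z} = ⊤ := by
  let m := (r.ord j).1
  let W := Submodule.span (TwistedAlg α) {z : Layer r ι m | idemElt α (e j) • z = z}
  let K : Ideal (TwistedAlg α) :=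
    { carrier := {a | ∀ x : P, ∃ h : a • x ∈ lowPart r ι (m + 1),
        Submodule.mkQ ((lowPart r ι m).submoduleOf (lowPart r ι (m + 1))) ⟨a • x, h⟩ ∈ W}
      zero_mem' := fun x => by
        have h : (0 : TwistedAlg α) • x = 0 := zero_smul _ x
        refine ⟨h ▸ zero_mem _, ?_⟩
        convert zero_mem W
        exact (Submodule.Quotient.mk_eq_zero _).2 (by
          change (0 : TwistedAlg α) • x ∈ lowPart r ι m
          rw [h]
          exact zero_mem _)
      add_mem' := fun {a b} ha hb x => by
        obtain ⟨h1, h2⟩ := ha x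
        obtain ⟨h3, h4⟩ := hb x
        refine ⟨by rw [add_smul]; exact add_mem h1 h3, ?_⟩
        convert add_mem h2 h4 using 1
        rw [← map_add]
        exact congrArg _ (Subtype.ext (add_smul a b x))
      smul_mem' := fun c a ha x => by
        obtain ⟨h1, h2⟩ := ha x
        refine ⟨by rw [smul_assoc]; exact Submodule.smul_mem _ _ h1, ?_⟩
        convert W.smul_mem c h2 using 1
        rw [← map_smul]
        exact congrArg _ (Subtype.ext (smul_assoc c a x)) }
  have hK : K.IsTwoSided := ⟨fun {a} b ha x => by
    obtain ⟨h1, h2⟩ := ha (b • x)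
    refine ⟨by rw [mul_smul]; exact h1, ?_⟩
    convert h2 using 2
    exact Subtype.ext (mul_smul a b x)⟩
  have hle : lowIdeal α r (m + 1) ≤ K := by
    refine lowIdeal_succ_le r (fun a ha x => ?_) (fun x => ?_)
    · have h := smul_mem_lowPart r (ι := ι) ha x
      refine ⟨lowPart_mono r (Nat.le_succ _) h, ?_⟩
      convert zero_mem W
      exact (Submodule.Quotient.mk_eq_zero _).2 h
    · refine ⟨smul_mem_lowPart r ?_ x, Submodule.subset_span ?_⟩
      · rw [idemElt_mem_lowIdeal, r.pos_idem]
        exact Nat.lt_succ_self _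
      · change _ • _ = _
        rw [← map_smul]
        refine congrArg _ (Subtype.ext ?_)
        change idemElt α (e j) • idemElt α (e j) • x = _
        rw [smul_smul, (idemElt_idem α (e j)).eq]
  rw [eq_top_iff]
  intro z _
  obtain ⟨⟨z, hz⟩, rfl⟩ := Submodule.mkQ_surjective _ z
  obtain ⟨h1, h2⟩ := hle hz y
  convert h2 using 2
  exact Subtype.ext (hy z).symm

variable [∀ X Y : C, Finite (X ⟶ Y)] {l : Fin n → ℕ} {T : ∀ i, Fin (l i) → Type x}
  [∀ i r, AddCommGroup (T i r)] [∀ i r, Module (TwistedGroupAlg α (e i)) (T i r)]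

/-- The layers of a direct summand of `A` are direct sums of modules `Δ`. -/
lemma exists_pi_delta_of_layer [IsNoetherian (TwistedAlg α) P] (hC : IsSplitCat C)
    (hT : ∀ i, IsSimpleReps (TwistedGroupAlg α (e i)) (T i)) (hy : ∀ z, ι z • y = z) (j : Fin n)
    [NeZero (Nat.card (e j).Gam : k)] :
    ∃ (N : ℕ) (s : Fin N → Fin (l j))
      (g : lowPart r ι (r.ord j + 1) →ₗ[TwistedAlg α] ∀ q, Delta α (e j) (T j (s q))),
      Function.Surjective g ∧
      LinearMap.ker g = (lowPart r ι (r.ord j)).submoduleOf (lowPart r ι (r.ord j + 1)) := by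
  let m := (r.ord j).1
  let X := Layer r ι m
  let he := idemElt_idem α (e j)
  have hX : ∀ a ∈ lowIdeal α r m, ∀ z : X, a • z = 0 := fun a ha z => lowIdeal_smul_layer r ha z
  have hkill : ∀ c : he.Corner, inflHom α (e j) c = 0 → ∀ z : CornerPart he X, c • z = 0 :=
    cornerPart_killed r hX
  have hss : IsSemisimpleModule he.Corner (CornerPart he X) :=
    isSemisimpleModule_of_surjective (inflHom α (e j)) _ (inflHom_surjective (e j)) hkill
  obtain ⟨N, S, ψ, hS⟩ := IsSemisimpleModule.exists_linearEquiv_fin_dfinsupp he.Corner (CornerPart he X)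
  have hST : ∀ q, ∃ t, Nonempty (S q ≃ₗ[he.Corner] Inflation α (e j) (T j t)) := fun q =>
    (hT j).exists_equiv_inflation α (e j) (S q)
      (fun c hc z => Subtype.ext (hkill c hc z.1)) (hS q)
  choose s hs using hST
  let ψ' : CornerPart he X ≃ₗ[he.Corner] ∀ q, Inflation α (e j) (T j (s q)) :=
    (ψ.trans DFinsupp.linearEquivFunOnFintype).trans (LinearEquiv.piCongrRight fun q => (hs q).some)
  obtain ⟨g, hg, hg0⟩ := Induced.exists_pi_surjective he (layer_span r hy j) ψ'
  have hpi : ∀ a ∈ lowIdeal α r m, ∀ z : ∀ q, Delta α (e j) (T j (s q)), a • z = 0 :=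
    fun a ha z => funext fun q => lowIdeal_smul_delta r hC j _ ha (z q)
  -- Lift J_(m+1) → X, a ↦ ay, through g. Composing the lift with ι and passing modulo J_m P gives a
  -- section of g, because ι(z)y = z.
  let f₀ : lowIdeal α r (m + 1) →ₗ[TwistedAlg α] lowPart r ι (m + 1) :=
    { toFun := fun a => ⟨a.1 • y, smul_mem_lowPart r a.2 y⟩
      map_add' := fun a b => Subtype.ext (add_smul a.1 b.1 y)
      map_smul' := fun c a => Subtype.ext (smul_assoc c a.1 y) }
  let f : lowIdeal α r (m + 1) →ₗ[TwistedAlg α] X := (Submodule.mkQ _).comp f₀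
  obtain ⟨h, hh, hh0⟩ := exists_lift_lowIdeal r hC hpi g hg f
  let σ : lowPart r ι (m + 1) →ₗ[TwistedAlg α] ∀ q, Delta α (e j) (T j (s q)) :=
    h.comp (ι.restrict fun z hz => hz)
  let σ' : X →ₗ[TwistedAlg α] ∀ q, Delta α (e j) (T j (s q)) :=
    Submodule.liftQ _ σ (fun z hz => hh0 _ hz)
  have hσ' : ∀ z, g (σ' z) = z := by
    intro z
    obtain ⟨z, rfl⟩ := Submodule.mkQ_surjective _ z
    refine (hh _).trans ?_
    exact congrArg (Submodule.mkQ _) (Subtype.ext (hy z.1))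
  have hinj := injective_of_split (Induced.span_pi_corner he) g σ' hσ' hg0
  let G := LinearEquiv.ofBijective g ⟨hinj, hg⟩
  refine ⟨N, s, G.symm.toLinearMap.comp (Submodule.mkQ _), ?_, ?_⟩
  · exact G.symm.surjective.comp (Submodule.mkQ_surjective _)
  · rw [LinearMap.ker_comp, LinearEquiv.ker, Submodule.comap_bot, Submodule.ker_mkQ]

end Layer

/-! ### Projective covers as retracts of Ae', and their layers -/

section Cover

variable {C : Type u} [Category.{v} C] [Finite C] {k : Type w} [Field k]
  {α : TwoCocycle C k} {n : ℕ} {e : Fin n → Idem C} (r : JRank e)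
  {P : Type y} [AddCommGroup P] [Module (TwistedAlg α) P]

/-- A projective cover of a simple module `D` with `f' D ≠ 0` is a direct summand of `A f'`. -/
lemma IsProjectiveCover.exists_retract {D : Type*} [AddCommGroup D] [Module (TwistedAlg α) D]
    [IsSimpleModule (TwistedAlg α) D] {π : P →ₗ[TwistedAlg α] D} (hπ : IsProjectiveCover π)
    {f : Idem C} (hf : ∃ z : D, idemElt α f • z ≠ 0) :
    ∃ (y : P) (ι : P →ₗ[TwistedAlg α] TwistedAlg α), (∀ z, ι z • y = z) ∧
      ∀ z, ι z * idemElt α f = ι z := by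
  obtain ⟨z, hz⟩ := hf
  obtain ⟨y, rfl⟩ := hπ.surjective z
  -- As e'π(y) ≠ 0, the element e'y lies outside ker π, the greatest proper submodule, and so
  -- generates P.
  have hy : Submodule.span (TwistedAlg α) {idemElt α f • y} = ⊤ := by
    by_contra h
    apply hz
    rw [← map_smul]
    exact hπ.le_ker h (Submodule.mem_span_singleton_self _)
  have hs : Function.Surjective (LinearMap.toSpanSingleton (TwistedAlg α) P (idemElt α f • y)) := by
    rw [← LinearMap.range_eq_top, LinearMap.range_toSpanSingleton, hy]
  have := hπ.projective
  obtain ⟨ι, hι⟩ := Module.projective_lifting_property _ LinearMap.id hs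
  refine ⟨idemElt α f • y, (LinearMap.toSpanSingleton (TwistedAlg α) (TwistedAlg α)
    (idemElt α f)).comp ι, fun z => ?_, fun z => ?_⟩
  · have := LinearMap.congr_fun hι z
    rw [LinearMap.comp_apply, LinearMap.toSpanSingleton_apply, smul_assoc, smul_smul (idemElt α f),
      (idemElt_idem α f).eq]
    exact this
  · change ι z * idemElt α f * idemElt α f = ι z * idemElt α f
    rw [mul_assoc, (idemElt_idem α f).eq]

variable {ι : P →ₗ[TwistedAlg α] TwistedAlg α} {y : P}

lemma lowPart_zero (hy : ∀ z, ι z • y = z) : lowPart r ι 0 = ⊥ := by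
  rw [eq_bot_iff]
  intro z hz
  rw [mem_lowPart, lowIdeal_zero] at hz
  rw [← hy z, show ι z = 0 from hz, zero_smul]
  exact zero_mem _

lemma lowPart_succ_eq_top {i : Fin n} (hι : ∀ z, ι z * idemElt α (e i) = ι z) :
    lowPart r ι (r.ord i + 1) = ⊤ := by
  rw [eq_top_iff]
  intro z _
  rw [mem_lowPart, ← hι]
  refine Ideal.mul_mem_left _ _ ?_
  rw [idemElt_mem_lowIdeal, r.pos_idem]
  exact Nat.lt_succ_self _

/-- ι embeds P in Ae_i', which is spanned by morphisms s = s ∘ e_i; a nonzero layer of number ord j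
requires one of these in the J-class of e_j. -/
lemma mem_idealGen_of_lowPart_ne {i j : Fin n} (hι : ∀ z, ι z * idemElt α (e i) = ι z)
    (h : ¬ lowPart r ι (r.ord j + 1) ≤ lowPart r ι (r.ord j)) :
    (e j).toMor ∈ idealGen {(e i).toMor} := by
  obtain ⟨z, hz, hz'⟩ := SetLike.not_le_iff_exists.1 h
  obtain ⟨s, ⟨⟨Z, t, rfl, ht⟩, hs⟩, hle⟩ := exists_mor_of_notMem_lowIdeal r
    (mem_morSpan_inter (mem_morSpan_of_mul_idemElt (hι z)) hz) hz'
  have h1 := comp_mem_idealGen (e i).hom t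
  rw [ht] at h1
  refine mem_idealGen_trans (r.mem_of_pos_eq ?_) h1
  rw [r.pos_idem]
  change r.pos _ < (r.ord j).1 + 1 at hs
  omega

variable [∀ X Y : C, Finite (X ⟶ Y)] {l : Fin n → ℕ} {T : ∀ i, Fin (l i) → Type x}
  [∀ i r, AddCommGroup (T i r)] [∀ i r, Module (TwistedGroupAlg α (e i)) (T i r)]

lemma nontrivial_delta {i : Fin n} (hT : IsSimpleReps (TwistedGroupAlg α (e i)) (T i))
    (t : Fin (l i)) : Nontrivial (Delta α (e i) (T i t)) := by
  have := hT.simple t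
  have := Inflation.isSimpleModule α (e i) (T i t)
  infer_instance

/-- Each layer below that of p is a direct sum of modules Δ_js. If it has a summand, e_j lies
strictly below e_p, which is (j,s) > p in the reversed order on weights; otherwise it adds no step.
-/
lemma reflTransGen_lowPart [IsNoetherian (TwistedAlg α) P] (hC : IsSplitCat C)
    (hk : ∀ e : Idem C, (Nat.card e.Gam : k) ≠ 0)
    (hT : ∀ i, IsSimpleReps (TwistedGroupAlg α (e i)) (T i)) (p : Weight e l)
    (hy : ∀ z, ι z • y = z) (hι : ∀ z, ι z * idemElt α (e p.1) = ι z) (m : ℕ)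
    (hm : m ≤ r.ord p.1) :
    Relation.ReflTransGen
      (FiltrationStep (R := TwistedAlg α) (fun p : Weight e l => Delta α (e p.1) (T p.1 p.2)) p)
      ⊥ (lowPart r ι m) := by
  induction m with
  | zero => rw [lowPart_zero r hy]
  | succ m ih =>
    refine (ih (by omega)).trans ?_
    obtain ⟨j, hj⟩ := r.ord.surjective ⟨m, by omega⟩
    obtain rfl : (r.ord j).1 = m := congrArg Fin.val hj
    have : NeZero (Nat.card (e j).Gam : k) := ⟨hk (e j)⟩
    obtain ⟨N, s, g, hg, hgk⟩ := exists_pi_delta_of_layer r hC hT hy j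
    have : ∀ q : Weight e l, Nontrivial (Delta α (e q.1) (T q.1 q.2)) :=
      fun q => nontrivial_delta (hT q.1) q.2
    refine reflTransGen_of_pi (Δ := fun p : Weight e l => Delta α (e p.1) (T p.1 p.2))
      (lowPart_mono r (Nat.le_succ _)) (fun q => (⟨j, s q⟩ : Weight e l)) ?_ g hg hgk
    intro q
    refine r.jLT_iff.2 ⟨mem_idealGen_of_lowPart_ne r hι fun hle => ?_, ?_⟩
    · have h1 : LinearMap.ker g = ⊤ := by
        rw [hgk, eq_top_iff]
        exact fun z _ => hle z.2
      have := nontrivial_delta (hT j) (s q)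
      obtain ⟨z, hz⟩ := exists_ne (0 : Delta α (e j) (T j (s q)))
      obtain ⟨x, hx⟩ := hg (Pi.single q z)
      apply hz
      have h2 : g x = 0 := by rw [← LinearMap.mem_ker, h1]; trivial
      rw [← Pi.single_eq_same (M := fun q => Delta α (e j) (T j (s q))) q z, ← hx, h2]
      rfl
    · rintro h
      have h' : r.ord j = r.ord p.1 := congrArg r.ord h
      rw [h'] at hm
      omega

end Cover

/-- If a projective cover of a simple module `D` maps onto a finite product of modules with simple
heads, then there is at most one factor, and its head is `D`. -/
lemma IsProjectiveCover.exists_ker_proj_eq {R P D : Type*} [Ring R] [AddCommGroup P] [Module R P]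
    [AddCommGroup D] [Module R D] [IsSimpleModule R D] {π : P →ₗ[R] D} (hπ : IsProjectiveCover π)
    {N : ℕ} {Δ : Fin N → Type*} [∀ q, AddCommGroup (Δ q)] [∀ q, Module R (Δ q)]
    (hΔ : ∀ q, IsSimpleModule R (Head R (Δ q))) (G : P →ₗ[R] ∀ q, Δ q)
    (hG : Function.Surjective G) (hk : LinearMap.ker G ≠ ⊤) :
    ∃ q, Nonempty (Head R (Δ q) ≃ₗ[R] D) ∧
      LinearMap.ker ((LinearMap.proj q).comp G) = LinearMap.ker G := by
  let H (q : Fin N) : P →ₗ[R] Head R (Δ q) :=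
    (Submodule.mkQ _).comp ((LinearMap.proj q).comp G)
  have hHs : ∀ q, Function.Surjective (H q) := fun q =>
    (Submodule.mkQ_surjective _).comp ((Function.surjective_eval q).comp hG)
  have hD := LinearMap.isCoatom_ker_of_surjective hπ.surjective
  -- All maps from P to the heads have kernel ker π, the greatest proper submodule. Two independent
  -- coordinates cannot share a kernel, hence `hsub`.
  have hker : ∀ q, LinearMap.ker (H q) = LinearMap.ker π := fun q => by
    have hc := LinearMap.isCoatom_ker_of_surjective (hHs q)
    exact ((hc.le_iff.1 (hπ.le_ker hc.1)).resolve_left hD.1).symm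
  have hsub : ∀ q q' : Fin N, q = q' := by
    intro q q'
    by_contra hne
    have := IsSimpleModule.nontrivial R (Head R (Δ q))
    obtain ⟨z, hz⟩ := exists_ne (0 : Head R (Δ q))
    obtain ⟨z, rfl⟩ := Submodule.mkQ_surjective _ z
    obtain ⟨t, ht⟩ := hG (Pi.single q z)
    have h1 : t ∈ LinearMap.ker (H q') := by
      change Submodule.mkQ _ (G t q') = 0
      rw [ht, Pi.single_eq_of_ne (Ne.symm hne), map_zero]
    rw [hker, ← hker q] at h1
    change Submodule.mkQ _ (G t q) = 0 at h1
    rw [ht, Pi.single_eq_same] at h1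
    exact hz h1
  have hN : Nonempty (Fin N) := by
    by_contra h
    rw [not_nonempty_iff] at h
    apply hk
    rw [eq_top_iff]
    exact fun t _ => Subsingleton.elim _ _
  obtain ⟨q⟩ := hN
  refine ⟨q, ⟨((H q).quotKerEquivOfSurjective (hHs q)).symm.trans
    ((Submodule.quotEquivOfEq _ _ (hker q)).trans (π.quotKerEquivOfSurjective hπ.surjective))⟩, ?_⟩
  ext t
  simp only [LinearMap.mem_ker, LinearMap.comp_apply, LinearMap.proj_apply]
  constructor
  · intro h
    funext q'
    rw [← hsub q q']
    exact h
  · intro h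
    rw [h]
    rfl

lemma Submodule.smul_mem_of_quot_submoduleOf_equiv {R M N : Type*} [Ring R] [AddCommGroup M]
    [Module R M] [AddCommGroup N] [Module R N] {L W : Submodule R M}
    (f : (W ⧸ L.submoduleOf W) ≃ₗ[R] N) {a : R} (ha : ∀ d : N, a • d = 0) {z : M} (hz : z ∈ W) :
    a • z ∈ L := by
  have h0 := ha (f (Submodule.Quotient.mk ⟨z, hz⟩))
  rw [← map_smul, ← Submodule.Quotient.mk_smul, map_eq_zero_iff f f.injective,
    Submodule.Quotient.mk_eq_zero] at h0
  exact h0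

/-- J_m = J_m², since s = s ∘ (u ∘ s) whenever s ∘ u ∘ s = s, and both factors lie in J_m with s. -/
lemma lowIdeal_le_of_mul_mem {C : Type u} [Category.{v} C] [Finite C] {k : Type w} [Field k]
    {α : TwoCocycle C k} {n : ℕ} {e : Fin n → Idem C} (r : JRank e) (hC : IsSplitCat C)
    {m : ℕ} {K : Ideal (TwistedAlg α)}
    (hK : ∀ a ∈ lowIdeal α r m, ∀ b ∈ lowIdeal α r m, a * b ∈ K) : lowIdeal α r m ≤ K := by
  intro x hx
  rw [mem_lowIdeal] at hx
  induction hx using morSpan_induction with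
  | zero => exact zero_mem _
  | add a b _ _ ha hb => exact add_mem ha hb
  | single c s hs =>
    obtain ⟨X, Y, s⟩ := s
    obtain ⟨u, hu⟩ := hC s
    have h := TwistedAlg.of_mul_of α s (s ≫ u)
    rw [Category.assoc, hu] at h
    have h1 : c • TwistedAlg.of α ⟨X, Y, s⟩ = ((c * (α.val s (s ≫ u))⁻¹.1) •
        TwistedAlg.of α ⟨X, Y, s⟩) * TwistedAlg.of α ⟨X, X, s ≫ u⟩ := by
      rw [smul_mul_assoc, h, smul_smul, mul_assoc, Units.inv_mul, mul_one]
    rw [h1]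
    refine hK _ (smul_mem_lowIdeal r _ ((of_mem_lowIdeal r).2 hs)) _ ((of_mem_lowIdeal r).2 ?_)
    exact (r.pos_le (comp_mem_idealGen s u)).trans_lt hs

/-! ### Standard filtrations and standard modules -/

section Main

variable {C : Type u} [Category.{v} C] [Finite C] [∀ X Y : C, Finite (X ⟶ Y)] {k : Type w} [Field k]
  {α : TwoCocycle C k} {n : ℕ} {e : Fin n → Idem C} (r : JRank e)
  {P : Type y} [AddCommGroup P] [Module (TwistedAlg α) P]
  {l : Fin n → ℕ} {T : ∀ i, Fin (l i) → Type x}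
  [∀ i r, AddCommGroup (T i r)] [∀ i r, Module (TwistedGroupAlg α (e i)) (T i r)]
  {ι : P →ₗ[TwistedAlg α] TwistedAlg α} {y : P}

lemma head_delta_isSimpleModule {i : Fin n} (hT : IsSimpleReps (TwistedGroupAlg α (e i)) (T i))
    (t : Fin (l i)) : IsSimpleModule (TwistedAlg α) (Head (TwistedAlg α) (Delta α (e i) (T i t))) := by
  have := hT.simple t
  have := Inflation.isSimpleModule α (e i) (T i t)
  infer_instance

lemma lowPart_ne_top (hC : IsSplitCat C) (hT : ∀ i, IsSimpleReps (TwistedGroupAlg α (e i)) (T i))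
    (p : Weight e l) {π : P →ₗ[TwistedAlg α] Head (TwistedAlg α) (Delta α (e p.1) (T p.1 p.2))}
    (hπ : Function.Surjective π) (hy : ∀ z, ι z • y = z) : lowPart r ι (r.ord p.1) ≠ ⊤ := by
  intro h
  have := head_delta_isSimpleModule (hT p.1) p.2
  have := IsSimpleModule.nontrivial (TwistedAlg α)
    (Head (TwistedAlg α) (Delta α (e p.1) (T p.1 p.2)))
  obtain ⟨z, hz⟩ := exists_ne (0 : Head (TwistedAlg α) (Delta α (e p.1) (T p.1 p.2)))
  obtain ⟨z, rfl⟩ := hπ z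
  have hz' : z ∈ lowPart r ι (r.ord p.1) := by rw [h]; trivial
  apply hz
  rw [← hy z, map_smul]
  exact lowIdeal_smul_head r hC _ _ hz' _

/-- The top layer of the projective cover of `D p` is `Δ p`. -/
lemma nonempty_quot_lowPart_equiv [IsNoetherian (TwistedAlg α) P] (hC : IsSplitCat C)
    (hk : ∀ e : Idem C, (Nat.card e.Gam : k) ≠ 0)
    (hT : ∀ i, IsSimpleReps (TwistedGroupAlg α (e i)) (T i)) (p : Weight e l)
    {π : P →ₗ[TwistedAlg α] Head (TwistedAlg α) (Delta α (e p.1) (T p.1 p.2))}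
    (hπ : IsProjectiveCover π) (hy : ∀ z, ι z • y = z)
    (hι : ∀ z, ι z * idemElt α (e p.1) = ι z) :
    Nonempty ((P ⧸ lowPart r ι (r.ord p.1)) ≃ₗ[TwistedAlg α] Delta α (e p.1) (T p.1 p.2)) := by
  obtain ⟨i, t⟩ := p
  have hs := head_delta_isSimpleModule (hT i)
  have := hs t
  have : NeZero (Nat.card (e i).Gam : k) := ⟨hk (e i)⟩
  obtain ⟨N, s, g, hg, hgk⟩ := exists_pi_delta_of_layer r hC hT hy i
  have htop := lowPart_succ_eq_top r hι
  let inc : P →ₗ[TwistedAlg α] lowPart r ι (r.ord i + 1) :=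
    LinearMap.codRestrict _ LinearMap.id fun z => by
      change z ∈ lowPart r ι (r.ord i + 1)
      rw [htop]
      trivial
  have hker : LinearMap.ker (g.comp inc) = lowPart r ι (r.ord i) := by
    rw [LinearMap.ker_comp, hgk]
    rfl
  have hsurj : Function.Surjective (g.comp inc) := by
    refine hg.comp ?_
    rintro ⟨z, hz⟩
    exact ⟨z, rfl⟩
  obtain ⟨q, ⟨f⟩, hq⟩ := hπ.exists_ker_proj_eq (fun q => hs (s q)) (g.comp inc) hsurj (by
    rw [hker]
    exact lowPart_ne_top r hC hT ⟨i, t⟩ hπ.surjective hy)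
  have hst : (⟨i, s q⟩ : Weight e l) = ⟨i, t⟩ :=
    (delta_isSimpleReps r hC hT).pairwise ⟨i, s q⟩ ⟨i, t⟩ ⟨f⟩
  have hst' : s q = t := by
    cases hst
    rfl
  rw [hker] at hq
  rw [← hst', ← hq]
  exact ⟨LinearMap.quotKerEquivOfSurjective _ ((Function.surjective_eval q).comp hsurj)⟩

lemma isNoetherian_of_retract
    (hy : ∀ z, ι z • y = z) : IsNoetherian (TwistedAlg α) P :=
  isNoetherian_of_surjective (LinearMap.toSpanSingleton (TwistedAlg α) P y)
    (LinearMap.range_eq_top.2 fun z => ⟨ι z, hy z⟩)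

lemma hasStandardFiltration_of_isProjectiveCover (r : JRank e) (hC : IsSplitCat C)
    (hk : ∀ e : Idem C, (Nat.card e.Gam : k) ≠ 0)
    (hT : ∀ i, IsSimpleReps (TwistedGroupAlg α (e i)) (T i)) (p : Weight e l)
    {π : P →ₗ[TwistedAlg α] Head (TwistedAlg α) (Delta α (e p.1) (T p.1 p.2))}
    (hπ : IsProjectiveCover π) :
    HasStandardFiltration (TwistedAlg α)
      (fun p : Weight e l => Delta α (e p.1) (T p.1 p.2)) p P := by
  have := (hT p.1).simple p.2
  have := Inflation.isSimpleModule α (e p.1) (T p.1 p.2)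
  obtain ⟨y, ι, hy, hι⟩ := hπ.exists_retract
    (Induced.exists_head_smul_ne_zero (idemElt_idem α (e p.1)))
  have := isNoetherian_of_retract hy
  exact hasStandardFiltration_of_reflTransGen
    (Δ := fun p : Weight e l => Delta α (e p.1) (T p.1 p.2))
    (lowPart_ne_top r hC hT p hπ.surjective hy).lt_top
    (reflTransGen_lowPart r hC hk hT p hy hι _ le_rfl)
    (nonempty_quot_lowPart_equiv r hC hk hT p hπ hy hι)

/-- A quotient `P / K` of the projective cover of `D p` is a quotient of `Δ p`, if all composition
factors of its radical are of the form `D q` with `q < p`. -/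
lemma lowPart_le_of_factorsAmong (hC : IsSplitCat C)
    (hT : ∀ i, IsSimpleReps (TwistedGroupAlg α (e i)) (T i)) (p : Weight e l)
    [IsNoetherian (TwistedAlg α) P]
    {π : P →ₗ[TwistedAlg α] Head (TwistedAlg α) (Delta α (e p.1) (T p.1 p.2))}
    (hπ : IsProjectiveCover π) (hy : ∀ z, ι z • y = z) (K : Submodule (TwistedAlg α) P)
    (hK : FactorsAmong (TwistedAlg α)
      (fun p : Weight e l => Head (TwistedAlg α) (Delta α (e p.1) (T p.1 p.2))) {q | q < p}
      (Module.jacobson (TwistedAlg α) (P ⧸ K))) : lowPart r ι (r.ord p.1) ≤ K := by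
  let A := TwistedAlg α
  have := head_delta_isSimpleModule (hT p.1) p.2
  have hne := lowPart_ne_top r hC hT p hπ.surjective hy
  have hcoat := LinearMap.isCoatom_ker_of_surjective hπ.surjective
  let V : Submodule A (P ⧸ K) := (lowPart r ι (r.ord p.1)).map K.mkQ
  let J := Module.jacobson A (P ⧸ K)
  -- Every maximal submodule of P/K pulls back to ker π, which contains the proper submodule J_m P,
  -- for m the number of p.
  have hV : V ≤ J := by
    refine le_sInf fun c hc => ?_
    rw [Submodule.map_le_iff_le_comap]
    have h1 : IsCoatom (c.comap K.mkQ) :=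
      (Submodule.isCoatom_comap_iff (Submodule.mkQ_surjective K)).2 hc
    rw [← ((h1.le_iff.1 (hπ.le_ker h1.1)).resolve_left hcoat.1)]
    exact hπ.le_ker hne
  by_contra hle
  have hbot : V.submoduleOf J ≠ ⊥ := by
    intro h
    apply hle
    intro z hz
    have hzV : K.mkQ z ∈ V := ⟨z, hz, rfl⟩
    have : (⟨K.mkQ z, hV hzV⟩ : J) ∈ V.submoduleOf J := hzV
    rw [h] at this
    exact (Submodule.Quotient.mk_eq_zero K).1 (congrArg Subtype.val this)
  -- V is Noetherian and nonzero, so it has a simple quotient V/L ≅ D_q with q < p. The number of q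
  -- exceeds that of p, so the ideal of number ord p kills D_q and maps V into L.
  obtain ⟨L, -, hL⟩ := exists_le_covBy_of_lt (bot_lt_iff_ne_bot.2 hbot)
  obtain ⟨q, hq, ⟨f⟩⟩ := hK L _ hL
  have hpq := r.pos_lt_pos (show JLT (jClass (e p.1).toMor) (jClass (e q.1).toMor) from hq)
  have hkill : ∀ a ∈ lowIdeal α r (r.ord p.1), ∀ z ∈ V.submoduleOf J, a • z ∈ L := by
    intro a ha z hz
    exact Submodule.smul_mem_of_quot_submoduleOf_equiv f
      (fun d => lowIdeal_smul_head r hC _ _ (lowIdeal_mono r hpq.le ha) d) hz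
  refine hL.lt.not_ge ?_
  rintro ⟨_, hzJ⟩ ⟨z, hz, rfl⟩
  -- By idempotence of this ideal, V is its product with V, hence contained in L: a contradiction.
  have key : lowIdeal α r (r.ord p.1) ≤ (L.map J.subtype).comap
      (LinearMap.toSpanSingleton A (P ⧸ K) (K.mkQ y)) := by
    refine lowIdeal_le_of_mul_mem r hC fun a ha b hb => ?_
    have hb' : K.mkQ (b • y) ∈ V := ⟨b • y, smul_mem_lowPart r hb y, rfl⟩
    refine ⟨a • ⟨K.mkQ (b • y), hV hb'⟩, hkill a ha _ hb', ?_⟩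
    change a • K.mkQ (b • y) = (a * b) • K.mkQ y
    rw [map_smul, mul_smul]
  obtain ⟨z', hz', hzz'⟩ := key hz
  change z'.1 = ι z • K.mkQ y at hzz'
  rw [← map_smul, hy] at hzz'
  rwa [show (⟨K.mkQ z, hzJ⟩ : J) = z' from Subtype.ext hzz'.symm]

/-- A cover is found inside A, which maps onto D_p by a ↦ ae'z; the required K is the submodule J_m
P, with m the number of p. -/
lemma delta_isStandardModule (r : JRank e) (hC : IsSplitCat C)
    (hk : ∀ e : Idem C, (Nat.card e.Gam : k) ≠ 0)
    (hT : ∀ i, IsSimpleReps (TwistedGroupAlg α (e i)) (T i)) (p : Weight e l) :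
    IsStandardModule (TwistedAlg α)
      (fun p : Weight e l => Head (TwistedAlg α) (Delta α (e p.1) (T p.1 p.2))) p
      (Delta α (e p.1) (T p.1 p.2)) := by
  have := (hT p.1).simple p.2
  have := Inflation.isSimpleModule α (e p.1) (T p.1 p.2)
  have hne := Induced.exists_head_smul_ne_zero (idemElt_idem α (e p.1))
    (N := Inflation α (e p.1) (T p.1 p.2))
  obtain ⟨z, hz⟩ := id hne
  obtain ⟨N, hN⟩ := LinearMap.exists_isProjectiveCover
    (LinearMap.toSpanSingleton (TwistedAlg α) _ (idemElt α (e p.1) • z))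
    (IsSimpleModule.toSpanSingleton_surjective _ hz)
  obtain ⟨y, ι, hy, hι⟩ := hN.exists_retract hne
  obtain ⟨f⟩ := nonempty_quot_lowPart_equiv r hC hk hT p hN hy hι
  refine ⟨N, inferInstance, inferInstance, _, lowPart r ι (r.ord p.1), hN, ⟨?_, ?_⟩, ⟨f⟩⟩
  · exact (delta_factorsAmong r hC hT p).of_equiv f.jacobson.symm
  · intro K hK
    exact lowPart_le_of_factorsAmong r hC hT p hN hy K hK

end Main

end

theorem theorem4p2
    {C : Type u} [Category.{v} C] [Finite C] [∀ X Y : C, Finite (X ⟶ Y)] (hC : IsSplitCat C)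
    {k : Type w} [Field k] (α : TwoCocycle C k)
    (hk : ∀ e : Idem C, (Nat.card e.Gam : k) ≠ 0)
    {n : ℕ} (e : Fin n → Idem C) (he : IsIdemReps e)
    (l : Fin n → ℕ) (T : ∀ i, Fin (l i) → Type x)
    [∀ i r, AddCommGroup (T i r)] [∀ i r, Module (TwistedGroupAlg α (e i)) (T i r)]
    (hT : ∀ i, IsSimpleReps (TwistedGroupAlg α (e i)) (T i)) :
    let A := TwistedAlg α
    let Δ := fun p : Weight e l => Delta α (e p.1) (T p.1 p.2)
    let D := fun p : Weight e l => Head A (Δ p)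
    IsQuasiHereditary k A ∧
    IsSimpleReps A D ∧
    ∀ p : Weight e l,
      IsStandardModule A D p (Δ p) ∧
      FactorsAmong A D {q | q < p} (Module.jacobson A (Δ p)) ∧
      ∀ (P : Type y) [AddCommGroup P] [Module A P] (π : P →ₗ[A] D p),
        IsProjectiveCover π → HasStandardFiltration A Δ p P := by
  obtain ⟨r⟩ := nonempty_jRank hC he
  exact ⟨twistedAlg_isQuasiHereditary r hC hk, delta_isSimpleReps r hC hT, fun p =>
    ⟨delta_isStandardModule r hC hk hT p, delta_factorsAmong r hC hT p, fun P _ _ π hπ =>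
      hasStandardFiltration_of_isProjectiveCover r hC hk hT p hπ⟩⟩
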